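/- A link $L\subset\mathbb R^3$ is a finite disjoint union of simple closed curves (continuous injective images of the circle). For distinct points $x,y,z\in\mathbb R^3$ let $r(x,y,z)$ be the radius of the circle through them, with $r(x,y,z)=\infty$ if they are collinear, and define the thickness of $L$ as $$\tau(L)=\inf\{\,r(x,y,z) : x,y,z\in L \text{ pairwise distinct}\,\}.$$ The length $\operatorname{Len}$ of a curve is the supremum of the lengths of its inscribed polygons. The linking number of two disjoint oriented closed curves is given for $C^1$ curves by the Gauss linking integral, and for continuous curves by the common value of that integral on all pairs of $C^1$ closed curves whose parametrizations are uniformly close enough to theirs. Suppose $L$ is a link of unit thickness, i.e. $\tau(L)\ge 1$. Let $K$ be one component of $L$, let $J$ be the union of any collection of other components, and let $\operatorname{Lk}(J,K)$ denote the total linking number of $J$ and $K$, i.e. the sum of the linking numbers of the components of $J$ with $K$. Then, for every choice of orientations of the components, $$\operatorname{Len}(K)\ \ge\ 2\pi+2\pi\sqrt{|\operatorname{Lk}(J,K)|}.$$ -/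

import Mathlib

open scoped ENNReal

noncomputable section

/-- Euclidean three-space. -/
abbrev Space3 : Type := EuclideanSpace ℝ (Fin 3)

/-- A closed curve in space: a continuous map from the circle `ℝ / ℤ`. -/
abbrev ClosedCurve : Type := C(UnitAddCircle, Space3)

/-- The closed curve seen as a `1`-periodic function of a real parameter. -/
def ClosedCurve.lift (γ : ClosedCurve) (t : ℝ) : Space3 := γ (t : UnitAddCircle)

/-- The length of a closed curve: the supremum of the lengths of its inscribed polygons,
possibly `∞`. -/
def ClosedCurve.length (γ : ClosedCurve) : ℝ≥0∞ := eVariationOn γ.lift (Set.Icc 0 1)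

/-- A link in space, with an orientation of each component: finitely or infinitely many (according
to the index type) pairwise disjoint simple closed curves, each given by a parametrization.
Nothing beyond continuity is assumed of the curves; the orientation of a component is the one
induced by its parametrization. -/
structure OrientedLink (ι : Type*) where
  component : ι → ClosedCurve
  injective : ∀ i, Function.Injective (component i)
  disjoint : Pairwise fun i j => Disjoint (Set.range (component i)) (Set.range (component j))

/-- The underlying set of points of the link. -/
def OrientedLink.carrier {ι : Type*} (L : OrientedLink ι) : Set Space3 :=
  ⋃ i, Set.range (L.component i)

open Classical in
/-- The radius of the circle through three distinct points, which is `∞` if they are collinear. -/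
def circleRadius (x y z : Space3) : ℝ≥0∞ :=
  if h : AffineIndependent ℝ ![x, y, z] then
    ENNReal.ofReal (Affine.Simplex.circumradius (⟨![x, y, z], h⟩ : Affine.Simplex ℝ Space3 2))
  else ⊤

/-- The local thickness of a set `L` at a point `x`. -/
def localThickness (L : Set Space3) (x : Space3) : ℝ≥0∞ :=
  ⨅ (y ∈ L) (z ∈ L) (_ : x ≠ y) (_ : y ≠ z) (_ : z ≠ x), circleRadius x y z

/-- The thickness of a set `L`: the infimum of its local thicknesses. -/
def thickness (L : Set Space3) : ℝ≥0∞ := ⨅ x ∈ L, localThickness L x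

/-- The scalar triple product `u · (v × w)`. -/
def tripleProduct (u v w : Space3) : ℝ := Matrix.det (Matrix.of ![u.ofLp, v.ofLp, w.ofLp])

/-- The Gauss linking integral
`(1 / 4π) ∮ ∮ (γ(s) - δ(t)) · (γ'(s) × δ'(t)) / |γ(s) - δ(t)|³ dt ds`,
which is the linking number for disjoint closed curves of class `C¹`. -/
def gaussLinkingIntegral (p : ClosedCurve × ClosedCurve) : ℝ :=
  (1 / (4 * Real.pi)) * ∫ s in (0 : ℝ)..1, ∫ t in (0 : ℝ)..1,
    tripleProduct (p.1.lift s - p.2.lift t) (deriv p.1.lift s) (deriv p.2.lift t) /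
      ‖p.1.lift s - p.2.lift t‖ ^ 3

/-- The pairs of closed curves of class `C¹`. -/
def C1Pairs : Set (ClosedCurve × ClosedCurve) :=
  {p | ContDiff ℝ 1 p.1.lift ∧ ContDiff ℝ 1 p.2.lift}

/-- The linking number of two disjoint continuous closed curves: the extension of the Gauss
linking integral from pairs of `C¹` curves to pairs of continuous curves by continuity, in the
topology of uniform convergence. On pairs of disjoint `C¹` curves the Gauss integral is invariant
under homotopies that keep the two curves disjoint; so it has the same value on all the pairs of
`C¹` curves that are uniformly close enough to the given pair, and the linking number is this
value. It is the Gauss integral itself if both curves are `C¹`. -/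
def linkingNumber (γ δ : ClosedCurve) : ℝ := extendFrom C1Pairs gaussLinkingIntegral (γ, δ)

/-- The total linking number of a union `J` of components of the link with its component `k`. -/
def OrientedLink.totalLinkingNumber {ι : Type*} (L : OrientedLink ι) (J : Finset ι) (k : ι) : ℝ :=
  ∑ j ∈ J, linkingNumber (L.component j) (L.component k)

end

/-! Unit thickness has two consequences. Each component is a $C^{1,1}$ curve with curvature at most
one (`UnitThick.nonempty_unitSpeedLoop`). A point at distance less than one from one component is at
distance at least one from every other (`UnitSpeedLoop.one_le_infDist`), and the normal tubes of
every radius $r<1$ about a slightly smoothed component are embedded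
(`UnitSpeedLoop.exists_tube_injective`).

Span $K$ by the cone from a point $p$. If a component $K_j$ has linking number $n$ with $K$, so does
each curve parallel to $K_j$ in its tube, hence each of them crosses the cone at least $|n|$ times.
Averaging over the tube, the cone meets the tube in area at least $\pi|n|$
(`UnitSpeedLoop.abs_linkingNumber_le`). Intersection numbers are replaced by analysis: the kernel
$x/|x|^3$ of the Gauss integral is modified for $|x|<\varepsilon$ into the attraction of a
continuous ball of total mass $4\pi$. By the homotopy formula `gaussPairing_add_sub` the Gauss
integral becomes the integral of this mass density over cone times curve. After averaging over the
tube and changing variables, the inner integral is the mass inside the tube, at most $4\pi$.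

Choose $p$ so that the cone angle is exactly $2\pi$ (`UnitSpeedLoop.exists_coneAngle_eq`). The cone
then unrolls onto a plane region bounded by a curve of length $\ell=\operatorname{Len}(K)$, of area
at most $\ell^2/4\pi$ by the isoperimetric inequality (`integral_cross_le`). Unrolling does not
decrease distances to $K$ (`UnitSpeedLoop.norm_cone_sub_sq_le`), so the part of the cone in the
tubes, of area at least $\pi\Lambda$ with $\Lambda=\sum_j|\operatorname{Lk}(K_j,K)|$, stays at
distance at least one from the boundary, and its unit neighbourhood lies in the region.
Brunn–Minkowski (`sq_sqrt_add_sqrt_pi_le`) gives $(\sqrt{\pi\Lambda}+\sqrt\pi)^2\le\ell^2/4\pi$,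
that is, $\ell\ge 2\pi+2\pi\sqrt\Lambda$. For $\Lambda=0$ the bound $\ell\ge2\pi$ follows from the
curvature bound alone. -/

noncomputable section

open Set Filter Topology MeasureTheory

open scoped RealInnerProductSpace

/-! ### Unit thickness: Gram inequality, tangent directions, chords. -/

/-- All triangles with vertices in `L` have circumradius at least one, in the form of an inequality
between the Gram determinant and the product of the squared side lengths. -/
def UnitThick (L : Set Space3) : Prop :=
  ∀ x ∈ L, ∀ y ∈ L, ∀ z ∈ L, x ≠ y → y ≠ z → z ≠ x →
    4 * (‖y - x‖ ^ 2 * ‖z - x‖ ^ 2 - ⟪y - x, z - x⟫ ^ 2) ≤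
      ‖y - x‖ ^ 2 * ‖z - x‖ ^ 2 * ‖y - z‖ ^ 2

/-- By the law of sines the circumradius is the side $|y-z|$ divided by twice the sine of the
opposite angle, and that sine times the two other sides is the square root of the Gram determinant.
For collinear points the Gram determinant vanishes. -/
theorem gram_le_of_one_le_circleRadius {x y z : Space3} (h : 1 ≤ circleRadius x y z) :
    4 * (‖y - x‖ ^ 2 * ‖z - x‖ ^ 2 - ⟪y - x, z - x⟫ ^ 2) ≤
      ‖y - x‖ ^ 2 * ‖z - x‖ ^ 2 * ‖y - z‖ ^ 2 := by
  by_cases ha : AffineIndependent ℝ ![x, y, z]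
  · rw [circleRadius, dif_pos ha, ENNReal.one_le_ofReal] at h
    set t : Affine.Triangle ℝ Space3 := ⟨![x, y, z], ha⟩ with ht
    have key := Affine.Triangle.dist_div_sin_angle_div_two_eq_circumradius
      t (i₁ := 1) (i₂ := 0) (i₃ := 2) (by decide) (by decide) (by decide)
    have e0 : t.points 0 = x := rfl
    have e1 : t.points 1 = y := rfl
    have e2 : t.points 2 = z := rfl
    rw [e0, e1, e2] at key
    have hs := InnerProductGeometry.sin_angle_mul_norm_mul_norm (y - x) (z - x)
    have hsin : 0 ≤ Real.sin (EuclideanGeometry.angle y x z) :=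
      InnerProductGeometry.sin_angle_nonneg _ _
    have hang : EuclideanGeometry.angle y x z = InnerProductGeometry.angle (y - x) (z - x) := rfl
    rw [← hang] at hs
    set σ := Real.sin (EuclideanGeometry.angle y x z)
    rw [← key] at h
    -- With `σ = 0` the quotient in `h` would be zero, by the convention for division by zero.
    have hσ : 0 < σ := by
      rcases hsin.lt_or_eq with h0 | h0
      · exact h0
      · rw [← h0] at h; norm_num at h
    have h2 : 2 * σ ≤ ‖y - z‖ := by
      rw [dist_eq_norm, div_div, le_div_iff₀ (by positivity)] at h
      linarith
    have hG : 0 ≤ ⟪y - x, y - x⟫ * ⟪z - x, z - x⟫ - ⟪y - x, z - x⟫ * ⟪y - x, z - x⟫ := by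
      linarith [real_inner_mul_inner_self_le (y - x) (z - x)]
    have hs2 : (σ * (‖y - x‖ * ‖z - x‖)) ^ 2 =
        ‖y - x‖ ^ 2 * ‖z - x‖ ^ 2 - ⟪y - x, z - x⟫ ^ 2 := by
      rw [hs, Real.sq_sqrt hG, real_inner_self_eq_norm_sq, real_inner_self_eq_norm_sq]; ring
    rw [← hs2]
    have h3 : (2 * σ) ^ 2 ≤ ‖y - z‖ ^ 2 := by gcongr
    nlinarith [mul_le_mul_of_nonneg_left h3 (sq_nonneg (‖y - x‖ * ‖z - x‖))]
  · rw [affineIndependent_iff_not_collinear_set, not_not,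
      collinear_iff_of_mem (p₀ := x) (by simp)] at ha
    obtain ⟨v, hv⟩ := ha
    obtain ⟨r, hr⟩ := hv y (by simp)
    obtain ⟨q, hq⟩ := hv z (by simp)
    have h1 : y - x = r • v := by rw [hr]; simp
    have h2 : z - x = q • v := by rw [hq]; simp
    have : ‖y - x‖ ^ 2 * ‖z - x‖ ^ 2 - ⟪y - x, z - x⟫ ^ 2 = 0 := by
      rw [h1, h2, norm_smul, norm_smul, real_inner_smul_left, real_inner_smul_right,
        real_inner_self_eq_norm_sq, Real.norm_eq_abs, Real.norm_eq_abs, mul_pow, mul_pow,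
        sq_abs, sq_abs]
      ring
    rw [this, mul_zero]; positivity

theorem unitThick_of_one_le_thickness {L : Set Space3} (h : 1 ≤ thickness L) : UnitThick L := by
  intro x hx y hy z hz hxy hyz hzx
  apply gram_le_of_one_le_circleRadius
  refine h.trans ?_
  refine (iInf₂_le x hx).trans ?_
  refine (iInf₂_le y hy).trans ?_
  refine (iInf₂_le z hz).trans ?_
  exact (iInf_le _ hxy).trans ((iInf_le _ hyz).trans (iInf_le _ hzx))

/-- `T` spans the tangent line at `y`: every circle through `y` tangent to `T` and through
another point of `L` has radius at least one. -/
def IsTangentAt (L : Set Space3) (y T : Space3) : Prop :=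
  ∀ z ∈ L, 4 * (‖z - y‖ ^ 2 - ⟪T, z - y⟫ ^ 2) ≤ ‖z - y‖ ^ 4

/-- Secant directions from `y` have a convergent subsequence. Dividing the triangle inequality for
`y`, `u n`, `z` by $|u_n-y|^2$ and passing to the limit replaces circles through three points by
circles tangent at `y`. -/
theorem UnitThick.exists_tangent {L : Set Space3} (hL : UnitThick L) {y : Space3} (hy : y ∈ L)
    {u : ℕ → Space3} (hu : ∀ n, u n ∈ L) (huy : ∀ n, u n ≠ y) (hlim : Tendsto u atTop (𝓝 y)) :
    ∃ T : Space3, ‖T‖ = 1 ∧ IsTangentAt L y T := by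
  set d : ℕ → Space3 := fun n => ‖u n - y‖⁻¹ • (u n - y) with hd
  have hn : ∀ n, ‖u n - y‖ ≠ 0 := fun n => by simpa [sub_eq_zero] using huy n
  have hmem : ∀ n, d n ∈ Metric.sphere (0 : Space3) 1 := fun n => by
    simp [hd, norm_smul, hn n]
  obtain ⟨T, hT, φ, hφ, hφT⟩ := (isCompact_sphere (0 : Space3) 1).tendsto_subseq hmem
  refine ⟨T, by simpa using hT, fun z hz => ?_⟩
  by_cases hzy : z = y
  · simp [hzy]
  have hlim' : Tendsto (fun n => u (φ n)) atTop (𝓝 y) := hlim.comp hφ.tendsto_atTop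
  have hev : ∀ᶠ n in atTop, u (φ n) ≠ z := hlim'.eventually_ne (Ne.symm hzy)
  have h1 : ∀ᶠ n in atTop, 4 * (‖z - y‖ ^ 2 - ⟪d (φ n), z - y⟫ ^ 2) ≤
      ‖z - y‖ ^ 2 * ‖u (φ n) - z‖ ^ 2 := by
    filter_upwards [hev] with n hn'
    have h := hL y hy (u (φ n)) (hu _) z hz (huy _).symm hn' hzy
    have hpos : 0 < ‖u (φ n) - y‖ ^ 2 := by have := hn (φ n); positivity
    have e : ⟪u (φ n) - y, z - y⟫ = ‖u (φ n) - y‖ * ⟪d (φ n), z - y⟫ := by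
      rw [hd]; simp only [real_inner_smul_left]; field_simp [hn (φ n)]
    rw [e] at h
    have : ‖u (φ n) - y‖ ^ 2 * (4 * (‖z - y‖ ^ 2 - ⟪d (φ n), z - y⟫ ^ 2)) ≤
      ‖u (φ n) - y‖ ^ 2 * (‖z - y‖ ^ 2 * ‖u (φ n) - z‖ ^ 2) := by nlinarith
    exact le_of_mul_le_mul_left this hpos
  have h2 : Tendsto (fun n => 4 * (‖z - y‖ ^ 2 - ⟪d (φ n), z - y⟫ ^ 2)) atTop
      (𝓝 (4 * (‖z - y‖ ^ 2 - ⟪T, z - y⟫ ^ 2))) :=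
    (((hφT.inner tendsto_const_nhds).pow 2).const_sub _).const_mul _
  have h3 : Tendsto (fun n => ‖z - y‖ ^ 2 * ‖u (φ n) - z‖ ^ 2) atTop
      (𝓝 (‖z - y‖ ^ 2 * ‖y - z‖ ^ 2)) := (((hlim'.sub_const z).norm).pow 2).const_mul _
  refine (le_of_tendsto_of_tendsto h2 h3 h1).trans_eq ?_
  rw [norm_sub_rev y z]; ring

/-- The component of `v` orthogonal to a unit vector. -/
theorem norm_sub_inner_smul_sq {T : Space3} (hT : ‖T‖ = 1) (v : Space3) :
    ‖v - ⟪T, v⟫ • T‖ ^ 2 = ‖v‖ ^ 2 - ⟪T, v⟫ ^ 2 := by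
  rw [norm_sub_sq_real, norm_smul, real_inner_smul_right, hT, Real.norm_eq_abs, mul_one, sq_abs,
    real_inner_comm v T]
  ring

theorem norm_sub_inner_smul_le {T : Space3} (hT : ‖T‖ = 1) (v : Space3) :
    ‖v - ⟪T, v⟫ • T‖ ≤ ‖v‖ := by
  have := norm_sub_inner_smul_sq hT v
  exact le_of_sq_le_sq (by nlinarith [sq_nonneg ⟪T, v⟫]) (norm_nonneg _)

/-- Chords between points of `L` close to `a` are almost parallel to the tangent at `a`. -/
theorem UnitThick.chord_near {L : Set Space3} (hL : UnitThick L) {a T : Space3} (ha : a ∈ L)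
    (hT : ‖T‖ = 1) (hTa : IsTangentAt L a T) {ε : ℝ} {x y : Space3} (hx : x ∈ L)
    (hy : y ∈ L) (hxa : ‖x - a‖ ≤ ε) (hya : ‖y - a‖ ≤ ε) :
    (1 - ε ^ 2) * ‖y - x‖ ^ 2 ≤ ⟪T, y - x⟫ ^ 2 := by
  have hε : 0 ≤ ε := (norm_nonneg _).trans hxa
  have base : ∀ z ∈ L, ‖z - a‖ ≤ ε → (1 - ε ^ 2) * ‖z - a‖ ^ 2 ≤ ⟪T, z - a⟫ ^ 2 := by
    intro z hz hza
    have h1 := hTa z hz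
    have h2 : ‖z - a‖ ^ 2 ≤ ε ^ 2 := by gcongr
    nlinarith [mul_le_mul_of_nonneg_left h2 (sq_nonneg ‖z - a‖)]
  by_cases hxa' : x = a
  · subst hxa'; exact base y hy hya
  by_cases hya' : y = a
  · subst hya'
    have := base x hx hxa
    rw [norm_sub_rev, ← neg_sub x y, inner_neg_right, neg_sq]; exact this
  by_cases hxy : x = y
  · subst hxy; simp
  have h := hL x hx y hy a ha hxy hya' (Ne.symm hxa')
  set v := y - x with hv
  set w := a - x with hw
  have hwpos : 0 < ‖w‖ := norm_pos_iff.2 (sub_ne_zero.2 (Ne.symm hxa'))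
  -- Split `v` into its projection `c • w` on the direction of `a - x` and a remainder. The triangle
  -- `x`, `y`, `a` bounds the remainder by $\varepsilon|v|/2$, tangency at `a` bounds the normal
  -- part of `w` by $\varepsilon|w|/2$; together the part of `v` normal to `T` is at most
  -- $\varepsilon|v|$.
  set c := ⟪v, w⟫ / ‖w‖ ^ 2 with hc
  have hwε : ‖w‖ ≤ ε := by rw [hw, norm_sub_rev]; exact hxa
  have hcw : |c| * ‖w‖ ≤ ‖v‖ := by
    rw [hc, abs_div, abs_of_nonneg (sq_nonneg ‖w‖), div_mul_eq_mul_div, div_le_iff₀ (by positivity)]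
    nlinarith [abs_real_inner_le_norm v w, mul_le_mul_of_nonneg_right (abs_real_inner_le_norm v w) hwpos.le]
  have e1 : ‖v - c • w‖ ^ 2 * (4 * ‖w‖ ^ 2) = 4 * (‖v‖ ^ 2 * ‖w‖ ^ 2 - ⟪v, w⟫ ^ 2) := by
    rw [norm_sub_sq_real, norm_smul, real_inner_smul_right, Real.norm_eq_abs, mul_pow, sq_abs, hc]
    field_simp; ring
  have e2 : 2 * ‖v - c • w‖ ≤ ‖v‖ * ε := by
    apply le_of_sq_le_sq _ (by positivity)
    have h5 : ‖y - a‖ ^ 2 ≤ ε ^ 2 := by gcongr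
    have h6 : ‖v - c • w‖ ^ 2 * (4 * ‖w‖ ^ 2) ≤ (‖v‖ ^ 2 * ε ^ 2) * ‖w‖ ^ 2 := by
      rw [e1]
      refine h.trans ?_
      nlinarith [mul_le_mul_of_nonneg_left h5 (mul_nonneg (sq_nonneg ‖v‖) (sq_nonneg ‖w‖))]
    have h7 : 0 < ‖w‖ ^ 2 := by positivity
    nlinarith [le_of_mul_le_mul_right (show (4 * ‖v - c • w‖ ^ 2) * ‖w‖ ^ 2 ≤
      (‖v‖ ^ 2 * ε ^ 2) * ‖w‖ ^ 2 by linarith) h7]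
  have e3 : 2 * ‖w - ⟪T, w⟫ • T‖ ≤ ‖w‖ * ε := by
    have h8 := hTa x hx
    have h9 : ‖w‖ = ‖x - a‖ := by rw [hw, norm_sub_rev]
    have h10 : ⟪T, w⟫ ^ 2 = ⟪T, x - a⟫ ^ 2 := by
      rw [hw, ← neg_sub x a, inner_neg_right, neg_sq]
    apply le_of_sq_le_sq _ (by positivity)
    have h11 := norm_sub_inner_smul_sq hT w
    rw [h9, h10] at h11
    rw [mul_pow, h11, h9]
    have h5 : ‖x - a‖ ^ 2 ≤ ε ^ 2 := by gcongr
    nlinarith [mul_le_mul_of_nonneg_left h5 (sq_nonneg ‖x - a‖)]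
  have e4 : ‖v - ⟪T, v⟫ • T‖ ≤ ε * ‖v‖ := by
    have : v - ⟪T, v⟫ • T = ((v - c • w) - ⟪T, v - c • w⟫ • T) + c • (w - ⟪T, w⟫ • T) := by
      rw [inner_sub_right T v, inner_smul_right]; module
    rw [this]
    refine (norm_add_le _ _).trans ?_
    rw [norm_smul, Real.norm_eq_abs]
    have h12 := norm_sub_inner_smul_le hT (v - c • w)
    have h13 : |c| * (2 * ‖w - ⟪T, w⟫ • T‖) ≤ |c| * (‖w‖ * ε) := by gcongr
    nlinarith [mul_le_mul_of_nonneg_right hcw hε]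
  have e5 := norm_sub_inner_smul_sq hT v
  have e6 : ‖v - ⟪T, v⟫ • T‖ ^ 2 ≤ (ε * ‖v‖) ^ 2 := by gcongr
  nlinarith

/-! ### Closed curves as periodic functions; forward tangents. -/

theorem ClosedCurve.continuous_lift (γ : ClosedCurve) : Continuous γ.lift :=
  γ.continuous.comp (AddCircle.continuous_mk' 1)

theorem ClosedCurve.lift_periodic (γ : ClosedCurve) : Function.Periodic γ.lift 1 := fun t => by
  simp [ClosedCurve.lift]

theorem ClosedCurve.lift_injOn {γ : ClosedCurve} (hγ : Function.Injective γ) {s t : ℝ}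
    (h : γ.lift s = γ.lift t) (hst : |s - t| < 1) : s = t := by
  have h1 : (s : UnitAddCircle) = t := hγ h
  rw [← sub_eq_zero, ← AddCircle.coe_sub, AddCircle.coe_eq_zero_iff] at h1
  obtain ⟨n, hn⟩ := h1
  have h2 : (n : ℝ) = s - t := by simpa using hn
  rw [← h2] at hst
  have h3 : n = 0 := by
    have : |n| < 1 := by exact_mod_cast hst
    exact Int.abs_lt_one_iff.1 this
  rw [h3] at h2; simp at h2; linarith

theorem ClosedCurve.range_lift (γ : ClosedCurve) : range γ.lift = range γ := by
  ext x; constructor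
  · rintro ⟨t, rfl⟩; exact ⟨_, rfl⟩
  · rintro ⟨t, rfl⟩
    obtain ⟨s, rfl⟩ := QuotientAddGroup.mk_surjective t
    exact ⟨s, rfl⟩

/-- Near each parameter, a simple closed curve in a set of unit thickness moves forward in the
direction of a tangent vector. -/
theorem UnitThick.exists_forward_tangent {L : Set Space3} (hL : UnitThick L) {γ : ClosedCurve}
    (hγ : Function.Injective γ) (hγL : range γ ⊆ L) (t₀ : ℝ) :
    ∃ T : Space3, ‖T‖ = 1 ∧ IsTangentAt L (γ.lift t₀) T ∧ ∀ η > 0, ∃ δ > 0, ∀ t t',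
      t₀ - δ < t → t ≤ t' → t' < t₀ + δ →
        ‖γ.lift t' - γ.lift t‖ ≤ (1 + η) * ⟪T, γ.lift t' - γ.lift t⟫ := by
  have hmem : ∀ t, γ.lift t ∈ L := fun t => hγL (γ.range_lift ▸ mem_range_self t)
  obtain ⟨T, hT, hTa⟩ := hL.exists_tangent (hmem t₀) (u := fun n : ℕ => γ.lift (t₀ + 1 / (n + 2)))
    (fun n => hmem _)
    (fun n h => by
      have h0 : (0 : ℝ) < 1 / (n + 2) := by positivity
      have h1 : (1 : ℝ) / (n + 2) < 1 := by
        rw [div_lt_one (by positivity)]; have : (0 : ℝ) ≤ n := by positivity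
        linarith
      have := ClosedCurve.lift_injOn hγ h (by rw [add_sub_cancel_left, abs_of_pos h0]; exact h1)
      linarith)
    (by
      have h0 : Tendsto (fun n : ℕ => t₀ + 1 / ((n : ℝ) + 2)) atTop (𝓝 (t₀ + 0)) := by
        refine tendsto_const_nhds.add ?_
        have := (tendsto_one_div_add_atTop_nhds_zero_nat (𝕜 := ℝ)).comp (tendsto_add_atTop_nat 1)
        refine this.congr fun n => ?_
        simp; ring
      rw [add_zero] at h0
      exact (γ.continuous_lift.tendsto t₀).comp h0)
  have near : ∀ ε > 0, ∃ δ > 0, ∀ t, |t - t₀| < δ → ‖γ.lift t - γ.lift t₀‖ < ε := by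
    intro ε hε
    obtain ⟨δ, hδ, h⟩ := Metric.continuous_iff.1 γ.continuous_lift t₀ ε hε
    exact ⟨δ, hδ, fun t ht => by rw [← dist_eq_norm]; exact h t (by rwa [Real.dist_eq])⟩
  obtain ⟨δ₁, hδ₁, h₁⟩ := near (1 / 2) (by norm_num)
  set δ₀ := min δ₁ (1 / 2) with hδ₀
  have hδ₀pos : 0 < δ₀ := by positivity
  have habs : ∀ t, t₀ - δ₀ < t → t < t₀ + δ₀ → |t - t₀| < δ₀ := fun t h h' => by
    rw [abs_lt]; constructor <;> linarith
  -- By the chord estimate with `ε = 1 / 2`, a short chord orthogonal to `T` has length zero. So the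
  -- height along `T` is injective near `t₀`, hence strictly monotone by continuity, and increasing
  -- after replacing `T` by `-T` if necessary.
  have hinj : InjOn (fun t => ⟪T, γ.lift t⟫) (Ioo (t₀ - δ₀) (t₀ + δ₀)) := by
    intro s hs t ht hst
    have hs' := habs s hs.1 hs.2
    have ht' := habs t ht.1 ht.2
    have hc := hL.chord_near (hmem t₀) hT hTa (hmem s) (hmem t)
      (h₁ s (hs'.trans_le (min_le_left _ _))).le (h₁ t (ht'.trans_le (min_le_left _ _))).le
    have h0 : ⟪T, γ.lift t - γ.lift s⟫ = 0 := by
      rw [inner_sub_right]; simp only at hst; linarith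
    rw [h0] at hc
    have h2 : ‖γ.lift t - γ.lift s‖ ^ 2 ≤ 0 := by nlinarith
    have h3 : γ.lift t - γ.lift s = 0 := by
      have : ‖γ.lift t - γ.lift s‖ = 0 := pow_eq_zero_iff (two_ne_zero) |>.1 (le_antisymm h2 (sq_nonneg _))
      exact norm_eq_zero.1 this
    refine ClosedCurve.lift_injOn hγ (sub_eq_zero.1 h3).symm ?_
    have : δ₀ ≤ 1 / 2 := min_le_right _ _
    rw [abs_lt] at hs' ht' ⊢; constructor <;> linarith
  have hcont : ContinuousOn (fun t => ⟪T, γ.lift t⟫) (Ioo (t₀ - δ₀) (t₀ + δ₀)) :=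
    (continuous_const.inner γ.continuous_lift).continuousOn
  obtain ⟨S, hS, hSa, hmono⟩ : ∃ S : Space3, ‖S‖ = 1 ∧ IsTangentAt L (γ.lift t₀) S ∧
      StrictMonoOn (fun t => ⟪S, γ.lift t⟫) (Ioo (t₀ - δ₀) (t₀ + δ₀)) := by
    rcases hcont.strictMonoOn_of_injOn_Ioo (by linarith) hinj with h | h
    · exact ⟨T, hT, hTa, h⟩
    · refine ⟨-T, by rwa [norm_neg], fun z hz => ?_, fun s hs t ht hst => ?_⟩
      · rw [inner_neg_left, neg_sq]; exact hTa z hz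
      · have := h hs ht hst
        simp only [inner_neg_left] at this ⊢; linarith
  refine ⟨S, hS, hSa, fun η hη => ?_⟩
  -- The witness solves $(1+\eta)^2(1-\varepsilon^2)=1$, which turns the squared chord estimate into
  -- the desired one.
  obtain ⟨ε, hε, hε1⟩ : ∃ ε > 0, 1 ≤ (1 + η) ^ 2 * (1 - ε ^ 2) := by
    refine ⟨√(1 - 1 / (1 + η) ^ 2), ?_, ?_⟩
    · apply Real.sqrt_pos.2
      rw [sub_pos, div_lt_one (by positivity)]; nlinarith
    · rw [Real.sq_sqrt]
      · field_simp; linarith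
      · rw [sub_nonneg, div_le_one (by positivity)]; nlinarith
  obtain ⟨δ₂, hδ₂, h₂⟩ := near ε hε
  refine ⟨min δ₀ δ₂, by positivity, fun t t' ht htt ht' => ?_⟩
  have hm0 : min δ₀ δ₂ ≤ δ₀ := min_le_left _ _
  have hm2 : min δ₀ δ₂ ≤ δ₂ := min_le_right _ _
  have hc := hL.chord_near (hmem t₀) hS hSa (hmem t) (hmem t')
    (h₂ t (by rw [abs_lt]; constructor <;> linarith)).le
    (h₂ t' (by rw [abs_lt]; constructor <;> linarith)).le
  have hpos : 0 ≤ ⟪S, γ.lift t' - γ.lift t⟫ := by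
    rw [inner_sub_right, sub_nonneg]
    exact hmono.monotoneOn ⟨by linarith, by linarith⟩ ⟨by linarith, by linarith⟩ htt
  apply le_of_sq_le_sq _ (by positivity)
  rw [mul_pow]
  nlinarith [mul_le_mul_of_nonneg_left hc (sq_nonneg (1 + η)),
    mul_le_mul_of_nonneg_right hε1 (sq_nonneg ‖γ.lift t' - γ.lift t‖)]

/-- A one-sided infinitesimal Lipschitz bound with constants arbitrarily close to one integrates to
the constant one. It upgrades the local comparison of tangents to the exact curvature bound. -/
theorem norm_sub_le_of_eventually_right {E : Type*} [NormedAddCommGroup E] {f : ℝ → E}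
    (hf : Continuous f)
    (h : ∀ x, ∀ η > 0, ∀ᶠ z in 𝓝[>] x, ‖f z - f x‖ ≤ (1 + η) * (z - x)) {x y : ℝ} (hxy : x ≤ y) :
    ‖f y - f x‖ ≤ y - x := by
  refine le_of_forall_pos_le_add fun ε hε => ?_
  obtain ⟨η, hη, hηε⟩ : ∃ η > 0, (1 + η) * (y - x) ≤ y - x + ε := by
    refine ⟨ε / (y - x + 1), by have := sub_nonneg.2 hxy; positivity, ?_⟩
    have h0 := sub_nonneg.2 hxy
    have : ε / (y - x + 1) * (y - x) ≤ ε := by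
      rw [div_mul_eq_mul_div, div_le_iff₀ (by positivity)]; nlinarith
    linarith
  refine le_trans ?_ hηε
  have key := image_norm_le_of_liminf_right_slope_norm_lt_deriv_boundary
    (f := fun z => f z - f x) (f' := fun _ => 1) (a := x) (b := y)
    (B := fun z => (1 + η) * (z - x)) (B' := fun _ => 1 + η)
    (by fun_prop)
    (fun u hu r hr => by
      apply Eventually.frequently
      filter_upwards [h u ((r - 1) / 2) (by linarith), self_mem_nhdsWithin] with z hz hzu
      have hzu' : 0 < z - u := sub_pos.2 hzu
      rw [slope_def_field, div_lt_iff₀ hzu']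
      have h1 : ‖f z - f x‖ - ‖f u - f x‖ ≤ ‖f z - f u‖ := by
        have := norm_sub_norm_le (f z - f x) (f u - f x)
        rwa [sub_sub_sub_cancel_right] at this
      simp only [Function.comp]
      nlinarith)
    (by simp) (by fun_prop)
    (fun u _ => by
      have := ((hasDerivAt_id u).sub_const x).const_mul (1 + η)
      simpa using this.hasDerivWithinAt)
    (fun u _ _ => by linarith)
  exact key (right_mem_Icc.2 hxy)

/-! ### Rectifiability and arc-length parametrization with 1-Lipschitz tangent. -/

/-- A unit-speed parametrization of a simple closed curve contained in a set `L` of unit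
thickness. -/
structure UnitSpeedLoop (L : Set Space3) (γ : ClosedCurve) where
  J : ℝ → Space3
  T : ℝ → Space3
  ℓ : ℝ
  s : ℝ → ℝ
  pos : 0 < ℓ
  continuous_s : Continuous s
  s_add_one : ∀ t, s (t + 1) = s t + ℓ
  lift_eq : ∀ t, γ.lift t = J (s t)
  periodic : Function.Periodic J ℓ
  hasDerivAt : ∀ x, HasDerivAt J (T x) x
  norm_T : ∀ x, ‖T x‖ = 1
  lipschitz_T : ∀ x y, ‖T x - T y‖ ≤ |x - y|
  length_eq : γ.length = ENNReal.ofReal ℓ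
  tangent : ∀ x, IsTangentAt L (J x) (T x)
  inj : ∀ x y, J x = J y → |x - y| < ℓ → x = y
  surj : ∀ x, ∃ t, s t = x

/-- Since $1-c^2=(1-c)(1+c)$ for $c=\langle T,e\rangle$, the Gram bound gives $|T-e|^2=2(1-c)\le
h^2/(2(1+c))$, which is close to $(h/2)^2$ when $c$ is close to one. So a tangent deviates from a
chord by about half the chord length; adding both ends gives Lipschitz constant one. -/
theorem norm_sub_le_of_gram_le {E : Type*} [NormedAddCommGroup E] [InnerProductSpace ℝ E]
    {T e : E} (hT : ‖T‖ = 1) (he : ‖e‖ = 1) {h η c₀ : ℝ} (hh : 0 ≤ h) (hη : 0 ≤ η)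
    (hg : 4 * (1 - ⟪T, e⟫ ^ 2) ≤ h ^ 2) (hc : c₀ ≤ ⟪T, e⟫)
    (hc₀ : 0 < 1 + c₀) (hηc : 2 ≤ (1 + η) ^ 2 * (1 + c₀)) :
    ‖T - e‖ ≤ (1 + η) * (h / 2) := by
  apply le_of_sq_le_sq _ (by positivity)
  have e1 : ‖T - e‖ ^ 2 = 2 * (1 - ⟪T, e⟫) := by rw [norm_sub_sq_real, hT, he]; ring
  set c := ⟪T, e⟫
  have hc1 : c ≤ 1 := by nlinarith [sq_nonneg ‖T - e‖]
  have h2 : 4 * (1 - c) * (1 + c₀) ≤ h ^ 2 := by nlinarith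
  have h3 : ‖T - e‖ ^ 2 * (1 + c₀) ≤ ((1 + η) * (h / 2)) ^ 2 * (1 + c₀) := by
    rw [e1]; nlinarith [mul_le_mul_of_nonneg_right hηc (sq_nonneg h)]
  exact le_of_mul_le_mul_right h3 hc₀

theorem eVariationOn_Icc_le_of_norm_le {E : Type*} [NormedAddCommGroup E] {f : ℝ → E} {g : ℝ → ℝ}
    {a b : ℝ} (hab : a ≤ b)
    (h : ∀ x y, a ≤ x → x ≤ y → y ≤ b → ‖f y - f x‖ ≤ g y - g x) :
    eVariationOn f (Icc a b) ≤ ENNReal.ofReal (g b - g a) := by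
  have hg : MonotoneOn g (Icc a b) := fun x hx y hy hxy => by
    linarith [h x y hx.1 hxy hy.2, norm_nonneg (f y - f x)]
  have e := hg.eVariationOn_eq (left_mem_Icc.2 hab) (right_mem_Icc.2 hab)
  rw [inter_self] at e
  rw [← e]
  refine iSup_mono fun p => Finset.sum_le_sum fun i _ => ?_
  have hi := p.2.2.2 i
  have hi' := p.2.2.2 (i + 1)
  have hm := p.2.2.1 (Nat.le_succ i)
  rw [edist_dist, edist_dist, dist_eq_norm]
  apply ENNReal.ofReal_le_ofReal
  exact (h _ _ hi.1 hm hi'.2).trans (le_abs_self _)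

/-- By compactness an interval is cut into finitely many pieces, each inside one of the windows. -/
theorem locallyBoundedVariationOn_of_local {E : Type*} [NormedAddCommGroup E] {f : ℝ → E}
    (h : ∀ t : ℝ, ∃ δ > 0, ∀ a b, t - δ < a → a ≤ b → b < t + δ →
      eVariationOn f (Icc a b) ≠ ∞) :
    LocallyBoundedVariationOn f univ := by
  intro a b _ _
  rcases lt_or_ge b a with hab | hab
  · rw [Icc_eq_empty (not_le.2 hab), inter_empty]
    simp [BoundedVariationOn]
  choose δ hδ hbd using h
  obtain ⟨u, hu0, hum, ⟨m, hm⟩, hc⟩ := exists_monotone_Icc_subset_open_cover_Icc hab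
    (c := fun t : ℝ => (Subtype.val ⁻¹' (Ioo (t - δ t) (t + δ t)) : Set (Icc a b)))
    (fun t => isOpen_Ioo.preimage continuous_subtype_val)
    (fun x _ => mem_iUnion.2 ⟨x.1, by simp [hδ x.1]⟩)
  have hsum := eVariationOn.sum' f (I := fun n => (u n : ℝ)) (fun i j hij => hum hij) (n := m)
  rw [hu0, hm m le_rfl] at hsum
  rw [BoundedVariationOn, univ_inter, ← hsum]
  refine (ENNReal.sum_lt_top.2 fun i _ => ?_).ne
  obtain ⟨t, ht⟩ := hc i
  have h1 := ht (left_mem_Icc.2 (hum (Nat.le_succ i)))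
  have h2 := ht (right_mem_Icc.2 (hum (Nat.le_succ i)))
  exact (hbd t _ _ h1.1 (hum (Nat.le_succ i)) h2.2).lt_top

theorem eVariationOn_Icc_add_const {E : Type*} [PseudoEMetricSpace E] {f : ℝ → E} {c : ℝ}
    (hf : Function.Periodic f c) (a b : ℝ) :
    eVariationOn f (Icc (a + c) (b + c)) = eVariationOn f (Icc a b) := by
  have := eVariationOn.comp_eq_of_monotoneOn f (t := Icc a b) (fun x => x + c)
    (fun x _ y _ h => by simpa using h)
  rw [image_add_const_Icc] at this
  rw [← this]
  congr 1
  ext x; exact hf x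

/-- Near each parameter the arc length is at most `1 + η` times the height gained along the tangent.
Hence the curve is rectifiable and its arc length `s` is an increasing homeomorphism of the line;
`J` is the curve composed with the inverse of `s`. The same comparison shows that `J` is strictly
differentiable, so `T` is continuous, and tangency at both ends of a short chord makes `T` Lipschitz
with constant one. -/
theorem UnitThick.nonempty_unitSpeedLoop {L : Set Space3} (hL : UnitThick L) {γ : ClosedCurve}
    (hγ : Function.Injective γ) (hγL : range γ ⊆ L) : Nonempty (UnitSpeedLoop L γ) := by
  choose T₀ hT₀ hTan hfwd using hL.exists_forward_tangent hγ hγL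
  have hvar : ∀ t₀, ∀ η > 0, ∃ δ > 0, ∀ t t', t₀ - δ < t → t ≤ t' → t' < t₀ + δ →
      eVariationOn γ.lift (Icc t t') ≤
        ENNReal.ofReal ((1 + η) * ⟪T₀ t₀, γ.lift t' - γ.lift t⟫) := by
    intro t₀ η hη
    obtain ⟨δ, hδ, h⟩ := hfwd t₀ η hη
    refine ⟨δ, hδ, fun t t' ht htt ht' => ?_⟩
    have := eVariationOn_Icc_le_of_norm_le (f := γ.lift)
      (g := fun x => (1 + η) * ⟪T₀ t₀, γ.lift x⟫) htt (fun x y hx hxy hy => by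
        rw [← mul_sub, ← inner_sub_right]
        exact h x y (by linarith) hxy (by linarith))
    rwa [← mul_sub, ← inner_sub_right] at this
  have hbv : LocallyBoundedVariationOn γ.lift univ := by
    refine locallyBoundedVariationOn_of_local fun t => ?_
    obtain ⟨δ, hδ, h⟩ := hvar t 1 one_pos
    exact ⟨δ, hδ, fun a b ha hab hb => ((h a b ha hab hb).trans_lt ENNReal.ofReal_lt_top).ne⟩
  set s : ℝ → ℝ := variationOnFromTo γ.lift univ 0 with hs
  have hsub : ∀ t t', t ≤ t' → s t' - s t = (eVariationOn γ.lift (Icc t t')).toReal := by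
    intro t t' h
    rw [hs, variationOnFromTo.sub_right hbv (mem_univ _) (mem_univ _) (mem_univ _),
      variationOnFromTo.eq_of_le _ _ h, univ_inter]
  have hfin : ∀ t t', eVariationOn γ.lift (Icc t t') ≠ ∞ := fun t t' => by
    have := hbv t t' (mem_univ _) (mem_univ _)
    rwa [BoundedVariationOn, univ_inter] at this
  have hchord : ∀ t t', t ≤ t' → ‖γ.lift t' - γ.lift t‖ ≤ s t' - s t := by
    intro t t' h
    rw [hsub t t' h, ← dist_eq_norm, dist_edist]
    exact ENNReal.toReal_mono (hfin _ _)
      (eVariationOn.edist_le _ (right_mem_Icc.2 h) (left_mem_Icc.2 h))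
  have harc : ∀ t₀, ∀ η > 0, ∃ δ > 0, ∀ t t', t₀ - δ < t → t ≤ t' → t' < t₀ + δ →
      s t' - s t ≤ (1 + η) * ⟪T₀ t₀, γ.lift t' - γ.lift t⟫ := by
    intro t₀ η hη
    obtain ⟨δ, hδ, h⟩ := hvar t₀ η hη
    obtain ⟨δ', hδ', h'⟩ := hfwd t₀ η hη
    refine ⟨min δ δ', by positivity, fun t t' ht htt ht' => ?_⟩
    have hm := min_le_left δ δ'
    have hm' := min_le_right δ δ'
    rw [hsub t t' htt]
    refine ENNReal.toReal_le_of_le_ofReal ?_ (h t t' (by linarith) htt (by linarith))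
    exact (norm_nonneg _).trans (h' t t' (by linarith) htt (by linarith))
  have hmono : Monotone s := fun t t' h => by
    linarith [hchord t t' h, norm_nonneg (γ.lift t' - γ.lift t)]
  have hstrict : StrictMono s := by
    refine hmono.strictMono_of_injective fun a b hab => ?_
    by_contra hne
    wlog hlt : a < b generalizing a b
    · exact this b a hab.symm (Ne.symm hne) (lt_of_le_of_ne (not_lt.1 hlt) (Ne.symm hne))
    -- Arc length constant on an interval would make the curve constant there; the cut at `a + 1 /
    -- 2` stays within one period, where the curve is injective.
    set c := min b (a + 1 / 2)
    have hac : a < c := lt_min hlt (by linarith)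
    have hsc : s c = s a :=
      le_antisymm ((hmono (min_le_left _ _)).trans hab.ge) (hmono hac.le)
    have h0 := hchord a c hac.le
    rw [hsc, sub_self] at h0
    have h1 := sub_eq_zero.1 (norm_le_zero_iff.1 h0)
    have h2 : c ≤ a + 1 / 2 := min_le_right _ _
    have := ClosedCurve.lift_injOn hγ h1 (by rw [abs_lt]; constructor <;> linarith)
    linarith
  have hcont : Continuous s := by
    refine continuous_iff_continuousAt.2 fun t₀ => ?_
    obtain ⟨δ, hδ, h⟩ := harc t₀ 1 one_pos
    rw [ContinuousAt, tendsto_iff_dist_tendsto_zero]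
    have hc : Tendsto (fun t => 2 * ‖γ.lift t - γ.lift t₀‖) (𝓝 t₀) (𝓝 0) := by
      have : Continuous fun t => 2 * ‖γ.lift t - γ.lift t₀‖ := by
        have := γ.continuous_lift; fun_prop
      simpa using this.tendsto t₀
    refine squeeze_zero' (Eventually.of_forall fun _ => dist_nonneg) ?_ hc
    filter_upwards [Ioo_mem_nhds (show t₀ - δ < t₀ by linarith) (show t₀ < t₀ + δ by linarith)]
      with t ht
    rw [Real.dist_eq]
    rcases le_total t₀ t with h' | h'
    · have h1 := h t₀ t (by linarith) h' ht.2
      have h2 := real_inner_le_norm (T₀ t₀) (γ.lift t - γ.lift t₀)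
      rw [hT₀, one_mul] at h2
      rw [abs_of_nonneg (by linarith [hmono h'])]; linarith
    · have h1 := h t t₀ ht.1 h' (by linarith)
      have h2 := real_inner_le_norm (T₀ t₀) (γ.lift t₀ - γ.lift t)
      rw [hT₀, one_mul] at h2
      rw [abs_of_nonpos (by linarith [hmono h']), norm_sub_rev]; linarith
  set ℓ := s 1 - s 0 with hℓ
  have hℓpos : 0 < ℓ := sub_pos.2 (hstrict one_pos)
  have hshift : ∀ t, s (t + 1) = s t + ℓ := by
    have h1 : ∀ a b, a ≤ b → s (b + 1) - s (a + 1) = s b - s a := fun a b h => by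
      rw [hsub _ _ h, hsub _ _ (by linarith), eVariationOn_Icc_add_const γ.lift_periodic]
    intro t
    rcases le_total 0 t with h | h
    · have := h1 0 t h; rw [zero_add] at this; linarith
    · have := h1 t 0 h; rw [zero_add] at this; linarith
  have hshiftn : ∀ n : ℕ, ∀ t, s (t + n) = s t + n * ℓ := by
    intro n; induction n with
    | zero => simp
    | succ n ih => intro t; push_cast; rw [← add_assoc, hshift, ih]; ring
  have hsurj : Function.Surjective s := by
    intro x
    obtain ⟨n, hn⟩ := exists_nat_ge (|x - s 0| / ℓ)
    rw [div_le_iff₀ hℓpos] at hn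
    have h1 := hshiftn n 0
    have h2 := hshiftn n (-n)
    rw [neg_add_cancel] at h2
    rw [zero_add] at h1
    have h3 := abs_le.1 hn
    have := intermediate_value_Icc (show -(n : ℝ) ≤ n by have : (0 : ℝ) ≤ n := n.cast_nonneg; linarith)
      hcont.continuousOn
    obtain ⟨t, _, ht⟩ := this (show x ∈ Icc (s (-n)) (s n) from ⟨by linarith, by linarith⟩)
    exact ⟨t, ht⟩
  set e := hstrict.orderIsoOfSurjective s hsurj with he
  have hes : ∀ t, e.symm (s t) = t := fun t => e.symm_apply_apply t
  have hse : ∀ x, s (e.symm x) = x := fun x => e.apply_symm_apply x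
  have hecont : Continuous e.symm := e.symm.continuous
  set J : ℝ → Space3 := fun x => γ.lift (e.symm x) with hJ
  set T : ℝ → Space3 := fun x => T₀ (e.symm x) with hTdef
  have hJs : ∀ t, γ.lift t = J (s t) := fun t => by rw [hJ]; simp only [hes]
  have hJlip : ∀ x y, x ≤ y → ‖J y - J x‖ ≤ y - x := fun x y h => by
    have := hchord _ _ (e.symm.monotone h)
    rwa [hse, hse] at this
  -- Both ends of the increment vary, so this is strict differentiability at `x₀`. It gives the
  -- derivative of `J` and, on moving the base point, the continuity of `T`.
  have hstr : ∀ x₀, ∀ κ > 0, ∀ᶠ p : ℝ × ℝ in 𝓝 (x₀, x₀), p.1 ≤ p.2 →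
      ‖J p.2 - J p.1 - (p.2 - p.1) • T x₀‖ ≤ κ * (p.2 - p.1) := by
    intro x₀ κ hκ
    -- For a chord `v` of arc length `d`, $|v-dT|^2\le 2d(d-\langle T,v\rangle)$; the tolerance
    -- $\kappa^2/2$ makes this at most $\kappa^2d^2$.
    obtain ⟨δ, hδ, h⟩ := harc (e.symm x₀) (κ ^ 2 / 2) (by positivity)
    have hnear : ∀ᶠ x in 𝓝 x₀, e.symm x ∈ Ioo (e.symm x₀ - δ) (e.symm x₀ + δ) :=
      hecont.continuousAt.eventually_mem (Ioo_mem_nhds (by linarith) (by linarith))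
    have h2 := hnear.prod_nhds hnear
    filter_upwards [h2] with p hp hle
    have h1 := h _ _ hp.1.1 (e.symm.monotone hle) hp.2.2
    rw [hse, hse] at h1
    have h3 := hJlip _ _ hle
    have h0 : 0 ≤ p.2 - p.1 := sub_nonneg.2 hle
    change p.2 - p.1 ≤ (1 + κ ^ 2 / 2) * ⟪T x₀, J p.2 - J p.1⟫ at h1
    set v := J p.2 - J p.1
    set d := p.2 - p.1
    have hTn : ‖T x₀‖ = 1 := hT₀ _
    have hi : 0 ≤ ⟪T x₀, v⟫ := by
      by_contra hneg
      push Not at hneg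
      nlinarith [sq_nonneg κ]
    have hle' : ⟪T x₀, v⟫ ≤ d := by
      have := real_inner_le_norm (T x₀) v
      rw [hTn, one_mul] at this; linarith
    apply le_of_sq_le_sq _ (by positivity)
    rw [norm_sub_sq_real, norm_smul, real_inner_smul_right, hTn, Real.norm_eq_abs, mul_one, sq_abs,
      real_inner_comm]
    have h4 : ‖v‖ ^ 2 ≤ d ^ 2 := by gcongr
    have h5 : d - ⟪T x₀, v⟫ ≤ κ ^ 2 / 2 * d := by nlinarith [sq_nonneg κ]
    nlinarith [mul_le_mul_of_nonneg_left h5 h0]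
  have hderiv : ∀ x, HasDerivAt J (T x) x := by
    intro x
    rw [hasDerivAt_iff_isLittleO, Asymptotics.isLittleO_iff]
    intro κ hκ
    have hst := hstr x κ hκ
    have h1 : ∀ᶠ y in 𝓝 x, x ≤ y → ‖J y - J x - (y - x) • T x‖ ≤ κ * (y - x) :=
      (Continuous.tendsto' (f := fun y => (x, y)) (by fun_prop) x (x, x) rfl).eventually hst
    have h2 : ∀ᶠ y in 𝓝 x, y ≤ x → ‖J x - J y - (x - y) • T x‖ ≤ κ * (x - y) :=
      (Continuous.tendsto' (f := fun y => (y, x)) (by fun_prop) x (x, x) rfl).eventually hst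
    filter_upwards [h1, h2] with y hy1 hy2
    rcases le_total x y with h | h
    · rw [Real.norm_eq_abs, abs_of_nonneg (sub_nonneg.2 h)]; exact hy1 h
    · rw [Real.norm_eq_abs, abs_of_nonpos (sub_nonpos.2 h), neg_sub, ← norm_neg]
      have e : -(J y - J x - (y - x) • T x) = J x - J y - (x - y) • T x := by module
      rw [e]; exact hy2 h
  have hmemL : ∀ x, J x ∈ L := fun x => hγL (γ.range_lift ▸ mem_range_self _)
  have htan : ∀ x, IsTangentAt L (J x) (T x) := fun x => hTan _
  have hTnear : ∀ x₀, ∀ κ > 0, ∀ᶠ x in 𝓝 x₀, ‖T x - T x₀‖ ≤ κ := by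
    intro x₀ κ hκ
    have hdiag : ∀ᶠ x in 𝓝 x₀, ∀ᶠ p : ℝ × ℝ in 𝓝 (x, x), p.1 ≤ p.2 →
        ‖J p.2 - J p.1 - (p.2 - p.1) • T x₀‖ ≤ κ * (p.2 - p.1) :=
      (Continuous.tendsto' (f := fun x : ℝ => (x, x)) (by fun_prop) x₀ (x₀, x₀) rfl).eventually
        (eventually_eventually_nhds.2 (hstr x₀ κ hκ))
    filter_upwards [hdiag] with x hx
    have hg : HasDerivAt (fun y => J y - y • T x₀) (T x - (1 : ℝ) • T x₀) x :=
      (hderiv x).sub ((hasDerivAt_id x).smul_const _)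
    rw [one_smul] at hg
    refine hg.le_of_lip' hκ.le ?_
    have h1 : ∀ᶠ y in 𝓝 x, x ≤ y → ‖J y - J x - (y - x) • T x₀‖ ≤ κ * (y - x) :=
      (Continuous.tendsto' (f := fun y => (x, y)) (by fun_prop) x (x, x) rfl).eventually hx
    have h2 : ∀ᶠ y in 𝓝 x, y ≤ x → ‖J x - J y - (x - y) • T x₀‖ ≤ κ * (x - y) :=
      (Continuous.tendsto' (f := fun y => (y, x)) (by fun_prop) x (x, x) rfl).eventually hx
    filter_upwards [h1, h2] with y hy1 hy2
    have e : J y - y • T x₀ - (J x - x • T x₀) = J y - J x - (y - x) • T x₀ := by module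
    rw [e]
    rcases le_total x y with h | h
    · rw [Real.norm_eq_abs, abs_of_nonneg (sub_nonneg.2 h)]; exact hy1 h
    · rw [Real.norm_eq_abs, abs_of_nonpos (sub_nonpos.2 h), neg_sub, ← norm_neg]
      have e : -(J y - J x - (y - x) • T x₀) = J x - J y - (x - y) • T x₀ := by module
      rw [e]; exact hy2 h
  have hTcont : Continuous T := by
    refine continuous_iff_continuousAt.2 fun x => Metric.continuousAt_iff'.2 fun ε hε => ?_
    filter_upwards [hTnear x (ε / 2) (by positivity)] with y hy
    rw [dist_eq_norm]; linarith
  have hTlip' : ∀ x y, x ≤ y → ‖T y - T x‖ ≤ y - x := by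
    intro x y hxy
    refine norm_sub_le_of_eventually_right hTcont (fun x η hη => ?_) hxy
    -- `1 - 3 * κ` will bound from below the cosines of the angles between the chord and the
    -- tangents at its two ends. With the chosen `κ` the last expression equals $(2+\eta)(1+\eta)$.
    obtain ⟨κ, hκ, hκ3, hκη⟩ : ∃ κ > 0, κ < 1 / 3 ∧ 2 ≤ (1 + η) ^ 2 * (1 + (1 - 3 * κ)) := by
      refine ⟨η / (3 * (1 + η)), by positivity, ?_, ?_⟩
      · rw [div_lt_div_iff₀ (by positivity) (by norm_num)]; linarith
      · have : (1 + η) ^ 2 * (1 + (1 - 3 * (η / (3 * (1 + η))))) = (2 + η) * (1 + η) := by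
          field_simp; ring
        rw [this]; nlinarith
    have h1 : ∀ᶠ z in 𝓝 x, x ≤ z → ‖J z - J x - (z - x) • T x‖ ≤ κ * (z - x) :=
      (Continuous.tendsto' (f := fun y => (x, y)) (by fun_prop) x (x, x) rfl).eventually
        (hstr x κ hκ)
    filter_upwards [self_mem_nhdsWithin, nhdsWithin_le_nhds h1,
      nhdsWithin_le_nhds (hTnear x κ hκ)] with z hz hz1 hz2
    replace hz1 := hz1 (le_of_lt hz)
    have hh : 0 < z - x := sub_pos.2 hz
    have hd := hJlip x z (le_of_lt hz)
    have hTx : ‖T x‖ = 1 := hT₀ _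
    have hTz : ‖T z‖ = 1 := hT₀ _
    have ht1 := htan x (J z) (hmemL z)
    have ht2 := htan z (J x) (hmemL x)
    rw [← neg_sub (J z), norm_neg, inner_neg_right, neg_sq] at ht2
    set d := J z - J x
    have hlow : (1 - κ) * (z - x) ≤ ⟪T x, d⟫ := by
      have e : ⟪T x, d⟫ = (z - x) + ⟪T x, d - (z - x) • T x⟫ := by
        rw [inner_sub_right _ d, real_inner_smul_right, real_inner_self_eq_norm_sq, hTx]; ring
      have := (abs_le.1 (abs_real_inner_le_norm (T x) (d - (z - x) • T x))).1
      rw [hTx, one_mul] at this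
      rw [e]; linarith
    have hdpos : 0 < ‖d‖ := by
      have := real_inner_le_norm (T x) d
      rw [hTx, one_mul] at this
      nlinarith
    have hen : ‖‖d‖⁻¹ • d‖ = 1 := by
      rw [norm_smul, norm_inv, norm_norm, inv_mul_cancel₀ hdpos.ne']
    have hgram : ∀ S : Space3, 4 * (‖d‖ ^ 2 - ⟪S, d⟫ ^ 2) ≤ ‖d‖ ^ 4 →
        4 * (1 - ⟪S, ‖d‖⁻¹ • d⟫ ^ 2) ≤ (z - x) ^ 2 := by
      intro S hS
      have h2 : ‖d‖ ^ 2 ≤ (z - x) ^ 2 := by gcongr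
      refine le_trans ?_ h2
      rw [real_inner_smul_right, mul_pow]
      have h3 : (4 * (1 - ‖d‖⁻¹ ^ 2 * ⟪S, d⟫ ^ 2)) * ‖d‖ ^ 2 ≤ ‖d‖ ^ 2 * ‖d‖ ^ 2 := by
        have : (4 * (1 - ‖d‖⁻¹ ^ 2 * ⟪S, d⟫ ^ 2)) * ‖d‖ ^ 2 = 4 * (‖d‖ ^ 2 - ⟪S, d⟫ ^ 2) := by
          field_simp
        rw [this]; linarith
      exact le_of_mul_le_mul_right h3 (by positivity)
    have hci : ∀ S : Space3, (1 - 3 * κ) * ‖d‖ ≤ ⟪S, d⟫ → 1 - 3 * κ ≤ ⟪S, ‖d‖⁻¹ • d⟫ := by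
      intro S hS
      rw [real_inner_smul_right, inv_mul_eq_div, le_div_iff₀ hdpos]; exact hS
    have hx1 : (1 - κ) * ‖d‖ ≤ ⟪T x, d⟫ := by nlinarith
    have hz1' : (1 - 3 * κ) * ‖d‖ ≤ ⟪T z, d⟫ := by
      have e : ⟪T z, d⟫ = ⟪T x, d⟫ + ⟪T z - T x, d⟫ := by rw [inner_sub_left]; ring
      have h4 := (abs_le.1 (abs_real_inner_le_norm (T z - T x) d)).1
      have h5 : ‖T z - T x‖ * ‖d‖ ≤ κ * ‖d‖ := by gcongr
      rw [e]; nlinarith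
    have a1 := norm_sub_le_of_gram_le hTx hen hh.le hη.le (hgram _ ht1)
      (hci _ (by nlinarith)) (by linarith) hκη
    have a2 := norm_sub_le_of_gram_le hTz hen hh.le hη.le (hgram _ ht2)
      (hci _ hz1') (by linarith) hκη
    have e : T z - T x = (T z - ‖d‖⁻¹ • d) - (T x - ‖d‖⁻¹ • d) := by abel
    rw [e]
    exact (norm_sub_le _ _).trans (by linarith)
  have hTlip : ∀ x y, ‖T x - T y‖ ≤ |x - y| := by
    intro x y
    rcases le_total y x with h | h
    · rw [abs_of_nonneg (sub_nonneg.2 h)]; exact hTlip' y x h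
    · rw [abs_of_nonpos (sub_nonpos.2 h), norm_sub_rev, neg_sub]; exact hTlip' x y h
  exact ⟨{
    J := J, T := T, ℓ := ℓ, s := s
    pos := hℓpos
    continuous_s := hcont
    s_add_one := hshift
    lift_eq := hJs
    periodic := fun x => by
      obtain ⟨t, rfl⟩ := hsurj x
      rw [← hshift, ← hJs, ← hJs, γ.lift_periodic]
    hasDerivAt := hderiv
    norm_T := fun x => hT₀ _
    lipschitz_T := hTlip
    length_eq := by
      rw [hℓ, hsub 0 1 zero_le_one, ENNReal.ofReal_toReal (hfin _ _)]; rfl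
    tangent := htan
    inj := fun x y h hxy => by
      obtain ⟨t, rfl⟩ := hsurj x
      obtain ⟨t', rfl⟩ := hsurj y
      rw [← hJs, ← hJs] at h
      rw [abs_lt] at hxy
      congr 1
      refine ClosedCurve.lift_injOn hγ h ?_
      have h1 : t < t' + 1 := hstrict.lt_iff_lt.1 (by rw [hshift]; linarith)
      have h2 : t' < t + 1 := hstrict.lt_iff_lt.1 (by rw [hshift]; linarith)
      rw [abs_lt]; constructor <;> linarith
    surj := hsurj }⟩

/-! ### Gauss integrals with a general radial kernel and the homotopy formula. -/

theorem tripleProduct_eq (u v w : Space3) : tripleProduct u v w =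
    u 0 * (v 1 * w 2 - v 2 * w 1) - u 1 * (v 0 * w 2 - v 2 * w 0) +
      u 2 * (v 0 * w 1 - v 1 * w 0) := by
  simp [tripleProduct, Matrix.det_fin_three]; ring

theorem inner_eq_coords (u v : Space3) : ⟪u, v⟫ = u 0 * v 0 + u 1 * v 1 + u 2 * v 2 := by
  simp [PiLp.inner_apply, Fin.sum_univ_three, mul_comm]

theorem norm_sq_eq_coords (u : Space3) : ‖u‖ ^ 2 = u 0 ^ 2 + u 1 ^ 2 + u 2 ^ 2 := by
  rw [← real_inner_self_eq_norm_sq, inner_eq_coords]; ring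

theorem HasDerivAt.coord {u : ℝ → Space3} {u' : Space3} {t : ℝ} (hu : HasDerivAt u u' t)
    (i : Fin 3) : HasDerivAt (fun t => u t i) (u' i) t :=
  ((EuclideanSpace.proj (𝕜 := ℝ) i).hasFDerivAt (x := u t)).comp_hasDerivAt t hu

theorem HasDerivAt.tripleProduct {u v w : ℝ → Space3} {u' v' w' : Space3} {t : ℝ}
    (hu : HasDerivAt u u' t) (hv : HasDerivAt v v' t) (hw : HasDerivAt w w' t) :
    HasDerivAt (fun t => tripleProduct (u t) (v t) (w t))
      (tripleProduct u' (v t) (w t) + tripleProduct (u t) v' (w t) +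
        tripleProduct (u t) (v t) w') t := by
  simp only [tripleProduct_eq]
  have := (((hu.coord 0).mul (((hv.coord 1).mul (hw.coord 2)).sub
    ((hv.coord 2).mul (hw.coord 1)))).sub ((hu.coord 1).mul (((hv.coord 0).mul (hw.coord 2)).sub
    ((hv.coord 2).mul (hw.coord 0))))).add ((hu.coord 2).mul (((hv.coord 0).mul (hw.coord 1)).sub
    ((hv.coord 1).mul (hw.coord 0))))
  refine this.congr_deriv ?_
  simp only [Pi.mul_apply, Pi.sub_apply]
  ring

@[fun_prop]
theorem Continuous.tripleProduct {X : Type*} [TopologicalSpace X] {u v w : X → Space3}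
    (hu : Continuous u) (hv : Continuous v) (hw : Continuous w) :
    Continuous fun t => tripleProduct (u t) (v t) (w t) := by
  simp only [tripleProduct_eq]
  fun_prop

theorem tripleProduct_zero_mid (u w : Space3) : tripleProduct u 0 w = 0 := by
  simp [tripleProduct_eq]

theorem tripleProduct_zero_right (u w : Space3) : tripleProduct u w 0 = 0 := by
  simp [tripleProduct_eq]

theorem intervalIntegral_swap_of_continuous {f : ℝ → ℝ → ℝ} (hf : Continuous f.uncurry)
    (a b c d : ℝ) : ∫ x in a..b, ∫ y in c..d, f x y = ∫ y in c..d, ∫ x in a..b, f x y := by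
  apply intervalIntegral_intervalIntegral_swap
  exact (hf.continuousOn.integrableOn_compact
    (isCompact_uIcc (a := a) (b := b) |>.prod (isCompact_uIcc (a := c) (b := d)))).mono_set
    (prod_mono uIoc_subset_uIcc uIoc_subset_uIcc)

/-- A closed curve of class `C¹` with period `a`. -/
structure IsC1Loop (a : ℝ) (P P' : ℝ → Space3) : Prop where
  periodic : Function.Periodic P a
  hasDerivAt : ∀ x, HasDerivAt P (P' x) x
  continuous_deriv : Continuous P'

theorem IsC1Loop.continuous {a : ℝ} {P P' : ℝ → Space3} (h : IsC1Loop a P P') : Continuous P :=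
  continuous_iff_continuousAt.2 fun x => (h.hasDerivAt x).continuousAt

theorem IsC1Loop.add {a : ℝ} {P P' V V' : ℝ → Space3} (h : IsC1Loop a P P')
    (hv : IsC1Loop a V V') : IsC1Loop a (fun x => P x + V x) (fun x => P' x + V' x) :=
  ⟨fun x => by rw [h.periodic, hv.periodic], fun x => (h.hasDerivAt x).add (hv.hasDerivAt x),
    h.continuous_deriv.add hv.continuous_deriv⟩

theorem IsC1Loop.sub {a : ℝ} {P P' V V' : ℝ → Space3} (h : IsC1Loop a P P')
    (hv : IsC1Loop a V V') : IsC1Loop a (fun x => P x - V x) (fun x => P' x - V' x) :=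
  ⟨fun x => by rw [h.periodic, hv.periodic], fun x => (h.hasDerivAt x).sub (hv.hasDerivAt x),
    h.continuous_deriv.sub hv.continuous_deriv⟩

theorem IsC1Loop.const_smul {a : ℝ} {P P' : ℝ → Space3} (h : IsC1Loop a P P') (c : ℝ) :
    IsC1Loop a (fun x => c • P x) (fun x => c • P' x) :=
  ⟨fun x => by rw [h.periodic], fun x => (h.hasDerivAt x).const_smul c,
    h.continuous_deriv.const_smul c⟩

theorem isC1Loop_const (a : ℝ) (p : Space3) : IsC1Loop a (fun _ => p) (fun _ => 0) :=
  ⟨fun _ => rfl, fun x => hasDerivAt_const x p, continuous_const⟩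

/-- The integrand of the Gauss integral with the kernel `χ(|x|²) x` in place of `x / |x|³`. -/
def gaussDensity (χ : ℝ → ℝ) (x u v : Space3) : ℝ := χ (‖x‖ ^ 2) * tripleProduct x u v

/-- The Gauss integral of two loops with periods `a` and `b`, with the kernel `χ(|x|²) x` in place
of `x / |x|³` and without the normalizing factor. -/
def gaussPairing (χ : ℝ → ℝ) (a b : ℝ) (P P' Q Q' : ℝ → Space3) : ℝ :=
  ∫ σ in (0 : ℝ)..a, ∫ τ in (0 : ℝ)..b, gaussDensity χ (P σ - Q τ) (P' σ) (Q' τ)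

/-- The divergence of the vector field `χ(|x|²) x`. -/
def kernelDiv (χ χ' : ℝ → ℝ) (s : ℝ) : ℝ := 3 * χ s + 2 * s * χ' s

theorem integral_deriv_periodic_eq_zero {a : ℝ} {f f' : ℝ → ℝ} (hf : ∀ x, HasDerivAt f (f' x) x)
    (hf' : Continuous f') (hp : Function.Periodic f a) : ∫ x in (0 : ℝ)..a, f' x = 0 := by
  rw [intervalIntegral.integral_eq_sub_of_hasDerivAt (fun x _ => hf x) (hf'.intervalIntegrable _ _)]
  have := hp 0
  rw [zero_add] at this
  rw [this, sub_self]

section Homotopy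

variable {χ χ' : ℝ → ℝ} (hχ : ∀ s, HasDerivAt χ (χ' s) s)
include hχ

theorem hasDerivAt_gaussDensity {x u v : ℝ → Space3} {x' u' v' : Space3} {t : ℝ}
    (hx : HasDerivAt x x' t) (hu : HasDerivAt u u' t) (hv : HasDerivAt v v' t) :
    HasDerivAt (fun t => gaussDensity χ (x t) (u t) (v t))
      (2 * χ' (‖x t‖ ^ 2) * ⟪x t, x'⟫ * tripleProduct (x t) (u t) (v t) + χ (‖x t‖ ^ 2) *
        (tripleProduct x' (u t) (v t) + tripleProduct (x t) u' (v t) +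
        tripleProduct (x t) (u t) v')) t := by
  have h := ((hχ _).comp t hx.norm_sq).mul (hx.tripleProduct hu hv)
  refine h.congr_deriv ?_
  simp only [Function.comp]
  ring

variable (hχ' : Continuous χ')
include hχ'

/-- The change of the Gauss integral under a linear homotopy of the first curve. -/
theorem gaussPairing_add_sub {a b : ℝ} {P P' V V' Q Q' : ℝ → Space3} (hP : IsC1Loop a P P')
    (hV : IsC1Loop a V V') (hQ : IsC1Loop b Q Q') :
    gaussPairing χ a b (fun x => P x + V x) (fun x => P' x + V' x) Q Q' -
        gaussPairing χ a b P P' Q Q' =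
      ∫ r in (0 : ℝ)..1, ∫ σ in (0 : ℝ)..a, ∫ τ in (0 : ℝ)..b,
        kernelDiv χ χ' (‖P σ + r • V σ - Q τ‖ ^ 2) *
          tripleProduct (V σ) (P' σ + r • V' σ) (Q' τ) := by
  have cχ : Continuous χ := continuous_iff_continuousAt.2 fun s => (hχ s).continuousAt
  have cP := hP.continuous
  have cP' := hP.continuous_deriv
  have cV := hV.continuous
  have cV' := hV.continuous_deriv
  have cQ := hQ.continuous
  have cQ' := hQ.continuous_deriv
  set g : ℝ → ℝ → ℝ → ℝ := fun r σ τ =>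
    gaussDensity χ (P σ + r • V σ - Q τ) (P' σ + r • V' σ) (Q' τ) with hg
  set D : ℝ → ℝ → ℝ → ℝ := fun r σ τ => kernelDiv χ χ' (‖P σ + r • V σ - Q τ‖ ^ 2) *
    tripleProduct (V σ) (P' σ + r • V' σ) (Q' τ) with hD
  -- `A'` is the `σ`-derivative of the density with `V` in place of the first tangent, and `B'` the
  -- `τ`-derivative of the density with `V` in place of the second. Modulo these two derivatives,
  -- whose integrals over a period vanish, the `r`-derivative of the Gauss density is `D`: only the
  -- divergence of the kernel survives.
  set A' : ℝ → ℝ → ℝ → ℝ := fun r σ τ =>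
    2 * χ' (‖P σ + r • V σ - Q τ‖ ^ 2) * ⟪P σ + r • V σ - Q τ, P' σ + r • V' σ⟫ *
        tripleProduct (P σ + r • V σ - Q τ) (V σ) (Q' τ) + χ (‖P σ + r • V σ - Q τ‖ ^ 2) *
      (tripleProduct (P' σ + r • V' σ) (V σ) (Q' τ) +
        tripleProduct (P σ + r • V σ - Q τ) (V' σ) (Q' τ)) with hA'
  set B' : ℝ → ℝ → ℝ → ℝ := fun r σ τ =>
    2 * χ' (‖P σ + r • V σ - Q τ‖ ^ 2) * ⟪P σ + r • V σ - Q τ, -Q' τ⟫ *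
        tripleProduct (P σ + r • V σ - Q τ) (P' σ + r • V' σ) (V σ) +
      χ (‖P σ + r • V σ - Q τ‖ ^ 2) * tripleProduct (-Q' τ) (P' σ + r • V' σ) (V σ) with hB'
  have hgd : ∀ r σ τ, HasDerivAt (fun r => g r σ τ) (D r σ τ + A' r σ τ - B' r σ τ) r := by
    intro r σ τ
    have hx : HasDerivAt (fun r : ℝ => P σ + r • V σ - Q τ) (V σ) r := by
      simpa using (((hasDerivAt_id r).smul_const (V σ)).const_add (P σ)).sub_const (Q τ)
    have hu : HasDerivAt (fun r : ℝ => P' σ + r • V' σ) (V' σ) r := by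
      simpa using ((hasDerivAt_id r).smul_const (V' σ)).const_add (P' σ)
    refine (hasDerivAt_gaussDensity hχ hx hu (hasDerivAt_const r (Q' τ))).congr_deriv ?_
    simp only [hD, hA', hB', kernelDiv]
    generalize χ (‖P σ + r • V σ - Q τ‖ ^ 2) = c
    generalize χ' (‖P σ + r • V σ - Q τ‖ ^ 2) = c'
    generalize P σ + r • V σ - Q τ = x
    generalize P' σ + r • V' σ = p
    simp only [tripleProduct_eq, inner_eq_coords, norm_sq_eq_coords, PiLp.neg_apply, PiLp.zero_apply]
    ring
  have cD : Continuous fun p : ℝ × ℝ × ℝ => D p.1 p.2.1 p.2.2 := by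
    simp only [hD, kernelDiv]; fun_prop
  have cA : Continuous fun p : ℝ × ℝ × ℝ => A' p.1 p.2.1 p.2.2 := by
    simp only [hA']; fun_prop
  have cB : Continuous fun p : ℝ × ℝ × ℝ => B' p.1 p.2.1 p.2.2 := by
    simp only [hB']; fun_prop
  have cg : Continuous fun p : ℝ × ℝ × ℝ => g p.1 p.2.1 p.2.2 := by
    simp only [hg, gaussDensity]; fun_prop
  have slice : ∀ {F : ℝ → ℝ → ℝ → ℝ}, Continuous (fun p : ℝ × ℝ × ℝ => F p.1 p.2.1 p.2.2) →
      ∀ {X : Type} [TopologicalSpace X] {u v w : X → ℝ}, Continuous u → Continuous v →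
      Continuous w → Continuous fun x => F (u x) (v x) (w x) :=
    fun hF _ _ _ _ _ hu hv hw => hF.comp (hu.prodMk (hv.prodMk hw))
  have hA0 : ∀ r τ, ∫ σ in (0 : ℝ)..a, A' r σ τ = 0 := by
    intro r τ
    refine integral_deriv_periodic_eq_zero
      (f := fun σ => gaussDensity χ (P σ + r • V σ - Q τ) (V σ) (Q' τ)) (fun σ => ?_)
      (slice cA continuous_const continuous_id continuous_const)
      (fun σ => by simp only [hP.periodic σ, hV.periodic σ])
    have hx : HasDerivAt (fun σ : ℝ => P σ + r • V σ - Q τ) (P' σ + r • V' σ) σ :=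
      ((hP.hasDerivAt σ).add ((hV.hasDerivAt σ).const_smul r)).sub_const (Q τ)
    refine (hasDerivAt_gaussDensity hχ hx (hV.hasDerivAt σ)
      (hasDerivAt_const σ (Q' τ))).congr_deriv ?_
    simp only [hA', tripleProduct_zero_right, add_zero]
  have hB0 : ∀ r σ, ∫ τ in (0 : ℝ)..b, B' r σ τ = 0 := by
    intro r σ
    refine integral_deriv_periodic_eq_zero
      (f := fun τ => gaussDensity χ (P σ + r • V σ - Q τ) (P' σ + r • V' σ) (V σ)) (fun τ => ?_)
      (slice cB continuous_const continuous_const continuous_id)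
      (fun τ => by simp only [hQ.periodic τ])
    have hx : HasDerivAt (fun τ : ℝ => P σ + r • V σ - Q τ) (-Q' τ) τ :=
      (hQ.hasDerivAt τ).const_sub _
    refine (hasDerivAt_gaussDensity hχ hx (hasDerivAt_const τ _)
      (hasDerivAt_const τ (V σ))).congr_deriv ?_
    simp only [hB', tripleProduct_zero_right, tripleProduct_zero_mid, add_zero]
  have cc : ∀ {F : ℝ → ℝ → ℝ → ℝ}, Continuous (fun p : ℝ × ℝ × ℝ => F p.1 p.2.1 p.2.2) →
      ∀ r, Continuous fun σ => ∫ τ in (0 : ℝ)..b, F r σ τ := fun hF r =>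
    intervalIntegral.continuous_parametric_intervalIntegral_of_continuous'
      (slice hF continuous_const continuous_fst continuous_snd) _ _
  have e1 : ∀ σ τ, g 1 σ τ - g 0 σ τ =
      ∫ r in (0 : ℝ)..1, (D r σ τ + A' r σ τ - B' r σ τ) := fun σ τ => by
    refine (intervalIntegral.integral_eq_sub_of_hasDerivAt (fun r _ => hgd r σ τ) ?_).symm
    refine Continuous.intervalIntegrable ?_ _ _
    exact ((slice cD continuous_id continuous_const continuous_const).add
      (slice cA continuous_id continuous_const continuous_const)).sub
      (slice cB continuous_id continuous_const continuous_const)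
  have e2 : gaussPairing χ a b (fun x => P x + V x) (fun x => P' x + V' x) Q Q' -
      gaussPairing χ a b P P' Q Q' =
      ∫ σ in (0 : ℝ)..a, ∫ τ in (0 : ℝ)..b, (g 1 σ τ - g 0 σ τ) := by
    have h1 : gaussPairing χ a b (fun x => P x + V x) (fun x => P' x + V' x) Q Q' =
      ∫ σ in (0 : ℝ)..a, ∫ τ in (0 : ℝ)..b, g 1 σ τ := by simp [gaussPairing, hg]
    have h0 : gaussPairing χ a b P P' Q Q' =
      ∫ σ in (0 : ℝ)..a, ∫ τ in (0 : ℝ)..b, g 0 σ τ := by simp [gaussPairing, hg]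
    rw [h1, h0, ← intervalIntegral.integral_sub ((cc cg 1).intervalIntegrable _ _)
      ((cc cg 0).intervalIntegrable _ _)]
    congr 1; ext σ
    rw [intervalIntegral.integral_sub]
    · exact (slice cg continuous_const continuous_const continuous_id).intervalIntegrable _ _
    · exact (slice cg continuous_const continuous_const continuous_id).intervalIntegrable _ _
  have sliceE : ∀ {X : Type} [TopologicalSpace X] {u v w : X → ℝ}, Continuous u →
      Continuous v → Continuous w → Continuous fun x => D (u x) (v x) (w x) +
        A' (u x) (v x) (w x) - B' (u x) (v x) (w x) :=
    fun hu hv hw => ((slice cD hu hv hw).add (slice cA hu hv hw)).sub (slice cB hu hv hw)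
  rw [e2]
  simp only [e1]
  have e3 : ∀ σ, ∫ τ in (0 : ℝ)..b, ∫ r in (0 : ℝ)..1, (D r σ τ + A' r σ τ - B' r σ τ) =
      ∫ r in (0 : ℝ)..1, ∫ τ in (0 : ℝ)..b, (D r σ τ + A' r σ τ - B' r σ τ) := fun σ =>
    intervalIntegral_swap_of_continuous
      (f := fun τ r => D r σ τ + A' r σ τ - B' r σ τ)
      (sliceE continuous_snd continuous_const continuous_fst) _ _ _ _
  simp only [e3]
  rw [intervalIntegral_swap_of_continuous]
  · congr 1; ext r
    have e4 : ∀ σ, ∫ τ in (0 : ℝ)..b, (D r σ τ + A' r σ τ - B' r σ τ) =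
        (∫ τ in (0 : ℝ)..b, D r σ τ) + ∫ τ in (0 : ℝ)..b, A' r σ τ := by
      intro σ
      have i1 := (slice cD continuous_const continuous_const continuous_id (u := fun _ => r)
        (v := fun _ => σ)).intervalIntegrable (μ := volume) 0 b
      have i2 := (slice cA continuous_const continuous_const continuous_id (u := fun _ => r)
        (v := fun _ => σ)).intervalIntegrable (μ := volume) 0 b
      have i3 := (slice cB continuous_const continuous_const continuous_id (u := fun _ => r)
        (v := fun _ => σ)).intervalIntegrable (μ := volume) 0 b
      have := intervalIntegral.integral_sub (i1.add i2) i3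
      simp only [id] at this ⊢
      rw [this, hB0, sub_zero]
      exact intervalIntegral.integral_add i1 i2
    simp only [e4]
    rw [intervalIntegral.integral_add ((cc cD r).intervalIntegrable _ _)
      ((cc cA r).intervalIntegrable _ _), intervalIntegral_swap_of_continuous
      (f := A' r) (slice cA continuous_const continuous_fst continuous_snd)]
    simp [hA0, hD]
  · refine intervalIntegral.continuous_parametric_intervalIntegral_of_continuous'
      (X := ℝ × ℝ) (f := fun p τ => D p.2 p.1 τ + A' p.2 p.1 τ - B' p.2 p.1 τ) ?_ _ _
    exact sliceE (by fun_prop) (by fun_prop) (by fun_prop)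

end Homotopy

/-! ### The Newtonian kernel of a small ball of mass $4\pi$. -/

/-- A function of class `C¹` on the real line, equal to `s ^ (-3 / 2)` for `s ≥ ε ^ 2`. -/
def newtonKernel (ε s : ℝ) : ℝ :=
  if s ≤ ε ^ 2 then (5 / 2 - 3 / 2 * (s / ε ^ 2)) / ε ^ 3 else 1 / √s ^ 3

/-- The derivative of `newtonKernel`. -/
def newtonKernelDeriv (ε s : ℝ) : ℝ :=
  if s ≤ ε ^ 2 then -(3 / 2) / ε ^ 5 else -(3 / 2) / √s ^ 5

theorem newtonKernel_of_le {ε s : ℝ} (hε : 0 < ε) (h : ε ^ 2 ≤ s) :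
    newtonKernel ε s = 1 / √s ^ 3 := by
  rcases h.eq_or_lt with rfl | h
  · rw [newtonKernel, if_pos le_rfl, Real.sqrt_sq hε.le]; field_simp; norm_num
  · rw [newtonKernel, if_neg (not_le.2 h)]

theorem newtonKernelDeriv_of_le {ε s : ℝ} (hε : 0 < ε) (h : ε ^ 2 ≤ s) :
    newtonKernelDeriv ε s = -(3 / 2) / √s ^ 5 := by
  rcases h.eq_or_lt with rfl | h
  · rw [newtonKernelDeriv, if_pos le_rfl, Real.sqrt_sq hε.le]
  · rw [newtonKernelDeriv, if_neg (not_le.2 h)]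

/-- The affine branch is the tangent line of $s^{-3/2}$ at $s=\varepsilon^2$, so the one-sided
derivatives agree at the junction. -/
theorem hasDerivAt_newtonKernel {ε : ℝ} (hε : 0 < ε) (s : ℝ) :
    HasDerivAt (newtonKernel ε) (newtonKernelDeriv ε s) s := by
  have h1 : s ≤ ε ^ 2 → HasDerivWithinAt (newtonKernel ε) (newtonKernelDeriv ε s) (Iic (ε ^ 2)) s := by
    intro h
    have : HasDerivAt (fun s => (5 / 2 - 3 / 2 * (s / ε ^ 2)) / ε ^ 3)
        (newtonKernelDeriv ε s) s := by
      refine (((((hasDerivAt_id s).div_const _).const_mul (3 / 2)).const_sub (5 / 2)).div_const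
        (ε ^ 3)).congr_deriv ?_
      rw [newtonKernelDeriv, if_pos h]; field_simp
    exact this.hasDerivWithinAt.congr (fun x hx => if_pos hx) (if_pos h)
  have h2 : ε ^ 2 ≤ s → HasDerivWithinAt (newtonKernel ε) (newtonKernelDeriv ε s) (Ici (ε ^ 2)) s := by
    intro h
    have hs : 0 < s := lt_of_lt_of_le (by positivity) h
    have hq : 0 < √s := Real.sqrt_pos.2 hs
    have : HasDerivAt (fun s => 1 / √s ^ 3) (newtonKernelDeriv ε s) s := by
      have := ((Real.hasDerivAt_sqrt hs.ne').pow 3).inv (by simp only [Pi.pow_apply]; positivity)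
      simp only [one_div]
      refine this.congr_deriv ?_
      rw [newtonKernelDeriv_of_le hε h]
      simp only [Pi.pow_apply]
      field_simp; norm_num; ring
    exact this.hasDerivWithinAt.congr (fun x hx => newtonKernel_of_le hε hx)
      (newtonKernel_of_le hε h)
  rcases lt_trichotomy s (ε ^ 2) with h | h | h
  · exact (h1 h.le).hasDerivAt (Iic_mem_nhds h)
  · have := (h1 h.le).union (h2 h.ge)
    rwa [Iic_union_Ici, hasDerivWithinAt_univ] at this
  · exact (h2 h.le).hasDerivAt (Ici_mem_nhds h)

theorem continuous_newtonKernelDeriv {ε : ℝ} (hε : 0 < ε) : Continuous (newtonKernelDeriv ε) := by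
  have : newtonKernelDeriv ε = fun s => -(3 / 2) / √(max s (ε ^ 2)) ^ 5 := by
    ext s
    rcases le_total s (ε ^ 2) with h | h
    · rw [max_eq_right h, newtonKernelDeriv, if_pos h, Real.sqrt_sq hε.le]
    · rw [max_eq_left h, newtonKernelDeriv_of_le hε h]
  rw [this]
  refine continuous_const.div (by fun_prop) fun s => ?_
  have : 0 < √(max s (ε ^ 2)) := Real.sqrt_pos.2 (lt_max_of_lt_right (by positivity))
  positivity

/-- The mass density whose Newtonian attraction is given by `newtonKernel`. -/
def newtonDensity (ε s : ℝ) : ℝ := kernelDiv (newtonKernel ε) (newtonKernelDeriv ε) s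

/-- The field $x/|x|^3$ is divergence-free: $3s^{-3/2}+2s\cdot(-\tfrac32)s^{-5/2}=0$. -/
theorem newtonDensity_of_le {ε s : ℝ} (hε : 0 < ε) (h : ε ^ 2 ≤ s) : newtonDensity ε s = 0 := by
  have hs : 0 < s := lt_of_lt_of_le (by positivity) h
  have hq : 0 < √s := Real.sqrt_pos.2 hs
  rw [newtonDensity, kernelDiv, newtonKernel_of_le hε h, newtonKernelDeriv_of_le hε h]
  have e : s = √s ^ 2 := (Real.sq_sqrt hs.le).symm
  have : 2 * s * (-(3 / 2) / √s ^ 5) = 2 * √s ^ 2 * (-(3 / 2) / √s ^ 5) := by rw [← e]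
  rw [this]; field_simp; ring

theorem newtonDensity_of_ge {ε s : ℝ} (hε : 0 < ε) (h : s ≤ ε ^ 2) :
    newtonDensity ε s = 15 / 2 * (1 - s / ε ^ 2) / ε ^ 3 := by
  rw [newtonDensity, kernelDiv, newtonKernel, newtonKernelDeriv, if_pos h, if_pos h]
  field_simp; ring

theorem newtonDensity_nonneg {ε : ℝ} (hε : 0 < ε) (s : ℝ) : 0 ≤ newtonDensity ε s := by
  rcases le_total s (ε ^ 2) with h | h
  · rw [newtonDensity_of_ge hε h]
    have : s / ε ^ 2 ≤ 1 := by rw [div_le_one (by positivity)]; exact h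
    have : 0 ≤ 1 - s / ε ^ 2 := by linarith
    positivity
  · rw [newtonDensity_of_le hε h]

theorem continuous_newtonDensity {ε : ℝ} (hε : 0 < ε) : Continuous (newtonDensity ε) := by
  have h1 : Continuous (newtonKernel ε) :=
    continuous_iff_continuousAt.2 fun s => (hasDerivAt_newtonKernel hε s).continuousAt
  have h2 := continuous_newtonKernelDeriv hε
  unfold newtonDensity kernelDiv
  fun_prop

/-- In polar coordinates the integral is $3\cdot\frac{4\pi}{3}$ times the radial integral of $y^2$
times the density, which equals one. The value $4\pi$ is the flux of $x/|x|^3$ and cancels the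
normalization of the linking integral. -/
theorem integral_newtonDensity {ε : ℝ} (hε : 0 < ε) :
    ∫ x : Space3, newtonDensity ε (‖x‖ ^ 2) = 4 * Real.pi := by
  rw [integral_fun_norm_addHaar volume (fun r => newtonDensity ε (r ^ 2))]
  have h1 : Module.finrank ℝ Space3 = 3 := by simp
  have h2 : volume.real (Metric.ball (0 : Space3) 1) = 4 / 3 * Real.pi := by
    rw [Measure.real, EuclideanSpace.volume_ball_fin_three]
    rw [ENNReal.ofReal_one, one_pow, one_mul, ENNReal.toReal_ofReal (by positivity)]; ring
  have h3 : ∫ y in Ioi (0 : ℝ), y ^ (3 - 1) • newtonDensity ε (y ^ 2) = 1 := by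
    have hs : ∫ y in Ioi (0 : ℝ), y ^ (3 - 1) • newtonDensity ε (y ^ 2) =
        ∫ y in Ioc (0 : ℝ) ε, y ^ (3 - 1) • newtonDensity ε (y ^ 2) := by
      refine setIntegral_eq_of_subset_of_forall_sdiff_eq_zero measurableSet_Ioi
        (fun x hx => hx.1) fun x hx => ?_
      have hx1 : 0 < x := hx.1
      have : ε < x := by by_contra h; exact hx.2 ⟨hx1, not_lt.1 h⟩
      rw [newtonDensity_of_le hε (by gcongr), smul_zero]
    rw [hs, ← intervalIntegral.integral_of_le hε.le]
    have hc : ∀ y ∈ uIcc 0 ε, y ^ (3 - 1) • newtonDensity ε (y ^ 2) =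
        (15 / 2) / ε ^ 3 * y ^ 2 - (15 / 2) / ε ^ 5 * y ^ 4 := by
      intro y hy
      rw [uIcc_of_le hε.le] at hy
      rw [newtonDensity_of_ge hε (by have := hy.1; have := hy.2; gcongr), smul_eq_mul]
      field_simp
    rw [intervalIntegral.integral_congr hc, intervalIntegral.integral_sub
      (Continuous.intervalIntegrable (by fun_prop) _ _)
      (Continuous.intervalIntegrable (by fun_prop) _ _), intervalIntegral.integral_const_mul,
      intervalIntegral.integral_const_mul, integral_pow, integral_pow]
    field_simp; norm_num; ring
  rw [h1, h2, h3]
  simp; ring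

/-! ### Invariance of the Gauss integral under homotopy and reparametrization. -/

theorem gaussDensity_newtonKernel {ε : ℝ} (hε : 0 < ε) {x : Space3} (hx : ε ≤ ‖x‖) (u v : Space3) :
    gaussDensity (newtonKernel ε) x u v = tripleProduct x u v / ‖x‖ ^ 3 := by
  rw [gaussDensity, newtonKernel_of_le hε (by gcongr), Real.sqrt_sq (norm_nonneg _)]; ring

theorem gaussPairing_congr {χ₁ χ₂ : ℝ → ℝ} {a b : ℝ} {P P' Q Q' : ℝ → Space3}
    (h : ∀ σ τ, gaussDensity χ₁ (P σ - Q τ) (P' σ) (Q' τ) =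
      gaussDensity χ₂ (P σ - Q τ) (P' σ) (Q' τ)) :
    gaussPairing χ₁ a b P P' Q Q' = gaussPairing χ₂ a b P P' Q Q' := by
  simp only [gaussPairing, h]

theorem gaussPairing_symm {χ : ℝ → ℝ} (hχ : Continuous χ) {a b : ℝ} {P P' Q Q' : ℝ → Space3}
    (hP : IsC1Loop a P P') (hQ : IsC1Loop b Q Q') :
    gaussPairing χ a b P P' Q Q' = gaussPairing χ b a Q Q' P P' := by
  have cP := hP.continuous
  have cP' := hP.continuous_deriv
  have cQ := hQ.continuous
  have cQ' := hQ.continuous_deriv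
  rw [gaussPairing, intervalIntegral_swap_of_continuous, gaussPairing]
  · congr 1; ext τ; congr 1; ext σ
    rw [gaussDensity, gaussDensity, norm_sub_rev]
    congr 1
    simp only [tripleProduct_eq, PiLp.sub_apply]; ring
  · simp only [Function.uncurry_def, gaussDensity]; fun_prop

/-- The Gauss integral is invariant under linear homotopies of the first curve which avoid the
second one. -/
theorem gaussPairing_add_eq {ε : ℝ} (hε : 0 < ε) {a b : ℝ} {P P' V V' Q Q' : ℝ → Space3}
    (hP : IsC1Loop a P P') (hV : IsC1Loop a V V') (hQ : IsC1Loop b Q Q')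
    (h : ∀ r ∈ Icc (0 : ℝ) 1, ∀ σ τ, ε ≤ ‖P σ + r • V σ - Q τ‖) :
    gaussPairing (newtonKernel ε) a b (fun x => P x + V x) (fun x => P' x + V' x) Q Q' =
      gaussPairing (newtonKernel ε) a b P P' Q Q' := by
  rw [← sub_eq_zero, gaussPairing_add_sub (hasDerivAt_newtonKernel hε)
    (continuous_newtonKernelDeriv hε) hP hV hQ]
  rw [intervalIntegral.integral_congr (g := fun _ => 0)]
  · simp
  intro r hr
  rw [uIcc_of_le zero_le_one] at hr
  have : ∀ σ τ, kernelDiv (newtonKernel ε) (newtonKernelDeriv ε)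
      (‖P σ + r • V σ - Q τ‖ ^ 2) = 0 := fun σ τ =>
    newtonDensity_of_le hε (by have := h r hr σ τ; gcongr)
  simp [this]

/-- The linear homotopy from `P` to `R` stays within `ε` of `C`, hence at distance at least `ε` from
`Q`, where the kernel is divergence-free. -/
theorem gaussPairing_eq_of_close {ε : ℝ} (hε : 0 < ε) {a b : ℝ}
    {P P' R R' Q Q' C : ℝ → Space3} (hP : IsC1Loop a P P') (hR : IsC1Loop a R R')
    (hQ : IsC1Loop b Q Q') (hPC : ∀ σ, ‖P σ - C σ‖ ≤ ε) (hRC : ∀ σ, ‖R σ - C σ‖ ≤ ε)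
    (hCQ : ∀ σ τ, 2 * ε ≤ ‖C σ - Q τ‖) :
    gaussPairing (newtonKernel ε) a b R R' Q Q' = gaussPairing (newtonKernel ε) a b P P' Q Q' := by
  have := gaussPairing_add_eq hε hP (hR.sub hP) hQ (fun r hr σ τ => by
    have e : P σ + r • (R σ - P σ) - Q τ =
        (C σ - Q τ) + ((1 - r) • (P σ - C σ) + r • (R σ - C σ)) := by module
    have h1 : ‖(1 - r) • (P σ - C σ) + r • (R σ - C σ)‖ ≤ ε := by
      refine (norm_add_le _ _).trans ?_
      rw [norm_smul, norm_smul, Real.norm_of_nonneg hr.1, Real.norm_of_nonneg (sub_nonneg.2 hr.2)]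
      nlinarith [hPC σ, hRC σ, hr.1, hr.2]
    have h2 := norm_sub_le_norm_add (C σ - Q τ) ((1 - r) • (P σ - C σ) + r • (R σ - C σ))
    rw [e]; linarith [hCQ σ τ])
  simpa using this

theorem gaussLinkingIntegral_eq {ε : ℝ} (hε : 0 < ε) {p : ClosedCurve × ClosedCurve}
    (h : ∀ σ τ, ε ≤ ‖p.1.lift σ - p.2.lift τ‖) : gaussLinkingIntegral p =
      1 / (4 * Real.pi) * gaussPairing (newtonKernel ε) 1 1 p.1.lift (deriv p.1.lift)
        p.2.lift (deriv p.2.lift) := by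
  rw [gaussLinkingIntegral, gaussPairing]
  simp only [gaussDensity_newtonKernel hε (h _ _)]

theorem IsC1Loop.of_contDiff {γ : ClosedCurve} (h : ContDiff ℝ 1 γ.lift) :
    IsC1Loop 1 γ.lift (deriv γ.lift) :=
  ⟨γ.lift_periodic, fun x => ((contDiff_one_iff_deriv.1 h).1 x).hasDerivAt,
    (contDiff_one_iff_deriv.1 h).2⟩

theorem IsC1Loop.periodic_deriv {a : ℝ} {P P' : ℝ → Space3} (h : IsC1Loop a P P') :
    Function.Periodic P' a := fun x => by
  have h1 : HasDerivAt (fun y => P (y + a)) (P' (x + a)) x := (h.hasDerivAt (x + a)).comp_add_const x a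
  have h2 : (fun y => P (y + a)) = P := funext h.periodic
  rw [h2] at h1
  exact h1.unique (h.hasDerivAt x)

theorem IsC1Loop.comp {a b : ℝ} {P P' : ℝ → Space3} (h : IsC1Loop b P P') {φ φ' : ℝ → ℝ}
    (hφ : ∀ x, HasDerivAt φ (φ' x) x) (hφ' : Continuous φ') (hp : ∀ x, φ (x + a) = φ x + b) :
    IsC1Loop a (fun x => P (φ x)) (fun x => φ' x • P' (φ x)) := by
  have hc : Continuous φ := continuous_iff_continuousAt.2 fun x => (hφ x).continuousAt
  refine ⟨fun x => ?_, fun x => (h.hasDerivAt (φ x)).scomp x (hφ x), ?_⟩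
  · simp only [hp]; exact h.periodic _
  · exact hφ'.smul (h.continuous_deriv.comp hc)

/-- The Gauss integral does not depend on the parametrization. -/
theorem gaussPairing_comp {χ : ℝ → ℝ} (hχ : Continuous χ) {a b c : ℝ} {P P' Q Q' : ℝ → Space3}
    (hP : IsC1Loop b P P') (hQ : IsC1Loop c Q Q') {φ φ' : ℝ → ℝ}
    (hφ : ∀ x, HasDerivAt φ (φ' x) x) (hφ' : Continuous φ') (hp : ∀ x, φ (x + a) = φ x + b) :
    gaussPairing χ a c (fun x => P (φ x)) (fun x => φ' x • P' (φ x)) Q Q' =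
      gaussPairing χ b c P P' Q Q' := by
  have cP := hP.continuous
  have cP' := hP.continuous_deriv
  have cQ := hQ.continuous
  have cQ' := hQ.continuous_deriv
  set f : ℝ → ℝ := fun σ => ∫ τ in (0 : ℝ)..c, gaussDensity χ (P σ - Q τ) (P' σ) (Q' τ) with hf
  have cf : Continuous f := by
    refine intervalIntegral.continuous_parametric_intervalIntegral_of_continuous' ?_ _ _
    simp only [Function.uncurry_def, gaussDensity]; fun_prop
  have e1 : gaussPairing χ a c (fun x => P (φ x)) (fun x => φ' x • P' (φ x)) Q Q' =
      ∫ x in (0 : ℝ)..a, (f ∘ φ) x * φ' x := by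
    rw [gaussPairing]
    congr 1; ext x
    simp only [hf, Function.comp]
    rw [← intervalIntegral.integral_mul_const]
    congr 1; ext τ
    simp only [gaussDensity, tripleProduct_eq, PiLp.smul_apply, smul_eq_mul]; ring
  rw [e1, intervalIntegral.integral_comp_mul_deriv (fun x _ => hφ x) hφ'.continuousOn cf]
  have hfp : Function.Periodic f b := fun x => by
    simp only [hf, hP.periodic x, hP.periodic_deriv x]
  have h0 := hp 0
  rw [zero_add] at h0
  rw [h0, hfp.intervalIntegral_add_eq (φ 0) 0, zero_add]
  rfl

/-! ### Steklov averages. -/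

section Steklov

variable {E : Type*} [NormedAddCommGroup E] [NormedSpace ℝ E]

/-- The average of `f` over an interval of length `δ` starting at the given point. -/
def steklov (δ : ℝ) (f : ℝ → E) (t : ℝ) : E := (1 / δ) • ∫ x in t..t + δ, f x

theorem hasDerivAt_steklov [CompleteSpace E] (δ : ℝ) {f : ℝ → E} (hf : Continuous f) (t : ℝ) :
    HasDerivAt (steklov δ f) ((1 / δ) • (f (t + δ) - f t)) t := by
  have hi : ∀ a b, IntervalIntegrable f volume a b := fun a b => hf.intervalIntegrable a b
  have e : steklov δ f = fun t => (1 / δ) • ((∫ x in (0 : ℝ)..t + δ, f x) - ∫ x in (0 : ℝ)..t, f x) := by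
    ext t; rw [steklov, intervalIntegral.integral_interval_sub_left (hi _ _) (hi _ _)]
  rw [e]
  have h1 : ∀ t, HasDerivAt (fun t => ∫ x in (0 : ℝ)..t, f x) (f t) t := fun t =>
    intervalIntegral.integral_hasDerivAt_right (hi _ _) (hf.stronglyMeasurableAtFilter _ _)
      hf.continuousAt
  exact (((h1 (t + δ)).comp_add_const t δ).sub (h1 t)).const_smul _

theorem norm_steklov_sub_le [CompleteSpace E] {δ : ℝ} (hδ : 0 < δ) {f : ℝ → E} (hf : Continuous f) {t : ℝ} {v : E}
    {C : ℝ} (h : ∀ x ∈ Icc t (t + δ), ‖f x - v‖ ≤ C) : ‖steklov δ f t - v‖ ≤ C := by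
  have e : steklov δ f t - v = (1 / δ) • ∫ x in t..t + δ, (f x - v) := by
    rw [intervalIntegral.integral_sub (hf.intervalIntegrable _ _) (by simp), steklov,
      intervalIntegral.integral_const, smul_sub, add_sub_cancel_left, smul_smul,
      one_div_mul_cancel hδ.ne', one_smul]
  rw [e, norm_smul, Real.norm_of_nonneg (by positivity)]
  have := intervalIntegral.norm_integral_le_of_norm_le_const (a := t) (b := t + δ)
    (f := fun x => f x - v) (C := C) (fun x hx => by
      rw [uIoc_of_le (by linarith)] at hx
      exact h x ⟨hx.1.le, hx.2⟩)
  rw [add_sub_cancel_left, abs_of_pos hδ] at this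
  calc 1 / δ * ‖∫ x in t..t + δ, (f x - v)‖ ≤ 1 / δ * (C * δ) := by gcongr
    _ = C := by field_simp

theorem steklov_add_of_periodic (δ : ℝ) {f : ℝ → E} {c : ℝ} (hp : Function.Periodic f c) :
    Function.Periodic (steklov δ f) c := fun t => by
  rw [steklov, steklov, show t + c + δ = t + δ + c by ring,
    ← intervalIntegral.integral_comp_add_right]
  simp only [hp _]

theorem steklov_add_of_add {δ : ℝ} (hδ : δ ≠ 0) {f : ℝ → ℝ} (hf : Continuous f) {c ℓ : ℝ}
    (hp : ∀ t, f (t + c) = f t + ℓ) (t : ℝ) : steklov δ f (t + c) = steklov δ f t + ℓ := by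
  rw [steklov, steklov, show t + c + δ = t + δ + c by ring,
    ← intervalIntegral.integral_comp_add_right]
  simp only [hp]
  rw [intervalIntegral.integral_add (hf.intervalIntegrable _ _) (by simp),
    intervalIntegral.integral_const, smul_add, add_sub_cancel_left, smul_smul,
    one_div_mul_cancel hδ, one_smul]

end Steklov

/-- The closed curve given by a continuous function of period one. -/
def closedCurveOfPeriodic (f : ℝ → Space3) (hf : Continuous f) (hp : Function.Periodic f 1) :
    ClosedCurve :=
  ⟨hp.lift, ((QuotientAddGroup.isQuotientMap_mk (AddSubgroup.zmultiples (1 : ℝ))).continuous_iff).2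
    hf⟩

theorem closedCurveOfPeriodic_lift (f : ℝ → Space3) (hf : Continuous f)
    (hp : Function.Periodic f 1) : (closedCurveOfPeriodic f hf hp).lift = f := rfl

theorem ClosedCurve.dist_lt_of_lift {γ δ : ClosedCurve} {C : ℝ} (hC : 0 < C)
    (h : ∀ t ∈ Icc (0 : ℝ) 1, ‖γ.lift t - δ.lift t‖ < C) : dist γ δ < C := by
  rw [ContinuousMap.dist_lt_iff hC]
  intro x
  have hx : x ∈ ((↑) : ℝ → UnitAddCircle) '' Ico 0 (0 + 1) := by
    rw [AddCircle.coe_image_Ico_eq]; trivial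
  obtain ⟨t, ht, rfl⟩ := hx
  rw [zero_add] at ht
  rw [dist_eq_norm]
  exact h t ⟨ht.1, ht.2.le⟩

theorem ClosedCurve.norm_lift_sub_le (γ δ : ClosedCurve) (t : ℝ) :
    ‖γ.lift t - δ.lift t‖ ≤ dist γ δ := by
  rw [← dist_eq_norm]; exact ContinuousMap.dist_apply_le_dist _

/-! ### The linking number as a Gauss integral of unit-speed loops. -/

namespace UnitSpeedLoop

variable {L : Set Space3} {γ : ClosedCurve}

theorem continuous_T (A : UnitSpeedLoop L γ) : Continuous A.T :=
  (LipschitzWith.of_dist_le_mul (K := 1) fun x y => by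
    rw [dist_eq_norm, Real.dist_eq, NNReal.coe_one, one_mul]; exact A.lipschitz_T x y).continuous

theorem isC1Loop (A : UnitSpeedLoop L γ) : IsC1Loop A.ℓ A.J A.T :=
  ⟨A.periodic, A.hasDerivAt, A.continuous_T⟩

theorem continuous_J (A : UnitSpeedLoop L γ) : Continuous A.J := A.isC1Loop.continuous

theorem norm_J_sub_le (A : UnitSpeedLoop L γ) (x y : ℝ) : ‖A.J x - A.J y‖ ≤ |x - y| := by
  have := Convex.norm_image_sub_le_of_norm_hasDerivWithin_le (f := A.J) (f' := A.T) (s := univ)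
    (C := 1) (x := y) (y := x) (fun x _ => (A.hasDerivAt x).hasDerivWithinAt)
    (fun x _ => (A.norm_T x).le) convex_univ trivial trivial
  rwa [one_mul, Real.norm_eq_abs] at this

/-- There are `C¹` closed curves close to a curve of unit thickness, obtained by smoothing the
arc-length function. -/
theorem exists_close (A : UnitSpeedLoop L γ) {ε : ℝ} (hε : 0 < ε) :
    ∃ (α : ClosedCurve) (φ φ' : ℝ → ℝ), (∀ x, HasDerivAt φ (φ' x) x) ∧ Continuous φ' ∧
      (∀ x, φ (x + 1) = φ x + A.ℓ) ∧ (α.lift = fun x => A.J (φ x)) ∧ dist α γ < ε := by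
  obtain ⟨δ₀, hδ₀, hu⟩ := Metric.uniformContinuousOn_iff.1
    ((isCompact_Icc (a := (0 : ℝ)) (b := 2)).uniformContinuousOn_of_continuous
      A.continuous_s.continuousOn) (ε / 2) (by positivity)
  set δ := min (δ₀ / 2) 1 with hδ
  have hδpos : 0 < δ := by positivity
  have hd : ∀ x, HasDerivAt (steklov δ A.s) ((1 / δ) • (A.s (x + δ) - A.s x)) x :=
    hasDerivAt_steklov δ A.continuous_s
  have hc : Continuous fun x => (1 / δ) • (A.s (x + δ) - A.s x) := by
    have := A.continuous_s; fun_prop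
  have hp : ∀ x, steklov δ A.s (x + 1) = steklov δ A.s x + A.ℓ :=
    steklov_add_of_add hδpos.ne' A.continuous_s A.s_add_one
  have hC1 := A.isC1Loop.comp hd hc hp
  refine ⟨closedCurveOfPeriodic _ hC1.continuous hC1.periodic, _, _, hd, hc, hp, rfl, ?_⟩
  refine ClosedCurve.dist_lt_of_lift hε fun t ht => ?_
  rw [closedCurveOfPeriodic_lift, A.lift_eq]
  refine (A.norm_J_sub_le _ _).trans_lt ?_
  have := norm_steklov_sub_le hδpos A.continuous_s (t := t) (v := A.s t) (C := ε / 2)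
    (fun x hx => by
      have h1 : δ ≤ δ₀ / 2 := min_le_left _ _
      have h2 : δ ≤ 1 := min_le_right _ _
      have := hu x ⟨by linarith [hx.1, ht.1], by linarith [hx.2, ht.2]⟩ t
        ⟨ht.1, by linarith [ht.2]⟩ (by
          rw [Real.dist_eq, abs_of_nonneg (by linarith [hx.1])]; linarith [hx.2])
      rw [dist_eq_norm] at this
      exact this.le)
  rw [Real.norm_eq_abs] at this
  linarith

/-- The linking number of two disjoint curves of unit thickness is the Gauss integral of their
unit-speed parametrizations. -/
theorem linkingNumber_eq {δ : ClosedCurve} {M : Set Space3} (A : UnitSpeedLoop L γ)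
    (B : UnitSpeedLoop M δ) {ε : ℝ} (hε : 0 < ε) (h : ∀ x y, ε ≤ ‖A.J x - B.J y‖) :
    linkingNumber γ δ =
      1 / (4 * Real.pi) * gaussPairing (newtonKernel ε) A.ℓ B.ℓ A.J A.T B.J B.T := by
  -- Two curves at distance `5 * η` remain at distance `3 * η` when each moves by at most `η`; this
  -- exceeds the margin needed to compare two nearby `C¹` pairs by linear homotopies.
  set η := ε / 5 with hη
  have hη0 : 0 < η := by positivity
  have hker : gaussPairing (newtonKernel ε) A.ℓ B.ℓ A.J A.T B.J B.T =
      gaussPairing (newtonKernel η) A.ℓ B.ℓ A.J A.T B.J B.T := gaussPairing_congr fun σ τ => by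
    rw [gaussDensity_newtonKernel hε (h σ τ), gaussDensity_newtonKernel hη0
      ((by rw [hη]; linarith : η ≤ ε).trans (h σ τ))]
  rw [hker]
  have cχ : Continuous (newtonKernel η) :=
    continuous_iff_continuousAt.2 fun s => (hasDerivAt_newtonKernel hη0 s).continuousAt
  have hfar : ∀ s t, 5 * η ≤ ‖γ.lift s - δ.lift t‖ := fun s t => by
    rw [A.lift_eq, B.lift_eq]; have := h (A.s s) (B.s t); rw [hη]; linarith
  -- Smoothing the arc-length functions gives `C¹` pairs arbitrarily close to `(γ, δ)` that are
  -- reparametrizations of the unit-speed loops, so their Gauss integrals have exactly the asserted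
  -- value. They show both that `(γ, δ)` is in the closure of `C1Pairs` and what the limit is.
  have hclose : ∀ c : ℝ, 0 < c → c ≤ η → ∃ p ∈ C1Pairs, dist p (γ, δ) < c ∧
      ∃ P' Q', IsC1Loop 1 p.1.lift P' ∧ IsC1Loop 1 p.2.lift Q' ∧
        gaussPairing (newtonKernel η) 1 1 p.1.lift P' p.2.lift Q' =
          gaussPairing (newtonKernel η) A.ℓ B.ℓ A.J A.T B.J B.T := by
    intro c hc _
    obtain ⟨α, φ, φ', hφ, hφ', hφp, hα, hαγ⟩ := A.exists_close hc
    obtain ⟨β, ψ, ψ', hψ, hψ', hψp, hβ, hβδ⟩ := B.exists_close hc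
    have h1 := A.isC1Loop.comp hφ hφ' hφp
    have h2 := B.isC1Loop.comp hψ hψ' hψp
    refine ⟨(α, β), ⟨?_, ?_⟩, ?_, fun x => φ' x • A.T (φ x), fun x => ψ' x • B.T (ψ x), ?_, ?_, ?_⟩
    · rw [contDiff_one_iff_deriv]; simp only [hα]
      exact ⟨fun x => (h1.hasDerivAt x).differentiableAt, by
        rw [funext fun x => (h1.hasDerivAt x).deriv]; exact h1.continuous_deriv⟩
    · rw [contDiff_one_iff_deriv]; simp only [hβ]
      exact ⟨fun x => (h2.hasDerivAt x).differentiableAt, by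
        rw [funext fun x => (h2.hasDerivAt x).deriv]; exact h2.continuous_deriv⟩
    · rw [Prod.dist_eq]; exact max_lt hαγ hβδ
    · simp only [hα]; exact h1
    · simp only [hβ]; exact h2
    · simp only [hα, hβ]
      rw [gaussPairing_comp cχ A.isC1Loop h2 hφ hφ' hφp, gaussPairing_symm cχ A.isC1Loop h2,
        gaussPairing_comp cχ B.isC1Loop A.isC1Loop hψ hψ' hψp,
        gaussPairing_symm cχ B.isC1Loop A.isC1Loop]
  refine extendFrom_eq (Metric.mem_closure_iff.2 fun c hc => ?_) ?_
  · obtain ⟨p, hp, hd, -⟩ := hclose (min c η) (by positivity) (min_le_right _ _)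
    exact ⟨p, hp, by rw [dist_comm]; exact hd.trans_le (min_le_left _ _)⟩
  · obtain ⟨q, hq, hqd, P', Q', hP', hQ', hval⟩ := hclose η hη0 le_rfl
    refine Tendsto.congr' (f₁ := fun _ => 1 / (4 * Real.pi) *
      gaussPairing (newtonKernel η) A.ℓ B.ℓ A.J A.T B.J B.T) ?_ tendsto_const_nhds
    filter_upwards [inter_mem_nhdsWithin C1Pairs (Metric.ball_mem_nhds (γ, δ) hη0)] with p hp
    obtain ⟨⟨hp1, hp2⟩, hpd⟩ := hp
    rw [Metric.mem_ball] at hpd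
    rw [Prod.dist_eq] at hpd hqd
    have hpd1 := fun t => (p.1.norm_lift_sub_le γ t).trans ((le_max_left _ _).trans hpd.le)
    have hpd2 := fun t => (p.2.norm_lift_sub_le δ t).trans ((le_max_right _ _).trans hpd.le)
    have hqd1 := fun t => (q.1.norm_lift_sub_le γ t).trans ((le_max_left _ _).trans hqd.le)
    have hqd2 := fun t => (q.2.norm_lift_sub_le δ t).trans ((le_max_right _ _).trans hqd.le)
    have hpL := IsC1Loop.of_contDiff hp1
    have hpR := IsC1Loop.of_contDiff hp2
    have tri : ∀ (u v w z : Space3), 5 * η ≤ ‖u - v‖ → ‖w - v‖ ≤ η → ‖z - u‖ ≤ η →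
        3 * η ≤ ‖z - w‖ := by
      intro u v w z h1 h2 h3
      have e : u - v = (z - w) + (w - v) - (z - u) := by abel
      rw [e] at h1
      linarith [norm_sub_le ((z - w) + (w - v)) (z - u), norm_add_le (z - w) (w - v)]
    rw [gaussLinkingIntegral_eq hη0 (fun σ τ => by
      have := tri (γ.lift σ) (δ.lift τ) (p.2.lift τ) (p.1.lift σ) (hfar σ τ) (hpd2 τ) (hpd1 σ)
      linarith), ← hval]
    congr 1
    -- The pair `p` is moved to `q` one curve at a time, through the mixed pair `(q.1, p.2)`.
    have s1 := gaussPairing_eq_of_close hη0 hpL hP' hpR (C := γ.lift) hpd1 hqd1 (fun σ τ => by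
      have := tri (γ.lift σ) (δ.lift τ) (p.2.lift τ) (γ.lift σ) (hfar σ τ) (hpd2 τ)
        (by rw [sub_self, norm_zero]; exact hη0.le)
      linarith)
    have s2 := gaussPairing_eq_of_close hη0 hpR hQ' hP' (C := δ.lift) hpd2 hqd2 (fun σ τ => by
      have := tri (δ.lift σ) (γ.lift τ) (q.1.lift τ) (δ.lift σ) (by
        rw [norm_sub_rev]; exact hfar τ σ) (hqd1 τ)
        (by rw [sub_self, norm_zero]; exact hη0.le)
      linarith)
    rw [← s1, gaussPairing_symm cχ hP' hpR, ← s2, gaussPairing_symm cχ hQ' hP']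

end UnitSpeedLoop

/-! ### Cones over a loop; tubes and normal frames. -/

/-- The area of the parallelogram spanned by two vectors. -/
def parallelogramArea (u v : Space3) : ℝ := √(‖u‖ ^ 2 * ‖v‖ ^ 2 - ⟪u, v⟫ ^ 2)

theorem abs_tripleProduct_le (u v w : Space3) :
    |tripleProduct u v w| ≤ parallelogramArea u v * ‖w‖ := by
  rw [← Real.sqrt_sq_eq_abs, parallelogramArea, ← Real.sqrt_sq (norm_nonneg w),
    ← Real.sqrt_mul (by nlinarith [real_inner_mul_inner_self_le u v,
      real_inner_self_eq_norm_sq u, real_inner_self_eq_norm_sq v])]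
  apply Real.sqrt_le_sqrt
  simp only [tripleProduct_eq, inner_eq_coords, norm_sq_eq_coords]
  set c0 := u 1 * v 2 - u 2 * v 1 with h0
  set c1 := u 2 * v 0 - u 0 * v 2 with h1
  set c2 := u 0 * v 1 - u 1 * v 0 with h2
  have e1 : u 0 * (v 1 * w 2 - v 2 * w 1) - u 1 * (v 0 * w 2 - v 2 * w 0) +
      u 2 * (v 0 * w 1 - v 1 * w 0) = c0 * w 0 + c1 * w 1 + c2 * w 2 := by
    rw [h0, h1, h2]; ring
  have e2 : (u 0 ^ 2 + u 1 ^ 2 + u 2 ^ 2) * (v 0 ^ 2 + v 1 ^ 2 + v 2 ^ 2) -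
      (u 0 * v 0 + u 1 * v 1 + u 2 * v 2) ^ 2 = c0 ^ 2 + c1 ^ 2 + c2 ^ 2 := by
    rw [h0, h1, h2]; ring
  rw [e1, e2]
  nlinarith [sq_nonneg (c0 * w 1 - c1 * w 0), sq_nonneg (c0 * w 2 - c2 * w 0),
    sq_nonneg (c1 * w 2 - c2 * w 1)]

theorem abs_tripleProduct_of_orthogonal {u v w : Space3} (huv : ⟪u, v⟫ = 0) (huw : ⟪u, w⟫ = 0)
    (hvw : ⟪v, w⟫ = 0) : |tripleProduct u v w| = ‖u‖ * ‖v‖ * ‖w‖ := by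
  have h : tripleProduct u v w ^ 2 = (‖u‖ * ‖v‖ * ‖w‖) ^ 2 := by
    have g : tripleProduct u v w ^ 2 = ‖u‖ ^ 2 * (‖v‖ ^ 2 * ‖w‖ ^ 2 - ⟪v, w⟫ ^ 2) -
        ⟪u, v⟫ * (⟪u, v⟫ * ‖w‖ ^ 2 - ⟪v, w⟫ * ⟪u, w⟫) +
        ⟪u, w⟫ * (⟪u, v⟫ * ⟪v, w⟫ - ‖v‖ ^ 2 * ⟪u, w⟫) := by
      simp only [tripleProduct_eq, inner_eq_coords, norm_sq_eq_coords]; ring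
    rw [g, huv, huw, hvw]; ring
  rw [← Real.sqrt_sq_eq_abs, h, Real.sqrt_sq (by positivity)]

theorem intervalIntegral_swap_pairs {f : ℝ → ℝ → ℝ → ℝ → ℝ}
    (hf : Continuous fun p : ℝ × ℝ × ℝ × ℝ => f p.1 p.2.1 p.2.2.1 p.2.2.2)
    (a b c d a' b' c' d' : ℝ) :
    ∫ x in a..b, ∫ y in c..d, ∫ z in a'..b', ∫ w in c'..d', f x y z w =
      ∫ z in a'..b', ∫ w in c'..d', ∫ x in a..b, ∫ y in c..d, f x y z w := by
  have slice : ∀ {X : Type} [TopologicalSpace X] {u v w z : X → ℝ}, Continuous u → Continuous v →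
      Continuous w → Continuous z → Continuous fun x => f (u x) (v x) (w x) (z x) :=
    fun hu hv hw hz => hf.comp (hu.prodMk (hv.prodMk (hw.prodMk hz)))
  calc _ = ∫ x in a..b, ∫ z in a'..b', ∫ y in c..d, ∫ w in c'..d', f x y z w := by
        congr 1; ext x
        exact intervalIntegral_swap_of_continuous (f := fun y z => ∫ w in c'..d', f x y z w)
          (intervalIntegral.continuous_parametric_intervalIntegral_of_continuous' (X := ℝ × ℝ)
            (f := fun p w => f x p.1 p.2 w)
            (slice (by fun_prop) (by fun_prop) (by fun_prop) (by fun_prop)) _ _) _ _ _ _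
    _ = ∫ z in a'..b', ∫ x in a..b, ∫ y in c..d, ∫ w in c'..d', f x y z w := by
        refine intervalIntegral_swap_of_continuous
          (f := fun x z => ∫ y in c..d, ∫ w in c'..d', f x y z w) ?_ _ _ _ _
        refine intervalIntegral.continuous_parametric_intervalIntegral_of_continuous'
          (X := ℝ × ℝ) (f := fun p y => ∫ w in c'..d', f p.1 y p.2 w) ?_ _ _
        exact intervalIntegral.continuous_parametric_intervalIntegral_of_continuous'
          (X := (ℝ × ℝ) × ℝ) (f := fun p w => f p.1.1 p.2 p.1.2 w)
          (slice (by fun_prop) (by fun_prop) (by fun_prop) (by fun_prop)) _ _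
    _ = ∫ z in a'..b', ∫ x in a..b, ∫ w in c'..d', ∫ y in c..d, f x y z w := by
        congr 1; ext z; congr 1; ext x
        exact intervalIntegral_swap_of_continuous (f := fun y w => f x y z w)
          (slice (by fun_prop) (by fun_prop) (by fun_prop) (by fun_prop)) _ _ _ _
    _ = _ := by
        congr 1; ext z
        refine intervalIntegral_swap_of_continuous (f := fun x w => ∫ y in c..d, f x y z w)
          ?_ _ _ _ _
        exact intervalIntegral.continuous_parametric_intervalIntegral_of_continuous'
          (X := ℝ × ℝ) (f := fun p y => f p.1 y z p.2)
          (slice (by fun_prop) (by fun_prop) (by fun_prop) (by fun_prop)) _ _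

/-- The Gauss integral of a loop `R` with a loop `Q` as an integral over the cone with apex `p`
over `Q`. -/
theorem gaussPairing_eq_cone {ε : ℝ} (hε : 0 < ε) {c b : ℝ} {R R' Q Q' : ℝ → Space3}
    (hR : IsC1Loop c R R') (hQ : IsC1Loop b Q Q') (p : Space3) :
    gaussPairing (newtonKernel ε) c b R R' Q Q' =
      ∫ r in (0 : ℝ)..1, ∫ τ in (0 : ℝ)..b, ∫ σ in (0 : ℝ)..c,
        newtonDensity ε (‖p + r • (Q τ - p) - R σ‖ ^ 2) *
          (r * tripleProduct (Q τ - p) (Q' τ) (R' σ)) := by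
  have cχ : Continuous (newtonKernel ε) :=
    continuous_iff_continuousAt.2 fun s => (hasDerivAt_newtonKernel hε s).continuousAt
  -- `Q` is deformed from the constant loop at `p`, whose Gauss integral is zero; the deformation
  -- sweeps out the cone, and the change along it is the whole integral.
  have h := gaussPairing_add_sub (hasDerivAt_newtonKernel hε) (continuous_newtonKernelDeriv hε)
    (isC1Loop_const b p) (hQ.sub (isC1Loop_const b p)) hR
  have h0 : gaussPairing (newtonKernel ε) b c (fun _ => p) (fun _ => 0) R R' = 0 := by
    simp [gaussPairing, gaussDensity, tripleProduct_zero_mid]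
  rw [h0, sub_zero] at h
  simp only [add_sub_cancel, zero_add, sub_zero] at h
  rw [gaussPairing_symm cχ hR hQ, h]
  congr 1; ext r; congr 1; ext τ; congr 1; ext σ
  rw [newtonDensity]
  congr 1
  simp only [tripleProduct_eq, PiLp.smul_apply, smul_eq_mul]; ring

/-- A loop `P` of class `C¹` with an orthonormal frame of class `C¹` of its normal bundle. -/
structure NormalFrame (a : ℝ) (P P' e₁ e₁' e₂ e₂' : ℝ → Space3) : Prop where
  curve : IsC1Loop a P P'
  fst : IsC1Loop a e₁ e₁'
  snd : IsC1Loop a e₂ e₂'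
  norm_fst : ∀ s, ‖e₁ s‖ = 1
  norm_snd : ∀ s, ‖e₂ s‖ = 1
  inner_fst_snd : ∀ s, ⟪e₁ s, e₂ s⟫ = 0
  inner_curve_fst : ∀ s, ⟪P' s, e₁ s⟫ = 0
  inner_curve_snd : ∀ s, ⟪P' s, e₂ s⟫ = 0

namespace NormalFrame

variable {a : ℝ} {P P' e₁ e₁' e₂ e₂' : ℝ → Space3}

theorem inner_deriv_const {u v u' v' : ℝ → Space3} {s c : ℝ} (hu : HasDerivAt u (u' s) s)
    (hv : HasDerivAt v (v' s) s) (h : ∀ s, ⟪u s, v s⟫ = c) : ⟪u s, v' s⟫ + ⟪u' s, v s⟫ = 0 := by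
  have h1 := hu.inner ℝ hv
  rw [funext h] at h1
  exact h1.unique (hasDerivAt_const s c)

theorem inner_fst_deriv (F : NormalFrame a P P' e₁ e₁' e₂ e₂') (s : ℝ) : ⟪e₁' s, e₁ s⟫ = 0 := by
  have := inner_deriv_const (F.fst.hasDerivAt s) (F.fst.hasDerivAt s) (c := 1)
    (fun s => by rw [real_inner_self_eq_norm_sq, F.norm_fst, one_pow])
  rw [real_inner_comm] at this; linarith

theorem inner_snd_deriv (F : NormalFrame a P P' e₁ e₁' e₂ e₂') (s : ℝ) : ⟪e₂' s, e₂ s⟫ = 0 := by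
  have := inner_deriv_const (F.snd.hasDerivAt s) (F.snd.hasDerivAt s) (c := 1)
    (fun s => by rw [real_inner_self_eq_norm_sq, F.norm_snd, one_pow])
  rw [real_inner_comm] at this; linarith

theorem inner_snd_deriv_fst (F : NormalFrame a P P' e₁ e₁' e₂ e₂') (s : ℝ) :
    ⟪e₂' s, e₁ s⟫ = -⟪e₁' s, e₂ s⟫ := by
  have := inner_deriv_const (F.fst.hasDerivAt s) (F.snd.hasDerivAt s) F.inner_fst_snd
  rw [real_inner_comm]; linarith

/-- The unit normal vector with angle `θ`. -/
def radial (e₁ e₂ : ℝ → Space3) (s θ : ℝ) : Space3 := Real.cos θ • e₁ s + Real.sin θ • e₂ s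

/-- The derivative of `radial` with respect to the angle. -/
def angular (e₁ e₂ : ℝ → Space3) (s θ : ℝ) : Space3 := (-Real.sin θ) • e₁ s + Real.cos θ • e₂ s

/-- Polar coordinates of the tube around `P`. -/
def tube (P e₁ e₂ : ℝ → Space3) (s ρ θ : ℝ) : Space3 := P s + ρ • radial e₁ e₂ s θ

/-- The component along the curve of the derivative of `tube` along the curve. -/
def axial (P' e₁ e₁' e₂ e₂' : ℝ → Space3) (s ρ θ : ℝ) : Space3 :=
  P' s + ρ • radial e₁' e₂' s θ - (⟪e₁' s, e₂ s⟫ * ρ) • angular e₁ e₂ s θ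

theorem norm_radial (F : NormalFrame a P P' e₁ e₁' e₂ e₂') (s θ : ℝ) : ‖radial e₁ e₂ s θ‖ = 1 := by
  have : ‖radial e₁ e₂ s θ‖ ^ 2 = 1 := by
    rw [radial, norm_add_sq_real, norm_smul, norm_smul, real_inner_smul_left,
      real_inner_smul_right, F.inner_fst_snd, F.norm_fst, F.norm_snd, mul_pow, mul_pow,
      Real.norm_eq_abs, Real.norm_eq_abs, sq_abs, sq_abs]
    linarith [Real.sin_sq_add_cos_sq θ]
  exact (pow_eq_one_iff_of_nonneg (norm_nonneg _) two_ne_zero).1 this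

theorem norm_angular (F : NormalFrame a P P' e₁ e₁' e₂ e₂') (s θ : ℝ) :
    ‖angular e₁ e₂ s θ‖ = 1 := by
  have : ‖angular e₁ e₂ s θ‖ ^ 2 = 1 := by
    rw [angular, norm_add_sq_real, norm_smul, norm_smul, real_inner_smul_left,
      real_inner_smul_right, F.inner_fst_snd, F.norm_fst, F.norm_snd, mul_pow, mul_pow,
      Real.norm_eq_abs, Real.norm_eq_abs, sq_abs, sq_abs]
    linarith [Real.sin_sq_add_cos_sq θ]
  exact (pow_eq_one_iff_of_nonneg (norm_nonneg _) two_ne_zero).1 this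

theorem inner_radial_angular (F : NormalFrame a P P' e₁ e₁' e₂ e₂') (s θ : ℝ) :
    ⟪radial e₁ e₂ s θ, angular e₁ e₂ s θ⟫ = 0 := by
  simp only [radial, angular, inner_add_left, inner_add_right, real_inner_smul_left,
    real_inner_smul_right, F.inner_fst_snd, real_inner_comm (e₁ s) (e₂ s),
    real_inner_self_eq_norm_sq, F.norm_fst, F.norm_snd]
  ring

/-- The component of the derivative of the radial field in the normal plane is the rotation of the
frame, `⟪e₁' s, e₂ s⟫` times the angular vector. Subtracting it leaves a vector tangent to the core.
-/
theorem inner_axial (F : NormalFrame a P P' e₁ e₁' e₂ e₂') (s ρ θ : ℝ) :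
    ⟪axial P' e₁ e₁' e₂ e₂' s ρ θ, e₁ s⟫ = 0 ∧ ⟪axial P' e₁ e₁' e₂ e₂' s ρ θ, e₂ s⟫ = 0 := by
  constructor
  · simp only [axial, radial, angular, inner_add_left, inner_sub_left, real_inner_smul_left,
      F.inner_curve_fst, F.inner_fst_deriv, F.inner_snd_deriv_fst, real_inner_self_eq_norm_sq,
      F.norm_fst, real_inner_comm (e₁ s) (e₂ s), F.inner_fst_snd]
    ring
  · simp only [axial, radial, angular, inner_add_left, inner_sub_left, real_inner_smul_left,
      F.inner_curve_snd, F.inner_snd_deriv, real_inner_self_eq_norm_sq,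
      F.norm_snd, F.inner_fst_snd]
    ring

/-- This is the Jacobian of the tube coordinates. The rotation of the frame is a multiple of the
angular column, so it drops out of the determinant; the remaining three vectors are mutually
orthogonal. -/
theorem abs_tripleProduct_tube (F : NormalFrame a P P' e₁ e₁' e₂ e₂') {s ρ θ : ℝ} (hρ : 0 ≤ ρ) :
    |tripleProduct (P' s + ρ • radial e₁' e₂' s θ) (radial e₁ e₂ s θ)
      (ρ • angular e₁ e₂ s θ)| = ρ * ‖axial P' e₁ e₁' e₂ e₂' s ρ θ‖ := by
  have e : tripleProduct (P' s + ρ • radial e₁' e₂' s θ) (radial e₁ e₂ s θ)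
      (ρ • angular e₁ e₂ s θ) = ρ * tripleProduct (axial P' e₁ e₁' e₂ e₂' s ρ θ)
        (radial e₁ e₂ s θ) (angular e₁ e₂ s θ) := by
    rw [axial]
    generalize P' s + ρ • radial e₁' e₂' s θ = x
    generalize ⟪e₁' s, e₂ s⟫ * ρ = c
    simp only [tripleProduct_eq, PiLp.smul_apply, smul_eq_mul, PiLp.sub_apply]; ring
  obtain ⟨h1, h2⟩ := F.inner_axial s ρ θ
  rw [e, abs_mul, abs_of_nonneg hρ, abs_tripleProduct_of_orthogonal _ _
    (F.inner_radial_angular s θ), F.norm_radial, F.norm_angular, mul_one, mul_one]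
  · simp only [radial, inner_add_right, real_inner_smul_right, h1, h2]; ring
  · simp only [angular, inner_add_right, real_inner_smul_right, h1, h2]; ring

theorem isC1Loop_tube (F : NormalFrame a P P' e₁ e₁' e₂ e₂') (ρ θ : ℝ) :
    IsC1Loop a (fun s => tube P e₁ e₂ s ρ θ) (fun s => P' s + ρ • radial e₁' e₂' s θ) :=
  F.curve.add (((F.fst.const_smul _).add (F.snd.const_smul _)).const_smul _)

theorem hasDerivAt_radial (e₁ e₂ : ℝ → Space3) (s θ : ℝ) :
    HasDerivAt (radial e₁ e₂ s) (angular e₁ e₂ s θ) θ :=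
  ((Real.hasDerivAt_cos θ).smul_const _).add ((Real.hasDerivAt_sin θ).smul_const _)

theorem isC1Loop_circle (e₁ e₂ : ℝ → Space3) (s ρ : ℝ) :
    IsC1Loop (2 * Real.pi) (fun θ => ρ • radial e₁ e₂ s θ) (fun θ => ρ • angular e₁ e₂ s θ) := by
  refine ⟨fun θ => by simp [radial], fun θ => (hasDerivAt_radial e₁ e₂ s θ).const_smul ρ, ?_⟩
  unfold angular; fun_prop

end NormalFrame

/-! ### Change of variables in the tube. -/

/-- A box in space. -/
def box3 (a b c : ℝ) : Set Space3 :=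
  {v | v 0 ∈ Ioc 0 a ∧ v 1 ∈ Ioc 0 b ∧ v 2 ∈ Ioc 0 c}

theorem measurableSet_box3 (a b c : ℝ) : MeasurableSet (box3 a b c) := by
  have h : ∀ i : Fin 3, Measurable fun v : Space3 => v i := fun i => by fun_prop
  exact ((h 0) measurableSet_Ioc).inter (((h 1) measurableSet_Ioc).inter ((h 2) measurableSet_Ioc))

theorem measurePreserving_coords :
    MeasurePreserving (fun v : Space3 => (v 0, v 1, v 2)) volume volume := by
  have h1 := EuclideanSpace.volume_preserving_symm_measurableEquiv_toLp (Fin 3)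
  have h2 := volume_preserving_piFinSuccAbove (fun _ : Fin 3 => ℝ) 0
  have h3 := (MeasurePreserving.id (volume : Measure ℝ)).prod
    (volume_preserving_piFinTwo (fun _ : Fin 2 => ℝ))
  exact h3.comp (h2.comp h1)

theorem setIntegral_box3 {a b c : ℝ} (ha : 0 ≤ a) (hb : 0 ≤ b) (hc : 0 ≤ c) {G : ℝ → ℝ → ℝ → ℝ}
    (hG : Continuous fun p : ℝ × ℝ × ℝ => G p.1 p.2.1 p.2.2) :
    ∫ v in box3 a b c, G (v 0) (v 1) (v 2) =
      ∫ x in (0 : ℝ)..a, ∫ y in (0 : ℝ)..b, ∫ z in (0 : ℝ)..c, G x y z := by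
  have hemb : MeasurableEmbedding (fun v : Space3 => (v 0, v 1, v 2)) := by
    have e : (fun v : Space3 => (v 0, v 1, v 2)) =
        (((MeasurableEquiv.toLp 2 (Fin 3 → ℝ)).symm.trans
          (MeasurableEquiv.piFinSuccAbove (fun _ : Fin 3 => ℝ) 0)).trans
          ((MeasurableEquiv.refl ℝ).prodCongr (MeasurableEquiv.piFinTwo (fun _ : Fin 2 => ℝ)))) :=
      rfl
    rw [e]; exact MeasurableEquiv.measurableEmbedding _
  have h := measurePreserving_coords.setIntegral_preimage_emb hemb
    (fun p : ℝ × ℝ × ℝ => G p.1 p.2.1 p.2.2) (Ioc 0 a ×ˢ (Ioc 0 b ×ˢ Ioc 0 c))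
  have hset : (fun v : Space3 => (v 0, v 1, v 2)) ⁻¹' (Ioc 0 a ×ˢ (Ioc 0 b ×ˢ Ioc 0 c)) =
      box3 a b c := by
    ext v; simp [box3]
  rw [hset] at h
  simp only at h
  rw [h]
  have int1 : IntegrableOn (fun p : ℝ × ℝ × ℝ => G p.1 p.2.1 p.2.2)
      (Ioc 0 a ×ˢ (Ioc 0 b ×ˢ Ioc 0 c)) (volume.prod volume) := by
    refine (hG.continuousOn.integrableOn_compact
      (isCompact_Icc (a := (0 : ℝ)) (b := a) |>.prod ((isCompact_Icc (a := (0 : ℝ)) (b := b)).prod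
        (isCompact_Icc (a := (0 : ℝ)) (b := c))))).mono_set ?_
    exact prod_mono Ioc_subset_Icc_self (prod_mono Ioc_subset_Icc_self Ioc_subset_Icc_self)
  rw [Measure.volume_eq_prod, setIntegral_prod _ int1, intervalIntegral.integral_of_le ha]
  congr 1; ext x
  have int2 : IntegrableOn (fun p : ℝ × ℝ => G x p.1 p.2)
      (Ioc 0 b ×ˢ Ioc 0 c) (volume.prod volume) := by
    have hx : Continuous (fun p : ℝ × ℝ => G x p.1 p.2) :=
      hG.comp (continuous_const.prodMk (continuous_fst.prodMk continuous_snd))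
    refine (hx.continuousOn.integrableOn_compact
      ((isCompact_Icc (a := (0 : ℝ)) (b := b)).prod
        (isCompact_Icc (a := (0 : ℝ)) (b := c)))).mono_set ?_
    exact prod_mono Ioc_subset_Icc_self Ioc_subset_Icc_self
  rw [Measure.volume_eq_prod, setIntegral_prod _ int2, intervalIntegral.integral_of_le hb]
  congr 1; ext y
  rw [intervalIntegral.integral_of_le hc]

/-- The linear map with the given columns. -/
def columns (x y z : Space3) : Space3 →L[ℝ] Space3 :=
  (EuclideanSpace.proj (𝕜 := ℝ) (0 : Fin 3)).smulRight x +
    (EuclideanSpace.proj (𝕜 := ℝ) (1 : Fin 3)).smulRight y +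
    (EuclideanSpace.proj (𝕜 := ℝ) (2 : Fin 3)).smulRight z

theorem det_columns (x y z : Space3) : (columns x y z).det = tripleProduct x y z := by
  rw [ContinuousLinearMap.det, ← LinearMap.det_toMatrix (EuclideanSpace.basisFun (Fin 3) ℝ).toBasis,
    Matrix.det_fin_three, tripleProduct_eq]
  simp [LinearMap.toMatrix_apply, columns]
  ring

namespace NormalFrame

variable {a : ℝ} {P P' e₁ e₁' e₂ e₂' : ℝ → Space3}

theorem hasFDerivAt_tube (F : NormalFrame a P P' e₁ e₁' e₂ e₂') (v : Space3) :
    HasFDerivAt (fun v : Space3 => tube P e₁ e₂ (v 0) (v 1) (v 2))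
      (columns (P' (v 0) + v 1 • radial e₁' e₂' (v 0) (v 2)) (radial e₁ e₂ (v 0) (v 2))
        (v 1 • angular e₁ e₂ (v 0) (v 2))) v := by
  have hp : ∀ i : Fin 3, HasFDerivAt (fun v : Space3 => v i) (EuclideanSpace.proj (𝕜 := ℝ) i) v :=
    fun i => (EuclideanSpace.proj (𝕜 := ℝ) i).hasFDerivAt
  have hP := (F.curve.hasDerivAt (v 0)).hasFDerivAt.comp v (hp 0)
  have h1 := (F.fst.hasDerivAt (v 0)).hasFDerivAt.comp v (hp 0)
  have h2 := (F.snd.hasDerivAt (v 0)).hasFDerivAt.comp v (hp 0)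
  have hc := (Real.hasDerivAt_cos (v 2)).comp_hasFDerivAt v (hp 2)
  have hs := (Real.hasDerivAt_sin (v 2)).comp_hasFDerivAt v (hp 2)
  have h := hP.add ((hp 1).smul ((hc.smul h1).add (hs.smul h2)))
  refine h.congr_fderiv ?_
  ext w
  simp [columns, radial, angular]
  ring

/-- By the change of variables formula the integral is the mass, contained in the embedded tube, of
the ball of radius `ε` about `m`; the whole ball has mass $4\pi$. -/
theorem integral_axial_mul_newtonDensity_le (F : NormalFrame a P P' e₁ e₁' e₂ e₂') (ha : 0 ≤ a)
    {r : ℝ} (hr : 0 ≤ r)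
    (hinj : ∀ s ∈ Ioc 0 a, ∀ s' ∈ Ioc 0 a, ∀ n n' : Space3, ⟪n, P' s⟫ = 0 → ⟪n', P' s'⟫ = 0 →
      ‖n‖ ≤ r → ‖n'‖ ≤ r → P s + n = P s' + n' → s = s') {ε : ℝ} (hε : 0 < ε) (m : Space3) :
    ∫ s in (0 : ℝ)..a, ∫ ρ in (0 : ℝ)..r, ∫ θ in (0 : ℝ)..2 * Real.pi,
      (ρ * ‖axial P' e₁ e₁' e₂ e₂' s ρ θ‖) * newtonDensity ε (‖m - tube P e₁ e₂ s ρ θ‖ ^ 2)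
        ≤ 4 * Real.pi := by
  have cP := F.curve.continuous
  have cP' := F.curve.continuous_deriv
  have c1 := F.fst.continuous
  have c1' := F.fst.continuous_deriv
  have c2 := F.snd.continuous
  have c2' := F.snd.continuous_deriv
  have cN := continuous_newtonDensity hε
  rw [← setIntegral_box3 ha hr (by positivity) (G := fun s ρ θ =>
    (ρ * ‖axial P' e₁ e₁' e₂ e₂' s ρ θ‖) * newtonDensity ε (‖m - tube P e₁ e₂ s ρ θ‖ ^ 2))
    (by unfold axial tube radial angular; fun_prop)]
  -- `hinj` separates points of different normal discs; within a disc these are polar coordinates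
  -- with positive radius and angle in a half-open interval of length $2\pi$.
  have hInj : InjOn (fun v : Space3 => tube P e₁ e₂ (v 0) (v 1) (v 2))
      (box3 a r (2 * Real.pi)) := by
    rintro v ⟨v0, v1, v2⟩ w ⟨w0, w1, w2⟩ hvw
    have hnorm : ∀ s ρ θ, 0 < ρ → ‖ρ • radial e₁ e₂ s θ‖ = ρ := fun s ρ θ h => by
      rw [norm_smul, F.norm_radial, mul_one, Real.norm_of_nonneg h.le]
    have horth : ∀ s ρ θ, ⟪ρ • radial e₁ e₂ s θ, P' s⟫ = 0 := fun s ρ θ => by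
      rw [radial, real_inner_smul_left, inner_add_left, real_inner_smul_left, real_inner_smul_left,
        real_inner_comm, F.inner_curve_fst, real_inner_comm, F.inner_curve_snd]; ring
    have h0 : v 0 = w 0 := hinj _ v0 _ w0 _ _ (horth _ (v 1) (v 2)) (horth _ (w 1) (w 2))
      (by rw [hnorm _ _ _ v1.1]; exact v1.2) (by rw [hnorm _ _ _ w1.1]; exact w1.2) hvw
    simp only [tube, h0] at hvw
    have hvw' := add_left_cancel hvw
    have h1 : v 1 = w 1 := by
      have := congrArg norm hvw'
      rwa [hnorm _ _ _ v1.1, hnorm _ _ _ w1.1] at this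
    rw [h1] at hvw'
    have hrad := smul_right_injective _ w1.1.ne' hvw'
    have hcs : ∀ s θ, ⟪radial e₁ e₂ s θ, e₁ s⟫ = Real.cos θ ∧ ⟪radial e₁ e₂ s θ, e₂ s⟫ = Real.sin θ := by
      intro s θ
      simp only [radial, inner_add_left, real_inner_smul_left, real_inner_self_eq_norm_sq,
        F.norm_fst, F.norm_snd, F.inner_fst_snd, real_inner_comm (e₁ s) (e₂ s)]
      constructor <;> ring
    have hcos : Real.cos (v 2) = Real.cos (w 2) := by
      rw [← (hcs (w 0) (v 2)).1, ← (hcs (w 0) (w 2)).1]; rw [hrad]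
    have hsin : Real.sin (v 2) = Real.sin (w 2) := by
      rw [← (hcs (w 0) (v 2)).2, ← (hcs (w 0) (w 2)).2]; rw [hrad]
    have h2 : v 2 = w 2 := by
      obtain ⟨k, hk⟩ := Real.Angle.angle_eq_iff_two_pi_dvd_sub.1 (Real.Angle.cos_sin_inj hcos hsin)
      have hk1 : -1 < (k : ℝ) := by
        by_contra h; push Not at h; nlinarith [Real.pi_pos, v2.1, w2.2]
      have hk2 : (k : ℝ) < 1 := by
        by_contra h; push Not at h; nlinarith [Real.pi_pos, v2.2, w2.1]
      have : k = 0 := by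
        have h3 : -1 < k := by exact_mod_cast hk1
        have h4 : k < 1 := by exact_mod_cast hk2
        omega
      rw [this] at hk; simp at hk; linarith
    ext i; fin_cases i
    · exact h0
    · exact h1
    · exact h2
  have hcv := integral_image_eq_integral_abs_det_fderiv_smul (volume : Measure Space3)
    (measurableSet_box3 a r (2 * Real.pi)) (fun v _ => (F.hasFDerivAt_tube v).hasFDerivWithinAt)
    hInj (fun y => newtonDensity ε (‖m - y‖ ^ 2))
  have hint : ∫ y : Space3, newtonDensity ε (‖m - y‖ ^ 2) = 4 * Real.pi := by
    rw [integral_sub_left_eq_self (fun y : Space3 => newtonDensity ε (‖y‖ ^ 2)) volume m,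
      integral_newtonDensity hε]
  have e1 : ∫ v in box3 a r (2 * Real.pi), (v 1 * ‖axial P' e₁ e₁' e₂ e₂' (v 0) (v 1) (v 2)‖) *
      newtonDensity ε (‖m - tube P e₁ e₂ (v 0) (v 1) (v 2)‖ ^ 2) =
      ∫ y in (fun v : Space3 => tube P e₁ e₂ (v 0) (v 1) (v 2)) '' box3 a r (2 * Real.pi),
        newtonDensity ε (‖m - y‖ ^ 2) := by
    rw [hcv]
    refine setIntegral_congr_fun (measurableSet_box3 _ _ _) fun v hv => ?_
    simp only
    rw [det_columns, F.abs_tripleProduct_tube hv.2.1.1.le, smul_eq_mul]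
  rw [e1, ← hint]
  refine setIntegral_le_integral ?_ (Eventually.of_forall fun y => newtonDensity_nonneg hε _)
  -- A non-integrable density would have Bochner integral zero instead of $4\pi$.
  by_contra h
  rw [integral_undef h] at hint
  have := Real.pi_pos
  linarith

end NormalFrame

/-! ### Iterated integrals: continuity, exchange of order, bounds. -/

theorem Continuous.intervalIntegral₂ {X : Type*} [TopologicalSpace X] {f : X → ℝ → ℝ → ℝ}
    (hf : Continuous fun p : (X × ℝ) × ℝ => f p.1.1 p.1.2 p.2) (a b c d : ℝ) :
    Continuous fun x => ∫ y in a..b, ∫ z in c..d, f x y z :=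
  intervalIntegral.continuous_parametric_intervalIntegral_of_continuous'
    (f := fun x y => ∫ z in c..d, f x y z)
    (intervalIntegral.continuous_parametric_intervalIntegral_of_continuous'
      (X := X × ℝ) (f := fun p z => f p.1 p.2 z) hf _ _) _ _

theorem intervalIntegral_rotate {f : ℝ → ℝ → ℝ → ℝ}
    (hf : Continuous fun p : ℝ × ℝ × ℝ => f p.1 p.2.1 p.2.2) (a b c d a' b' : ℝ) :
    ∫ x in a..b, ∫ y in c..d, ∫ z in a'..b', f x y z =
      ∫ y in c..d, ∫ z in a'..b', ∫ x in a..b, f x y z := by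
  have slice : ∀ {X : Type} [TopologicalSpace X] {u v w : X → ℝ}, Continuous u → Continuous v →
      Continuous w → Continuous fun x => f (u x) (v x) (w x) :=
    fun hu hv hw => hf.comp (hu.prodMk (hv.prodMk hw))
  rw [intervalIntegral_swap_of_continuous (f := fun x y => ∫ z in a'..b', f x y z)
    (intervalIntegral.continuous_parametric_intervalIntegral_of_continuous' (X := ℝ × ℝ)
      (f := fun p z => f p.1 p.2 z) (slice (by fun_prop) (by fun_prop) (by fun_prop)) _ _)]
  congr 1; ext y
  exact intervalIntegral_swap_of_continuous (f := fun x z => f x y z)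
    (slice (by fun_prop) (by fun_prop) (by fun_prop)) _ _ _ _

theorem abs_intervalIntegral₃_le {f g : ℝ → ℝ → ℝ → ℝ}
    (hg : Continuous fun p : (ℝ × ℝ) × ℝ => g p.1.1 p.1.2 p.2) {a b c : ℝ}
    (ha : 0 ≤ a) (hb : 0 ≤ b) (hc : 0 ≤ c)
    (h : ∀ x, ∀ y ∈ Ioc 0 b, ∀ z, |f x y z| ≤ g x y z) :
    |∫ x in (0 : ℝ)..a, ∫ y in (0 : ℝ)..b, ∫ z in (0 : ℝ)..c, f x y z| ≤
      ∫ x in (0 : ℝ)..a, ∫ y in (0 : ℝ)..b, ∫ z in (0 : ℝ)..c, g x y z := by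
  have c1 : Continuous fun p : ℝ × ℝ => ∫ z in (0 : ℝ)..c, g p.1 p.2 z :=
    intervalIntegral.continuous_parametric_intervalIntegral_of_continuous'
      (X := ℝ × ℝ) (f := fun p z => g p.1 p.2 z) hg _ _
  have c2 : Continuous fun x => ∫ y in (0 : ℝ)..b, ∫ z in (0 : ℝ)..c, g x y z :=
    Continuous.intervalIntegral₂ (f := g) hg 0 b 0 c
  rw [← Real.norm_eq_abs]
  refine intervalIntegral.norm_integral_le_of_norm_le ha (Eventually.of_forall fun x _ => ?_)
    (c2.intervalIntegrable (μ := volume) 0 a)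
  refine intervalIntegral.norm_integral_le_of_norm_le hb (Eventually.of_forall fun y hy => ?_)
    ((c1.comp (by fun_prop : Continuous fun y : ℝ => (x, y))).intervalIntegrable
      (μ := volume) 0 b)
  exact intervalIntegral.norm_integral_le_of_norm_le hc
    (Eventually.of_forall fun z _ => h x y hy z)
    ((hg.comp (by fun_prop : Continuous fun z : ℝ => ((x, y), z))).intervalIntegrable
      (μ := volume) 0 c)

theorem abs_intervalIntegral₂_le_setIntegral {H g : ℝ → ℝ → ℝ}
    (hH : Continuous fun p : ℝ × ℝ => H p.1 p.2) (hg : Continuous fun p : ℝ × ℝ => g p.1 p.2)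
    {A : Set (ℝ × ℝ)} (hA : MeasurableSet A) {a b : ℝ} (ha : 0 ≤ a) (hb : 0 ≤ b)
    (h0 : ∀ x ∈ Ioc 0 a, ∀ y ∈ Ioc 0 b, (x, y) ∉ A → H x y = 0)
    (h : ∀ x ∈ Ioc 0 a, ∀ y ∈ Ioc 0 b, |H x y| ≤ g x y) :
    |∫ x in (0 : ℝ)..a, ∫ y in (0 : ℝ)..b, H x y| ≤
      ∫ z in (Ioc 0 a ×ˢ Ioc 0 b) ∩ A, g z.1 z.2 := by
  have int : ∀ {k : ℝ → ℝ → ℝ}, Continuous (fun p : ℝ × ℝ => k p.1 p.2) →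
      IntegrableOn (fun p : ℝ × ℝ => k p.1 p.2) (Ioc 0 a ×ˢ Ioc 0 b) := fun hk =>
    (hk.continuousOn.integrableOn_compact ((isCompact_Icc (a := (0 : ℝ)) (b := a)).prod
      (isCompact_Icc (a := (0 : ℝ)) (b := b)))).mono_set
        (prod_mono Ioc_subset_Icc_self Ioc_subset_Icc_self)
  have e : ∫ x in (0 : ℝ)..a, ∫ y in (0 : ℝ)..b, H x y =
      ∫ z in Ioc 0 a ×ˢ Ioc 0 b, H z.1 z.2 := by
    have i := int hH
    rw [Measure.volume_eq_prod] at i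
    rw [Measure.volume_eq_prod, setIntegral_prod _ i, intervalIntegral.integral_of_le ha]
    congr 1; ext x
    rw [intervalIntegral.integral_of_le hb]
  rw [e, inter_comm, ← Measure.restrict_restrict hA, ← integral_indicator hA]
  rw [← Real.norm_eq_abs]
  refine norm_integral_le_of_norm_le ((int hg).integrable.indicator hA) ?_
  refine (ae_restrict_iff' (measurableSet_Ioc.prod measurableSet_Ioc)).2
    (Eventually.of_forall fun z hz => ?_)
  by_cases hzA : z ∈ A
  · rw [indicator_of_mem hzA]; exact h _ hz.1 _ hz.2
  · rw [indicator_of_notMem hzA, h0 _ hz.1 _ hz.2 hzA, norm_zero]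

theorem continuous_parallelogramArea {X : Type*} [TopologicalSpace X] {u v : X → Space3}
    (hu : Continuous u) (hv : Continuous v) : Continuous fun x => parallelogramArea (u x) (v x) := by
  unfold parallelogramArea; fun_prop

/-- The averaging argument in abstract form. `UA` stands for the parallel curves of the tube, all
with the same Gauss integral `c₀`; `UB` for the meridian circles, with Gauss integral zero; `ω` for
the rotation of the frame. As `ω` depends on `s` alone, integrating over the angle removes the `UB`
term, and integrating `c₀` over the disc gives the factor $\pi r^2$. -/
theorem integral_tube_eq {UA UB UC : ℝ → ℝ → ℝ → ℝ → ℝ → ℝ} {ω : ℝ → ℝ} {a b r c₀ : ℝ} (hr : 0 ≤ r)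
    (hA : Continuous fun x : (((ℝ × ℝ) × ℝ) × ℝ) × ℝ => UA x.1.1.1.1 x.1.1.1.2 x.1.1.2 x.1.2 x.2)
    (hB : Continuous fun x : (((ℝ × ℝ) × ℝ) × ℝ) × ℝ => UB x.1.1.1.1 x.1.1.1.2 x.1.1.2 x.1.2 x.2)
    (hC : Continuous fun x : (((ℝ × ℝ) × ℝ) × ℝ) × ℝ => UC x.1.1.1.1 x.1.1.1.2 x.1.1.2 x.1.2 x.2)
    (hsub : ∀ s ρ θ l τ, UC s ρ θ l τ = UA s ρ θ l τ - ω s * UB s ρ θ l τ)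
    (key1 : ∀ ρ ∈ Icc 0 r, ∀ θ, ∫ l in (0 : ℝ)..1, ∫ τ in (0 : ℝ)..b, ∫ s in (0 : ℝ)..a,
      UA s ρ θ l τ = c₀)
    (key2 : ∀ ρ ∈ Icc 0 r, ∀ s, ∫ l in (0 : ℝ)..1, ∫ τ in (0 : ℝ)..b,
      ∫ θ in (0 : ℝ)..2 * Real.pi, UB s ρ θ l τ = 0) :
    Real.pi * r ^ 2 * c₀ = ∫ l in (0 : ℝ)..1, ∫ τ in (0 : ℝ)..b, ∫ s in (0 : ℝ)..a,
      ∫ ρ in (0 : ℝ)..r, ∫ θ in (0 : ℝ)..2 * Real.pi, ρ * UC s ρ θ l τ := by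
  have sl : ∀ U : ℝ → ℝ → ℝ → ℝ → ℝ → ℝ, (Continuous fun x : (((ℝ × ℝ) × ℝ) × ℝ) × ℝ =>
      U x.1.1.1.1 x.1.1.1.2 x.1.1.2 x.1.2 x.2) →
      ∀ {X : Type} [TopologicalSpace X] {s ρ θ l τ : X → ℝ}, Continuous s → Continuous ρ →
      Continuous θ → Continuous l → Continuous τ →
      Continuous fun x => U (s x) (ρ x) (θ x) (l x) (τ x) := fun U hU _ _ _ _ _ _ _ h1 h2 h3 h4 h5 =>
    hU.comp ((((h1.prodMk h2).prodMk h3).prodMk h4).prodMk h5)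
  obtain ⟨I, hI⟩ : ∃ I : (ℝ → ℝ → ℝ → ℝ → ℝ → ℝ) → ℝ → ℝ → ℝ → ℝ, ∀ U s ρ θ, I U s ρ θ =
    ∫ l in (0 : ℝ)..1, ∫ τ in (0 : ℝ)..b, U s ρ θ l τ := ⟨_, fun _ _ _ _ => rfl⟩
  have slI : ∀ U : ℝ → ℝ → ℝ → ℝ → ℝ → ℝ, (Continuous fun x : (((ℝ × ℝ) × ℝ) × ℝ) × ℝ =>
      U x.1.1.1.1 x.1.1.1.2 x.1.1.2 x.1.2 x.2) →
      ∀ {X : Type} [TopologicalSpace X] {s ρ θ : X → ℝ}, Continuous s → Continuous ρ →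
      Continuous θ → Continuous fun x => I U (s x) (ρ x) (θ x) := fun U hU _ _ _ _ _ h1 h2 h3 => by
    have : Continuous fun x : (ℝ × ℝ) × ℝ => I U x.1.1 x.1.2 x.2 := by
      simp only [hI]
      exact Continuous.intervalIntegral₂ (f := fun (x : (ℝ × ℝ) × ℝ) l τ => U x.1.1 x.1.2 x.2 l τ)
        hU _ _ _ _
    exact this.comp ((h1.prodMk h2).prodMk h3)
  have key1' : ∀ ρ ∈ Icc 0 r, ∀ θ, ∫ s in (0 : ℝ)..a, I UA s ρ θ = c₀ := fun ρ hρ θ => by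
    simp only [hI]
    rw [← key1 ρ hρ θ]
    exact intervalIntegral_rotate (f := fun s l τ => UA s ρ θ l τ)
      (sl UA hA (by fun_prop) (by fun_prop) (by fun_prop) (by fun_prop) (by fun_prop)) _ _ _ _ _ _
  have key2' : ∀ ρ ∈ Icc 0 r, ∀ s, ∫ θ in (0 : ℝ)..2 * Real.pi, I UB s ρ θ = 0 := fun ρ hρ s => by
    simp only [hI]
    refine Eq.trans ?_ (key2 ρ hρ s)
    exact intervalIntegral_rotate (f := fun θ l τ => UB s ρ θ l τ)
      (sl UB hB (by fun_prop) (by fun_prop) (by fun_prop) (by fun_prop) (by fun_prop)) _ _ _ _ _ _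
  have hlin : ∀ s ρ θ, I UC s ρ θ = I UA s ρ θ - ω s * I UB s ρ θ := by
    intro s ρ θ
    simp only [hI, hsub]
    have i : ∀ U : ℝ → ℝ → ℝ → ℝ → ℝ → ℝ, (Continuous fun x : (((ℝ × ℝ) × ℝ) × ℝ) × ℝ =>
        U x.1.1.1.1 x.1.1.1.2 x.1.1.2 x.1.2 x.2) → ∀ l,
        IntervalIntegrable (fun τ => U s ρ θ l τ) volume 0 b := fun U hU l =>
      (sl U hU (by fun_prop) (by fun_prop) (by fun_prop) (by fun_prop)
        (by fun_prop)).intervalIntegrable _ _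
    have e : ∀ l, ∫ τ in (0 : ℝ)..b, (UA s ρ θ l τ - ω s * UB s ρ θ l τ) =
        (∫ τ in (0 : ℝ)..b, UA s ρ θ l τ) - ω s * ∫ τ in (0 : ℝ)..b, UB s ρ θ l τ :=
      fun l => by
        rw [intervalIntegral.integral_sub (i UA hA l) ((i UB hB l).const_mul _),
          intervalIntegral.integral_const_mul]
    simp only [e]
    have j : ∀ U : ℝ → ℝ → ℝ → ℝ → ℝ → ℝ, (Continuous fun x : (((ℝ × ℝ) × ℝ) × ℝ) × ℝ =>
        U x.1.1.1.1 x.1.1.1.2 x.1.1.2 x.1.2 x.2) →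
        IntervalIntegrable (fun l => ∫ τ in (0 : ℝ)..b, U s ρ θ l τ) volume 0 1 := fun U hU =>
      (intervalIntegral.continuous_parametric_intervalIntegral_of_continuous'
        (f := fun l τ => U s ρ θ l τ) (sl U hU (by fun_prop) (by fun_prop) (by fun_prop)
          (by fun_prop) (by fun_prop)) _ _).intervalIntegrable _ _
    rw [intervalIntegral.integral_sub (j UA hA) ((j UB hB).const_mul _),
      intervalIntegral.integral_const_mul]
  have main : ∫ s in (0 : ℝ)..a, ∫ ρ in (0 : ℝ)..r, ∫ θ in (0 : ℝ)..2 * Real.pi,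
      ρ * I UC s ρ θ = Real.pi * r ^ 2 * c₀ := by
    have e1 : ∀ s, ∀ ρ ∈ Icc 0 r, ∫ θ in (0 : ℝ)..2 * Real.pi, ρ * I UC s ρ θ =
        ∫ θ in (0 : ℝ)..2 * Real.pi, ρ * I UA s ρ θ := by
      intro s ρ hρ
      have iA : IntervalIntegrable (fun θ => I UA s ρ θ) volume 0 (2 * Real.pi) :=
        (slI UA hA (by fun_prop) (by fun_prop) (by fun_prop)).intervalIntegrable _ _
      have iB : IntervalIntegrable (fun θ => I UB s ρ θ) volume 0 (2 * Real.pi) :=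
        (slI UB hB (by fun_prop) (by fun_prop) (by fun_prop)).intervalIntegrable _ _
      rw [intervalIntegral.integral_const_mul, intervalIntegral.integral_const_mul]
      simp only [hlin]
      rw [intervalIntegral.integral_sub iA (iB.const_mul _), intervalIntegral.integral_const_mul,
        key2' ρ hρ, mul_zero, sub_zero]
    have e2 : ∀ s, ∫ ρ in (0 : ℝ)..r, ∫ θ in (0 : ℝ)..2 * Real.pi, ρ * I UC s ρ θ =
        ∫ ρ in (0 : ℝ)..r, ∫ θ in (0 : ℝ)..2 * Real.pi, ρ * I UA s ρ θ := fun s =>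
      intervalIntegral.integral_congr fun ρ hρ => e1 s ρ (by rwa [uIcc_of_le hr] at hρ)
    simp only [e2]
    rw [intervalIntegral_rotate (f := fun s ρ θ => ρ * I UA s ρ θ)
      ((by fun_prop : Continuous fun x : ℝ × ℝ × ℝ => x.2.1).mul
        (slI UA hA (by fun_prop) (by fun_prop) (by fun_prop)))]
    have e3 : ∫ ρ in (0 : ℝ)..r, ∫ θ in (0 : ℝ)..2 * Real.pi, ∫ s in (0 : ℝ)..a, ρ * I UA s ρ θ =
        ∫ ρ in (0 : ℝ)..r, ∫ θ in (0 : ℝ)..2 * Real.pi, ρ * c₀ :=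
      intervalIntegral.integral_congr fun ρ hρ => by
        simp only [intervalIntegral.integral_const_mul]
        congr 2; ext θ
        exact key1' ρ (by rwa [uIcc_of_le hr] at hρ) θ
    rw [e3]
    simp only [intervalIntegral.integral_const, sub_zero, smul_eq_mul,
      intervalIntegral.integral_const_mul, intervalIntegral.integral_mul_const, integral_id]
    ring
  have cF : Continuous fun x : ℝ × ℝ × ℝ => ∫ ρ in (0 : ℝ)..r, ∫ θ in (0 : ℝ)..2 * Real.pi,
      ρ * UC x.1 ρ θ x.2.1 x.2.2 :=
    Continuous.intervalIntegral₂ (f := fun (x : ℝ × ℝ × ℝ) ρ θ => ρ * UC x.1 ρ θ x.2.1 x.2.2)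
      ((by fun_prop : Continuous fun x : ((ℝ × ℝ × ℝ) × ℝ) × ℝ => x.1.2).mul
        (sl UC hC (by fun_prop) (by fun_prop) (by fun_prop) (by fun_prop) (by fun_prop))) _ _ _ _
  rw [← main, ← intervalIntegral_rotate (f := fun s l τ => ∫ ρ in (0 : ℝ)..r,
    ∫ θ in (0 : ℝ)..2 * Real.pi, ρ * UC s ρ θ l τ) cF]
  congr 1; ext s
  rw [← intervalIntegral_swap_pairs (f := fun ρ θ l τ => ρ * UC s ρ θ l τ)
    ((by fun_prop : Continuous fun x : ℝ × ℝ × ℝ × ℝ => x.1).mul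
      (sl UC hC (by fun_prop) (by fun_prop) (by fun_prop) (by fun_prop) (by fun_prop)))]
  simp only [hI, intervalIntegral.integral_const_mul]

/-! ### Linking number of a tube and area of a cone inside it. -/

namespace NormalFrame

variable {a : ℝ} {P P' e₁ e₁' e₂ e₂' : ℝ → Space3}

/-- The linking number of the core of an embedded tube with a loop is controlled by the area of
the part of a cone over the loop that meets the tube. -/
theorem abs_gaussPairing_le (F : NormalFrame a P P' e₁ e₁' e₂ e₂') (ha : 0 ≤ a)
    {r : ℝ} (hr : 0 ≤ r)
    (hinj : ∀ s ∈ Ioc 0 a, ∀ s' ∈ Ioc 0 a, ∀ n n' : Space3, ⟪n, P' s⟫ = 0 → ⟪n', P' s'⟫ = 0 →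
      ‖n‖ ≤ r → ‖n'‖ ≤ r → P s + n = P s' + n' → s = s') {ε : ℝ} (hε : 0 < ε)
    {b : ℝ} (hb : 0 ≤ b) {Q Q' : ℝ → Space3} (hQ : IsC1Loop b Q Q')
    (hfar : ∀ s n τ, ‖n‖ ≤ r → ε ≤ ‖P s + n - Q τ‖) {S : Set Space3} (hSm : MeasurableSet S)
    (hS : ∀ s n x, ‖n‖ ≤ r → ‖x - (P s + n)‖ < ε → x ∈ S) (p : Space3) :
    r ^ 2 / 4 * |gaussPairing (newtonKernel ε) a b P P' Q Q'| ≤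
      ∫ z in (Ioc 0 1 ×ˢ Ioc 0 b) ∩ (fun z : ℝ × ℝ => p + z.1 • (Q z.2 - p)) ⁻¹' S,
        z.1 * parallelogramArea (Q z.2 - p) (Q' z.2) := by
  have cP := F.curve.continuous
  have cP' := F.curve.continuous_deriv
  have c1 := F.fst.continuous
  have c1' := F.fst.continuous_deriv
  have c2 := F.snd.continuous
  have c2' := F.snd.continuous_deriv
  have cQ := hQ.continuous
  have cQ' := hQ.continuous_deriv
  have cN := continuous_newtonDensity hε
  have hnorm : ∀ s ρ θ, 0 ≤ ρ → ‖ρ • radial e₁ e₂ s θ‖ = ρ := fun s ρ θ h => by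
    rw [norm_smul, F.norm_radial, mul_one, Real.norm_of_nonneg h]
  obtain ⟨D, hD⟩ : ∃ D : ℝ → ℝ → ℝ → ℝ → ℝ → ℝ, ∀ s ρ θ l τ, D s ρ θ l τ =
    newtonDensity ε (‖p + l • (Q τ - p) - tube P e₁ e₂ s ρ θ‖ ^ 2) := ⟨_, fun _ _ _ _ _ => rfl⟩
  have cD : Continuous fun x : (((ℝ × ℝ) × ℝ) × ℝ) × ℝ =>
      D x.1.1.1.1 x.1.1.1.2 x.1.1.2 x.1.2 x.2 := by
    simp only [hD, tube, radial]; fun_prop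
  have hD0 : ∀ s ρ θ l τ, 0 ≤ D s ρ θ l τ := fun s ρ θ l τ => by
    rw [hD]; exact newtonDensity_nonneg hε _
  have cU : ∀ V : ℝ → ℝ → ℝ → Space3, (Continuous fun x : (ℝ × ℝ) × ℝ => V x.1.1 x.1.2 x.2) →
      Continuous fun x : (((ℝ × ℝ) × ℝ) × ℝ) × ℝ => D x.1.1.1.1 x.1.1.1.2 x.1.1.2 x.1.2 x.2 *
        (x.1.2 * tripleProduct (Q x.2 - p) (Q' x.2) (V x.1.1.1.1 x.1.1.1.2 x.1.1.2)) := by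
    intro V hV
    refine cD.mul (Continuous.mul (by fun_prop) (Continuous.tripleProduct (by fun_prop)
      (by fun_prop) ?_))
    exact hV.comp (continuous_fst.comp continuous_fst)
  have cC : Continuous fun x : (ℝ × ℝ) × ℝ => axial P' e₁ e₁' e₂ e₂' x.1.1 x.1.2 x.2 := by
    simp only [axial, angular, radial]; fun_prop
  have key := integral_tube_eq (a := a) (b := b) (c₀ := gaussPairing (newtonKernel ε) a b P P' Q Q')
    (ω := fun s => ⟪e₁' s, e₂ s⟫) hr
    (UA := fun s ρ θ l τ => D s ρ θ l τ * (l * tripleProduct (Q τ - p) (Q' τ)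
      (P' s + ρ • radial e₁' e₂' s θ)))
    (UB := fun s ρ θ l τ => D s ρ θ l τ * (l * tripleProduct (Q τ - p) (Q' τ)
      (ρ • angular e₁ e₂ s θ)))
    (UC := fun s ρ θ l τ => D s ρ θ l τ * (l * tripleProduct (Q τ - p) (Q' τ)
      (axial P' e₁ e₁' e₂ e₂' s ρ θ)))
    (cU (fun s ρ θ => P' s + ρ • radial e₁' e₂' s θ) (by simp only [radial]; fun_prop))
    (cU (fun s ρ θ => ρ • angular e₁ e₂ s θ) (by simp only [angular]; fun_prop))
    (cU (fun s ρ θ => axial P' e₁ e₁' e₂ e₂' s ρ θ) cC)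
    (fun s ρ θ l τ => by
      simp only [axial]
      rw [mul_smul]
      generalize P' s + ρ • radial e₁' e₂' s θ = x
      generalize ρ • angular e₁ e₂ s θ = y
      simp only [tripleProduct_eq, PiLp.sub_apply, PiLp.smul_apply, smul_eq_mul]; ring)
    -- The parallel curve is joined to the core inside the tube, away from `Q`, so it has the same
    -- Gauss integral.
    (fun ρ hρ θ => by
      have h1 := gaussPairing_add_eq hε F.curve (((F.fst.const_smul (Real.cos θ)).add
        (F.snd.const_smul (Real.sin θ))).const_smul ρ) hQ (fun x hx σ τ => by
          have : ‖ρ • (Real.cos θ • e₁ σ + Real.sin θ • e₂ σ)‖ = ρ := hnorm σ ρ θ hρ.1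
          refine hfar σ _ τ ?_
          rw [norm_smul, this, Real.norm_of_nonneg hx.1]
          nlinarith [hx.2, hρ.1, hρ.2])
      simp only [hD]
      rw [← h1]
      exact (gaussPairing_eq_cone hε (F.isC1Loop_tube ρ θ) hQ p).symm)
    -- The meridian circle contracts to `P s` inside its normal disc, away from `Q`. Its Gauss
    -- integral is zero, which is why the rotation of the frame may be discarded.
    (fun ρ hρ s => by
      have h0 := isC1Loop_const (2 * Real.pi) (P s)
      have h1 := gaussPairing_add_eq hε h0 (isC1Loop_circle e₁ e₂ s ρ) hQ (fun x hx σ τ => by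
          refine hfar s _ τ ?_
          rw [norm_smul, hnorm _ _ _ hρ.1, Real.norm_of_nonneg hx.1]
          nlinarith [hx.2, hρ.1, hρ.2])
      have h2 : gaussPairing (newtonKernel ε) (2 * Real.pi) b (fun _ => P s) (fun _ => 0) Q Q'
          = 0 := by
        simp [gaussPairing, gaussDensity, tripleProduct_zero_mid]
      have h3 := gaussPairing_eq_cone hε (h0.add (isC1Loop_circle e₁ e₂ s ρ)) hQ p
      rw [h1, h2] at h3
      simp only [zero_add] at h3
      simp only [hD]
      exact h3.symm)
  obtain ⟨H, hH⟩ : ∃ H : ℝ → ℝ → ℝ, ∀ l τ, H l τ = ∫ s in (0 : ℝ)..a, ∫ ρ in (0 : ℝ)..r,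
      ∫ θ in (0 : ℝ)..2 * Real.pi, ρ * (D s ρ θ l τ * (l * tripleProduct (Q τ - p) (Q' τ)
        (axial P' e₁ e₁' e₂ e₂' s ρ θ))) := ⟨_, fun _ _ => rfl⟩
  have cH : Continuous fun x : ℝ × ℝ => H x.1 x.2 := by
    simp only [hH]
    refine intervalIntegral.continuous_parametric_intervalIntegral_of_continuous'
      (f := fun (x : ℝ × ℝ) s => ∫ ρ in (0 : ℝ)..r, ∫ θ in (0 : ℝ)..2 * Real.pi,
        ρ * (D s ρ θ x.1 x.2 * (x.1 * tripleProduct (Q x.2 - p) (Q' x.2)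
          (axial P' e₁ e₁' e₂ e₂' s ρ θ)))) ?_ _ _
    refine Continuous.intervalIntegral₂ (X := (ℝ × ℝ) × ℝ) (f := fun x ρ θ =>
        ρ * (D x.2 ρ θ x.1.1 x.1.2 * (x.1.1 * tripleProduct (Q x.1.2 - p) (Q' x.1.2)
          (axial P' e₁ e₁' e₂ e₂' x.2 ρ θ)))) ?_ _ _ _ _
    refine (by fun_prop : Continuous fun x : (((ℝ × ℝ) × ℝ) × ℝ) × ℝ => x.1.2).mul ?_
    exact (cU (fun s ρ θ => axial P' e₁ e₁' e₂ e₂' s ρ θ) cC).comp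
      (by fun_prop : Continuous fun x : (((ℝ × ℝ) × ℝ) × ℝ) × ℝ =>
        ((((x.1.1.2, x.1.2), x.2), x.1.1.1.1), x.1.1.1.2))
  simp only [← hH] at key
  have hpA : ∀ u v, 0 ≤ parallelogramArea u v := fun u v => Real.sqrt_nonneg _
  -- At a fixed point of the cone, the area element factors out; what remains is the Jacobian of the
  -- tube times the mass density, of integral at most $4\pi$.
  have bound : ∀ l ∈ Ioc (0 : ℝ) 1, ∀ τ ∈ Ioc 0 b,
      |H l τ| ≤ 4 * Real.pi * (l * parallelogramArea (Q τ - p) (Q' τ)) := by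
    intro l hl τ _
    have h1 := F.integral_axial_mul_newtonDensity_le ha hr hinj hε (p + l • (Q τ - p))
    simp only [← hD] at h1
    have h2 : |H l τ| ≤ ∫ s in (0 : ℝ)..a, ∫ ρ in (0 : ℝ)..r, ∫ θ in (0 : ℝ)..2 * Real.pi,
        (l * parallelogramArea (Q τ - p) (Q' τ)) *
          ((ρ * ‖axial P' e₁ e₁' e₂ e₂' s ρ θ‖) * D s ρ θ l τ) := by
      rw [hH]
      refine abs_intervalIntegral₃_le ?_ ha hr (by positivity) fun s ρ hρ θ => ?_
      · have h4 : Continuous fun x : (ℝ × ℝ) × ℝ => D x.1.1 x.1.2 x.2 l τ :=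
          cD.comp (by fun_prop : Continuous fun x : (ℝ × ℝ) × ℝ => (((x, l), τ)))
        exact continuous_const.mul (((by fun_prop : Continuous fun x : (ℝ × ℝ) × ℝ => x.1.2).mul
          cC.norm).mul h4)
      · rw [abs_mul, abs_mul, abs_mul, abs_of_nonneg hρ.1.le, abs_of_nonneg (hD0 s ρ θ l τ),
          abs_of_nonneg hl.1.le]
        have h3 := mul_le_mul_of_nonneg_left (abs_tripleProduct_le (Q τ - p) (Q' τ)
          (axial P' e₁ e₁' e₂ e₂' s ρ θ)) (mul_nonneg hρ.1.le (mul_nonneg (hD0 s ρ θ l τ) hl.1.le))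
        linarith
    refine h2.trans ?_
    simp only [intervalIntegral.integral_const_mul]
    have := mul_le_mul_of_nonneg_left h1 (mul_nonneg hl.1.le (hpA (Q τ - p) (Q' τ)))
    linarith
  -- A point of the cone outside `S` is at distance at least `ε` from the whole tube, where the
  -- density is zero.
  have vanish : ∀ l ∈ Ioc (0 : ℝ) 1, ∀ τ ∈ Ioc 0 b,
      (l, τ) ∉ (fun z : ℝ × ℝ => p + z.1 • (Q z.2 - p)) ⁻¹' S → H l τ = 0 := by
    intro l _ τ _ h
    have h0 : |H l τ| ≤ ∫ s in (0 : ℝ)..a, ∫ ρ in (0 : ℝ)..r, ∫ θ in (0 : ℝ)..2 * Real.pi,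
        (0 : ℝ) := by
      rw [hH]
      refine abs_intervalIntegral₃_le (g := fun _ _ _ => 0) continuous_const ha hr (by positivity)
        fun s ρ hρ θ => ?_
      have : D s ρ θ l τ = 0 := by
        rw [hD]
        refine newtonDensity_of_le hε (pow_le_pow_left₀ hε.le ?_ 2)
        by_contra hlt
        exact h (hS s (ρ • radial e₁ e₂ s θ) _ ((hnorm s ρ θ hρ.1.le).trans_le hρ.2)
          (not_le.1 hlt))
      rw [this, zero_mul, mul_zero, abs_zero]
    simpa using h0
  have cM : Continuous fun z : ℝ × ℝ => p + z.1 • (Q z.2 - p) := by fun_prop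
  have cpA : Continuous fun z : ℝ × ℝ => parallelogramArea (Q z.2 - p) (Q' z.2) :=
    continuous_parallelogramArea (by fun_prop) (by fun_prop)
  have fin := abs_intervalIntegral₂_le_setIntegral cH
    (g := fun l τ => 4 * Real.pi * (l * parallelogramArea (Q τ - p) (Q' τ))) (by fun_prop)
    (cM.measurable hSm) zero_le_one hb vanish bound
  -- By `key` the integral of `H` is $\pi r^2$ times the Gauss pairing; comparing with the bound
  -- $4\pi$ times the area leaves the factor $r^2/4$.
  rw [← key, integral_const_mul, abs_mul, abs_of_nonneg (by positivity)] at fin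
  have hπ := Real.pi_pos
  refine le_of_mul_le_mul_left ?_ (by positivity : 0 < 4 * Real.pi)
  linarith

end NormalFrame

/-! ### Normal frames, disjoint neighbourhoods and embedded tubes. -/

/-- The cross product. -/
def cross (u v : Space3) : Space3 :=
  !₂[u 1 * v 2 - u 2 * v 1, u 2 * v 0 - u 0 * v 2, u 0 * v 1 - u 1 * v 0]

theorem inner_cross_left (u v : Space3) : ⟪u, cross u v⟫ = 0 := by
  simp [inner_eq_coords, cross]; ring

theorem inner_cross_right (u v : Space3) : ⟪v, cross u v⟫ = 0 := by
  simp [inner_eq_coords, cross]; ring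

theorem norm_cross_sq (u v : Space3) : ‖cross u v‖ ^ 2 = ‖u‖ ^ 2 * ‖v‖ ^ 2 - ⟪u, v⟫ ^ 2 := by
  simp [norm_sq_eq_coords, inner_eq_coords, cross]; ring

theorem ContDiff.cross {u v : ℝ → Space3} (hu : ContDiff ℝ 1 u) (hv : ContDiff ℝ 1 v) :
    ContDiff ℝ 1 fun s => cross (u s) (v s) := by
  have h1 := contDiff_euclidean.1 hu
  have h2 := contDiff_euclidean.1 hv
  refine contDiff_euclidean.2 fun i => ?_
  fin_cases i
  · exact ((h1 1).mul (h2 2)).sub ((h1 2).mul (h2 1))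
  · exact ((h1 2).mul (h2 0)).sub ((h1 0).mul (h2 2))
  · exact ((h1 0).mul (h2 1)).sub ((h1 1).mul (h2 0))

theorem IsC1Loop.of_contDiff_of_periodic {a : ℝ} {u : ℝ → Space3} (hu : ContDiff ℝ 1 u)
    (hp : Function.Periodic u a) : IsC1Loop a u (deriv u) :=
  ⟨hp, fun x => (hu.differentiable one_ne_zero x).hasDerivAt, hu.continuous_deriv_one⟩

/-- A loop of class `C²` with nonvanishing derivative has a normal frame. -/
theorem exists_normalFrame {a : ℝ} {P P' : ℝ → Space3} (hP : IsC1Loop a P P')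
    (hP' : ContDiff ℝ 1 P') (h0 : ∀ s, P' s ≠ 0) :
    ∃ e₁ e₁' e₂ e₂', NormalFrame a P P' e₁ e₁' e₂ e₂' := by
  -- The lines spanned by the tangent vectors form the `C¹` image of a plane, so their union misses
  -- a dense set. A vector `c` off this union is never parallel to `P' s`, and the cross product
  -- with it never vanishes.
  have hd : Dense (range fun z : ℝ × ℝ => z.2 • P' z.1)ᶜ :=
    ContDiff.dense_compl_range_of_finrank_lt_finrank
      (contDiff_snd.smul (hP'.comp contDiff_fst)) (by simp)
  obtain ⟨c, hc⟩ := hd.nonempty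
  have hper := hP.periodic_deriv
  have hne : ∀ s, cross c (P' s) ≠ 0 := by
    intro s h
    apply hc
    have h1 := norm_cross_sq c (P' s)
    rw [h, norm_zero, real_inner_comm] at h1
    have h2 : ‖P' s‖ ≠ 0 := norm_ne_zero_iff.2 (h0 s)
    refine ⟨(s, ⟪c, P' s⟫ / ‖P' s‖ ^ 2), ?_⟩
    simp only
    rw [← sub_eq_zero, ← norm_eq_zero, ← sq_eq_zero_iff, norm_sub_sq_real, norm_smul,
      real_inner_smul_left, real_inner_comm, mul_pow, Real.norm_eq_abs, sq_abs]
    field_simp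
    linarith
  have hne' : ∀ s, cross (P' s) (cross c (P' s)) ≠ 0 := by
    intro s h
    have h1 := norm_cross_sq (P' s) (cross c (P' s))
    rw [h, norm_zero, inner_cross_right] at h1
    have h2 : 0 < ‖P' s‖ := norm_pos_iff.2 (h0 s)
    have h3 : 0 < ‖cross c (P' s)‖ := norm_pos_iff.2 (hne s)
    have : 0 < ‖P' s‖ ^ 2 * ‖cross c (P' s)‖ ^ 2 := by positivity
    linarith
  have c1 : ContDiff ℝ 1 fun s => cross c (P' s) := contDiff_const.cross hP'
  have c2 : ContDiff ℝ 1 fun s => cross (P' s) (cross c (P' s)) := hP'.cross c1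
  have nrm : ∀ v : Space3, v ≠ 0 → ‖‖v‖⁻¹ • v‖ = 1 := fun v hv => by
    rw [norm_smul, norm_inv, norm_norm, inv_mul_cancel₀ (norm_ne_zero_iff.2 hv)]
  refine ⟨fun s => ‖cross c (P' s)‖⁻¹ • cross c (P' s), _,
    fun s => ‖cross (P' s) (cross c (P' s))‖⁻¹ • cross (P' s) (cross c (P' s)), _, hP,
    .of_contDiff_of_periodic (((c1.norm ℝ hne).inv fun s => norm_ne_zero_iff.2 (hne s)).smul c1)
      fun s => ?_,
    .of_contDiff_of_periodic (((c2.norm ℝ hne').inv fun s => norm_ne_zero_iff.2 (hne' s)).smul c2)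
      fun s => ?_, fun s => nrm _ (hne s), fun s => nrm _ (hne' s), fun s => ?_, fun s => ?_,
    fun s => ?_⟩
  · simp only [hper s]
  · simp only [hper s]
  · rw [real_inner_smul_left, real_inner_smul_right, inner_cross_right, mul_zero, mul_zero]
  · rw [real_inner_smul_right, inner_cross_right, mul_zero]
  · rw [real_inner_smul_right, inner_cross_left, mul_zero]

/-- Split `z - y` along `T` and normal to it; tangency bounds the normal part by $|z-y|^2/2$. -/
theorem IsTangentAt.abs_inner_le {L : Set Space3} {y T : Space3} (hT : ‖T‖ = 1)
    (h : IsTangentAt L y T) {z : Space3} (hz : z ∈ L) (n : Space3) :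
    |⟪n, z - y⟫| ≤ |⟪n, T⟫| * ‖z - y‖ + ‖n‖ * ‖z - y‖ ^ 2 / 2 := by
  set w := z - y with hw
  have e : ⟪n, w⟫ = ⟪n, T⟫ * ⟪T, w⟫ + ⟪n, w - ⟪T, w⟫ • T⟫ := by
    rw [inner_sub_right n w, real_inner_smul_right]; ring
  have h1 : ‖w - ⟪T, w⟫ • T‖ ≤ ‖w‖ ^ 2 / 2 := by
    refine le_of_sq_le_sq ?_ (by positivity)
    rw [norm_sub_inner_smul_sq hT]
    have := h z hz
    nlinarith
  have h2 : |⟪T, w⟫| ≤ ‖w‖ := by simpa [hT] using abs_real_inner_le_norm T w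
  have h3 := abs_real_inner_le_norm n (w - ⟪T, w⟫ • T)
  rw [e]
  refine (abs_add_le _ _).trans ?_
  rw [abs_mul]
  have h4 := mul_le_mul_of_nonneg_left h1 (norm_nonneg n)
  have h5 := mul_le_mul_of_nonneg_left h2 (abs_nonneg ⟪n, T⟫)
  linarith

namespace UnitSpeedLoop

variable {L : Set Space3} {γ γ' : ClosedCurve}

theorem range_J (A : UnitSpeedLoop L γ) : range A.J = range γ := by
  rw [← γ.range_lift]
  ext y
  constructor
  · rintro ⟨x, rfl⟩
    obtain ⟨t, rfl⟩ := A.surj x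
    exact ⟨t, A.lift_eq t⟩
  · rintro ⟨t, rfl⟩
    exact ⟨A.s t, (A.lift_eq t).symm⟩

theorem isCompact_range (A : UnitSpeedLoop L γ) : IsCompact (range A.J) := by
  rw [A.range_J]; exact _root_.isCompact_range γ.continuous

/-- A point at distance less than one from a curve of unit thickness has a unique nearest point
among all points of the link. -/
theorem exists_nearest (A : UnitSpeedLoop L γ) {y : Space3}
    (hy : Metric.infDist y (range A.J) < 1) :
    ∃ s, ‖y - A.J s‖ < 1 ∧ ∀ z ∈ L, ‖y - A.J s‖ ^ 2 +
      (1 - ‖y - A.J s‖) * ‖z - A.J s‖ ^ 2 ≤ ‖y - z‖ ^ 2 := by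
  obtain ⟨x, ⟨s, rfl⟩, hs⟩ := A.isCompact_range.exists_infDist_eq_dist (range_nonempty _) y
  rw [hs, dist_eq_norm] at hy
  refine ⟨s, hy, fun z hz => ?_⟩
  have horth : ⟪y - A.J s, A.T s⟫ = 0 := by
    have hd : HasDerivAt (fun t => ‖y - A.J t‖ ^ 2) (2 * ⟪y - A.J s, -A.T s⟫) s :=
      ((A.hasDerivAt s).const_sub y).norm_sq
    have hmin : IsLocalMin (fun t => ‖y - A.J t‖ ^ 2) s := Eventually.of_forall fun t => by
      have : dist y (A.J s) ≤ dist y (A.J t) := by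
        rw [← hs]; exact Metric.infDist_le_dist_of_mem (mem_range_self t)
      rw [dist_eq_norm, dist_eq_norm] at this
      exact pow_le_pow_left₀ (norm_nonneg _) this 2
    have := hmin.hasDerivAt_eq_zero hd
    rw [inner_neg_right] at this
    linarith
  -- With $n=y-J(s)$ normal to the curve, $2\langle n,z-J(s)\rangle\le|n|\,|z-J(s)|^2$; expanding
  -- $|y-z|^2$ leaves the margin $1-|n|$.
  have h1 := (A.tangent s).abs_inner_le (A.norm_T s) hz (y - A.J s)
  rw [horth, abs_zero, zero_mul, zero_add] at h1
  have h2 : y - z = (y - A.J s) - (z - A.J s) := by abel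
  have h3 := norm_sub_sq_real (y - A.J s) (z - A.J s)
  rw [← h2] at h3
  have h4 := le_abs_self ⟪y - A.J s, z - A.J s⟫
  nlinarith

/-- If `y` were at distance less than one from both curves, its nearest point on each would be
strictly nearer than the nearest point on the other, because `exists_nearest` compares with all
points of the link. -/
theorem one_le_infDist (A : UnitSpeedLoop L γ) (B : UnitSpeedLoop L γ') (hB : range γ' ⊆ L)
    {y : Space3} (hA : range γ ⊆ L) (hAB : Disjoint (range γ) (range γ'))
    (hy : Metric.infDist y (range A.J) < 1) : 1 ≤ Metric.infDist y (range B.J) := by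
  by_contra! h
  obtain ⟨s, hs, hs'⟩ := A.exists_nearest hy
  obtain ⟨t, ht, ht'⟩ := B.exists_nearest h
  have hsA : A.J s ∈ range γ := A.range_J ▸ mem_range_self s
  have htB : B.J t ∈ range γ' := B.range_J ▸ mem_range_self t
  have hne : A.J s ≠ B.J t := fun e => disjoint_left.1 hAB hsA (e ▸ htB)
  have h1 := hs' _ (hB htB)
  have h2 := ht' _ (hA hsA)
  have h3 : 0 < ‖A.J s - B.J t‖ := norm_pos_iff.2 (sub_ne_zero.2 hne)
  rw [norm_sub_rev (B.J t)] at h1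
  have : 0 < (1 - ‖y - A.J s‖) * ‖A.J s - B.J t‖ ^ 2 := mul_pos (by linarith) (by positivity)
  have : 0 < (1 - ‖y - B.J t‖) * ‖A.J s - B.J t‖ ^ 2 := mul_pos (by linarith) (by positivity)
  linarith

/-- The parameter pairs that are `h` apart in both directions around the loop form a compact set, on
which the chord length is positive by injectivity. -/
theorem exists_separation (A : UnitSpeedLoop L γ) {h : ℝ} (hh : 0 < h) :
    ∃ c > 0, ∀ s ∈ Icc 0 A.ℓ, ∀ t ∈ Icc 0 A.ℓ, h ≤ |s - t| → |s - t| ≤ A.ℓ - h →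
      c ≤ ‖A.J s - A.J t‖ := by
  obtain ⟨S, hS⟩ : ∃ S : Set (ℝ × ℝ), S = (Icc 0 A.ℓ ×ˢ Icc 0 A.ℓ) ∩
    ({z | h ≤ |z.1 - z.2|} ∩ {z | |z.1 - z.2| ≤ A.ℓ - h}) := ⟨_, rfl⟩
  have cJ := A.continuous_J
  have cd : Continuous fun z : ℝ × ℝ => |z.1 - z.2| := by fun_prop
  have hc : IsCompact S := by
    rw [hS]
    exact (isCompact_Icc.prod isCompact_Icc).inter_right
      ((isClosed_le continuous_const cd).inter (isClosed_le cd continuous_const))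
  have hmem : ∀ s t, (s, t) ∈ S ↔ (s ∈ Icc 0 A.ℓ ∧ t ∈ Icc 0 A.ℓ) ∧ h ≤ |s - t| ∧
      |s - t| ≤ A.ℓ - h := fun s t => by
    rw [hS, mem_inter_iff, mem_prod, mem_inter_iff, mem_ofPred_eq, mem_ofPred_eq]
  rcases S.eq_empty_or_nonempty with he | hne
  · exact ⟨1, one_pos, fun s hs t ht h1 h2 =>
      absurd ((hmem s t).2 ⟨⟨hs, ht⟩, h1, h2⟩) (by rw [he]; exact notMem_empty _)⟩
  have cf : Continuous fun z : ℝ × ℝ => ‖A.J z.1 - A.J z.2‖ := by fun_prop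
  obtain ⟨⟨x, y⟩, hz, hmin⟩ := hc.exists_isMinOn hne cf.continuousOn
  refine ⟨‖A.J x - A.J y‖, ?_, fun s hs t ht h1 h2 =>
    isMinOn_iff.1 hmin (s, t) ((hmem s t).2 ⟨⟨hs, ht⟩, h1, h2⟩)⟩
  rw [gt_iff_lt, norm_pos_iff, sub_ne_zero]
  intro e
  obtain ⟨-, h4, h5⟩ := (hmem x y).1 hz
  have h3 := A.inj _ _ e (by linarith)
  rw [h3, sub_self, abs_zero] at h4
  linarith

/-- The derivative of a smoothing of a curve. -/
def smoothT (A : UnitSpeedLoop L γ) (δ s : ℝ) : Space3 := (1 / δ) • (A.J (s + δ) - A.J s)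

theorem isC1Loop_steklov (A : UnitSpeedLoop L γ) (δ : ℝ) :
    IsC1Loop A.ℓ (steklov δ A.J) (A.smoothT δ) := by
  have := A.continuous_J
  refine ⟨steklov_add_of_periodic δ A.periodic, fun s => hasDerivAt_steklov δ A.continuous_J s, ?_⟩
  unfold smoothT; fun_prop

theorem contDiff_smoothT (A : UnitSpeedLoop L γ) (δ : ℝ) : ContDiff ℝ 1 (A.smoothT δ) := by
  have hJ : ContDiff ℝ 1 A.J := by
    rw [contDiff_one_iff_deriv]
    refine ⟨fun x => (A.hasDerivAt x).differentiableAt, ?_⟩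
    rw [funext fun x => (A.hasDerivAt x).deriv]
    exact A.continuous_T
  unfold smoothT
  exact ContDiff.const_smul (1 / δ) ((hJ.comp (contDiff_id.add contDiff_const)).sub hJ)

theorem smoothT_eq (A : UnitSpeedLoop L γ) (δ s : ℝ) : A.smoothT δ s = steklov δ A.T s := by
  rw [smoothT, steklov, intervalIntegral.integral_eq_sub_of_hasDerivAt
    (fun x _ => A.hasDerivAt x) (A.continuous_T.intervalIntegrable _ _)]

theorem norm_steklov_J_sub_le (A : UnitSpeedLoop L γ) {δ : ℝ} (hδ : 0 < δ) (s : ℝ) :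
    ‖steklov δ A.J s - A.J s‖ ≤ δ :=
  norm_steklov_sub_le hδ A.continuous_J fun x hx => (A.norm_J_sub_le x s).trans (by
    rw [abs_of_nonneg (by linarith [hx.1])]; linarith [hx.2])

theorem norm_smoothT_sub_le (A : UnitSpeedLoop L γ) {δ : ℝ} (hδ : 0 < δ) (s : ℝ) :
    ‖A.smoothT δ s - A.T s‖ ≤ δ := by
  rw [smoothT_eq]
  exact norm_steklov_sub_le hδ A.continuous_T fun x hx => (A.lipschitz_T x s).trans (by
    rw [abs_of_nonneg (by linarith [hx.1])]; linarith [hx.2])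

theorem norm_smoothT_sub_smoothT_le (A : UnitSpeedLoop L γ) {δ : ℝ} (hδ : 0 < δ) (s t : ℝ) :
    ‖A.smoothT δ s - A.smoothT δ t‖ ≤ |s - t| := by
  have e : A.smoothT δ s - A.smoothT δ t = steklov δ (fun x => A.T x - A.T (x + (t - s))) s := by
    have := A.continuous_T
    rw [smoothT_eq, smoothT_eq, steklov, steklov, steklov, ← smul_sub,
      intervalIntegral.integral_sub (A.continuous_T.intervalIntegrable _ _)
      (Continuous.intervalIntegrable (by fun_prop) _ _),
      intervalIntegral.integral_comp_add_right (fun x => A.T x)]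
    ring_nf
  rw [e, ← sub_zero (steklov _ _ _)]
  have := A.continuous_T
  refine norm_steklov_sub_le hδ (by fun_prop) fun x _ => ?_
  rw [sub_zero]
  refine (A.lipschitz_T _ _).trans_eq ?_
  congr 1; ring

/-- Close normal discs of a smoothed curve are disjoint. -/
theorem eq_of_disc_of_close (A : UnitSpeedLoop L γ) {δ r : ℝ} (hδ : 0 < δ)
    (hr0 : 0 ≤ r) (hδr : 8 * δ ≤ 1 - r) {s t : ℝ} (hst : 4 * |t - s| ≤ 1 - r) {n m : Space3}
    (hn : ⟪n, A.smoothT δ s⟫ = 0) (hm : ⟪m, A.smoothT δ t⟫ = 0)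
    (hm1 : ‖m‖ ≤ r) (h : steklov δ A.J s + n = steklov δ A.J t + m) : s = t := by
  by_contra hne
  have hpos : 0 < |t - s| := abs_pos.2 (sub_ne_zero.2 (Ne.symm hne))
  set u := A.smoothT δ s with hu
  -- First-order Taylor estimate: the derivative varies by at most $|t-s|$ between `s` and `t`.
  have hw : ‖steklov δ A.J t - steklov δ A.J s - (t - s) • u‖ ≤ |t - s| * |t - s| := by
    have hd : ∀ x, HasDerivAt (fun x => steklov δ A.J x - x • u) (A.smoothT δ x - u) x := fun x => by
      have h1 := ((A.isC1Loop_steklov δ).hasDerivAt x).sub ((hasDerivAt_id x).smul_const u)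
      rw [one_smul] at h1
      exact h1
    have := Convex.norm_image_sub_le_of_norm_hasDerivWithin_le (s := uIcc s t) (C := |t - s|)
      (fun x _ => (hd x).hasDerivWithinAt) (fun x hx => by
        refine (A.norm_smoothT_sub_smoothT_le hδ x s).trans ?_
        exact abs_sub_left_of_mem_uIcc hx) (convex_uIcc s t) left_mem_uIcc right_mem_uIcc
    have e : steklov δ A.J t - t • u - (steklov δ A.J s - s • u) =
        steklov δ A.J t - steklov δ A.J s - (t - s) • u := by rw [sub_smul]; abel
    rwa [Real.norm_eq_abs, e] at this
  have e : steklov δ A.J t - steklov δ A.J s = n - m := by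
    rw [sub_eq_sub_iff_add_eq_add, ← h, add_comm]
  rw [e] at hw
  have hu1 : ‖u‖ ≤ 1 + δ := by
    have := A.norm_smoothT_sub_le hδ s
    have h2 := norm_le_norm_add_norm_sub' u (A.T s)
    rw [A.norm_T] at h2; linarith
  have hu2 : 1 - δ ≤ ‖u‖ := by
    have := A.norm_smoothT_sub_le hδ s
    have h2 := norm_le_norm_add_norm_sub' (A.T s) u
    rw [A.norm_T, norm_sub_rev] at h2; linarith
  -- Pairing the Taylor estimate with `u` gives $|u|^2\le|t-s|\,|u|+r$ after division by $|t-s|$.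
  -- This is impossible, since $|u|$ is within $\delta$ of one while $|t-s|\le(1-r)/4$ and
  -- $\delta\le(1-r)/8$.
  have h1 : |⟪n - m - (t - s) • u, u⟫| ≤ |t - s| * |t - s| * ‖u‖ :=
    (abs_real_inner_le_norm _ _).trans (by gcongr)
  have h2 : |⟪m, u⟫| ≤ r * |t - s| := by
    have : ⟪m, u⟫ = ⟪m, u - A.smoothT δ t⟫ := by rw [inner_sub_right, hm, sub_zero]
    rw [this]
    refine (abs_real_inner_le_norm _ _).trans ?_
    have := A.norm_smoothT_sub_smoothT_le hδ s t
    rw [abs_sub_comm] at this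
    gcongr
  rw [inner_sub_left, inner_sub_left, real_inner_smul_left, hn, real_inner_self_eq_norm_sq] at h1
  have h3 : |(t - s) * ‖u‖ ^ 2| ≤ |0 - ⟪m, u⟫ - (t - s) * ‖u‖ ^ 2| + |⟪m, u⟫| := by
    have := abs_add_le (0 - ⟪m, u⟫ - (t - s) * ‖u‖ ^ 2) ⟪m, u⟫
    rwa [show 0 - ⟪m, u⟫ - (t - s) * ‖u‖ ^ 2 + ⟪m, u⟫ = -((t - s) * ‖u‖ ^ 2) by ring,
      abs_neg] at this
  rw [abs_mul, abs_of_nonneg (sq_nonneg ‖u‖)] at h3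
  have h4 : |t - s| * ‖u‖ ^ 2 ≤ |t - s| * (|t - s| * ‖u‖ + r) := by nlinarith
  have h5 := le_of_mul_le_mul_left h4 hpos
  have h6 : (1 - δ) ^ 2 ≤ ‖u‖ ^ 2 := pow_le_pow_left₀ (by linarith) hu2 2
  nlinarith

/-- Distant normal discs of a smoothed curve are disjoint. -/
theorem disc_ne_of_far (A : UnitSpeedLoop L γ) (hA : range γ ⊆ L) {δ r c : ℝ} (hδ : 0 < δ)
    (hr1 : r < 1) (hδc : 4 * δ < (1 - r) * c) {s t : ℝ} (hst : c ≤ ‖A.J s - A.J t‖)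
    {n m : Space3} (hn : ⟪n, A.smoothT δ s⟫ = 0) (hm : ⟪m, A.smoothT δ t⟫ = 0)
    (hn1 : ‖n‖ ≤ r) (hm1 : ‖m‖ ≤ r) : steklov δ A.J s + n ≠ steklov δ A.J t + m := by
  intro h
  have hmem : ∀ x, A.J x ∈ L := fun x => hA (A.range_J ▸ mem_range_self x)
  have key : ∀ s t n, ⟪n, A.smoothT δ s⟫ = 0 → ‖n‖ ≤ r →
      |⟪n, A.J t - A.J s⟫| ≤ δ * ‖A.J t - A.J s‖ + r * ‖A.J t - A.J s‖ ^ 2 / 2 := by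
    intro s t n hn hn1
    have h1 := (A.tangent s).abs_inner_le (A.norm_T s) (hmem t) n
    have h2 : |⟪n, A.T s⟫| ≤ δ := by
      have : ⟪n, A.T s⟫ = ⟪n, A.T s - A.smoothT δ s⟫ := by rw [inner_sub_right, hn, sub_zero]
      rw [this]
      refine (abs_real_inner_le_norm _ _).trans ?_
      rw [norm_sub_rev]
      nlinarith [A.norm_smoothT_sub_le hδ s, norm_nonneg n, norm_nonneg (A.smoothT δ s - A.T s)]
    have h3 := mul_le_mul_of_nonneg_right h2 (norm_nonneg (A.J t - A.J s))
    have h4 := mul_le_mul_of_nonneg_right hn1 (sq_nonneg ‖A.J t - A.J s‖)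
    linarith
  -- If the discs met, $n-m$ would equal the chord $w$ up to $2\delta$. The two tangency estimates
  -- then give $|w|^2\le r|w|^2+4\delta|w|$, so $(1-r)|w|\le4\delta$, contrary to `hδc` and `hst`.
  have k1 := key s t n hn hn1
  have k2 := key t s m hm hm1
  rw [norm_sub_rev] at hst
  set w := A.J t - A.J s with hw
  have hw' : A.J s - A.J t = -w := by rw [hw, neg_sub]
  rw [hw', inner_neg_right, norm_neg, abs_neg] at k2
  have e : ‖(n - m) - w‖ ≤ 2 * δ := by
    have : (n - m) - w = (steklov δ A.J t - A.J t) - (steklov δ A.J s - A.J s) := by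
      have : n = steklov δ A.J t + m - steklov δ A.J s := by rw [← h]; abel
      rw [this, hw]; abel
    rw [this]
    refine (norm_sub_le _ _).trans ?_
    linarith [A.norm_steklov_J_sub_le hδ s, A.norm_steklov_J_sub_le hδ t]
  have h1 := (abs_le.1 ((abs_real_inner_le_norm ((n - m) - w) w).trans
    (mul_le_mul_of_nonneg_right e (norm_nonneg w)))).1
  rw [inner_sub_left, inner_sub_left, real_inner_self_eq_norm_sq] at h1
  have h2 := (abs_le.1 k1).2
  have h3 := (abs_le.1 k2).1
  have h4 : 0 < ‖w‖ := by
    have : 0 < c := by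
      by_contra hc; push Not at hc; nlinarith
    linarith
  have h5 : ‖w‖ * ((1 - r) * ‖w‖) ≤ ‖w‖ * (4 * δ) := by nlinarith
  have h6 := le_of_mul_le_mul_left h5 h4
  nlinarith

/-- Normal discs at close parameters are disjoint because the curvature is at most one and the
radius is less than one; those at distant parameters because chords of the link satisfy the tangency
inequality with a definite margin. -/
theorem exists_tube_injective (A : UnitSpeedLoop L γ) (hA : range γ ⊆ L) {r : ℝ} (hr0 : 0 ≤ r)
    (hr1 : r < 1) : ∃ δ₀ > 0, ∀ δ, 0 < δ → δ < δ₀ → ∀ s ∈ Ioc 0 A.ℓ, ∀ t ∈ Ioc 0 A.ℓ,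
      ∀ n m : Space3, ⟪n, A.smoothT δ s⟫ = 0 → ⟪m, A.smoothT δ t⟫ = 0 → ‖n‖ ≤ r → ‖m‖ ≤ r →
      steklov δ A.J s + n = steklov δ A.J t + m → s = t := by
  set h := (1 - r) / 4 with hh
  have h0 : 0 < h := by rw [hh]; linarith
  obtain ⟨c, hc, hsep⟩ := A.exists_separation h0
  refine ⟨min ((1 - r) / 8) ((1 - r) * c / 4), lt_min (by linarith) (by
    have := mul_pos (sub_pos.2 hr1) hc; linarith), ?_⟩
  intro δ hδ hδ1 s hs t ht n m hn hm hn1 hm1 e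
  have hδ2 := hδ1.trans_le (min_le_left _ _)
  have hδ3 := hδ1.trans_le (min_le_right _ _)
  have per := (A.isC1Loop_steklov δ).periodic
  have per' := (A.isC1Loop_steklov δ).periodic_deriv
  by_cases h1 : |t - s| ≤ h
  · exact A.eq_of_disc_of_close hδ hr0 (by linarith) (by linarith) hn hm hm1 e
  by_cases h2 : |s - t| ≤ A.ℓ - h
  · refine absurd e (A.disc_ne_of_far hA hδ hr1 (by linarith) (hsep s ⟨hs.1.le, hs.2⟩ t
      ⟨ht.1.le, ht.2⟩ ?_ h2) hn hm hn1 hm1)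
    rw [abs_sub_comm]; linarith
  push Not at h1 h2
  -- The parameters are close only modulo the period. Shifting the smaller one by `A.ℓ` reduces to
  -- the first case, whose conclusion cannot hold for two points of `Ioc 0 A.ℓ`.
  exfalso
  rcases le_total s t with hst | hst
  · rw [abs_of_nonpos (by linarith)] at h2
    have := A.eq_of_disc_of_close (s := s + A.ℓ) (t := t) hδ hr0 (by linarith)
      (by rw [abs_of_nonpos (by linarith [hs.1, ht.2])]; linarith) (by rw [per']; exact hn) hm hm1
      (by rw [per]; exact e)
    linarith [hs.1, ht.2]
  · rw [abs_of_nonneg (by linarith)] at h2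
    have := A.eq_of_disc_of_close (s := s) (t := t + A.ℓ) hδ hr0 (by linarith)
      (by rw [abs_of_nonneg (by linarith [hs.2, ht.1])]; linarith) hn (by rw [per']; exact hm) hm1
      (by rw [per]; exact e)
    linarith [hs.2, ht.1]

/-- The linking number of two components of a link of unit thickness is controlled by the area of
the part of a cone over the second which is close to the first one. -/
theorem abs_linkingNumber_le (A : UnitSpeedLoop L γ) (B : UnitSpeedLoop L γ') (hA : range γ ⊆ L)
    (hB : range γ' ⊆ L) (hAB : Disjoint (range γ) (range γ')) (p : Space3) :
    Real.pi * |linkingNumber γ γ'| ≤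
      ∫ z in (Ioc 0 1 ×ˢ Ioc 0 B.ℓ) ∩ (fun z : ℝ × ℝ => p + z.1 • (B.J z.2 - p)) ⁻¹'
        {y | Metric.infDist y (range A.J) < 1}, z.1 * parallelogramArea (B.J z.2 - p) (B.T z.2) := by
  set X := ∫ z in (Ioc 0 1 ×ˢ Ioc 0 B.ℓ) ∩ (fun z : ℝ × ℝ => p + z.1 • (B.J z.2 - p)) ⁻¹'
        {y | Metric.infDist y (range A.J) < 1}, z.1 * parallelogramArea (B.J z.2 - p) (B.T z.2)
  have hdist : ∀ y τ, Metric.infDist y (range A.J) < 1 → 1 ≤ ‖y - B.J τ‖ := fun y τ hy => by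
    rw [← dist_eq_norm]
    exact (A.one_le_infDist B hB hA hAB hy).trans (Metric.infDist_le_dist_of_mem (mem_range_self τ))
  have hAJ : ∀ x τ, 1 ≤ ‖A.J x - B.J τ‖ := fun x τ => hdist _ _ (by
    rw [Metric.infDist_zero_of_mem (mem_range_self x)]; exact one_pos)
  -- The frame requires a smoothed core and the embedding requires radius less than one. The
  -- right-hand side depends on neither, so `r` may tend to one.
  have step : ∀ r ∈ Ioo (0 : ℝ) 1, r ^ 2 * (Real.pi * |linkingNumber γ γ'|) ≤ X := by
    intro r hr
    obtain ⟨δ₀, hδ₀, hinj⟩ := A.exists_tube_injective hA hr.1.le hr.2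
    -- `δ ≤ (1 - r) / 3` ensures `r + 2 * δ < 1`, so the `δ`-neighbourhood of the tube about the
    -- smoothed curve is within distance one of the original curve.
    set δ := min (δ₀ / 2) ((1 - r) / 3) with hδ
    have hδ0 : 0 < δ := lt_min (by linarith) (by linarith [hr.2])
    have hδ1 : δ < δ₀ := (min_le_left _ _).trans_lt (by linarith)
    have hδ2 : δ ≤ (1 - r) / 3 := min_le_right _ _
    have hr0 := hr.1
    have hne : ∀ s, A.smoothT δ s ≠ 0 := fun s h => by
      have := A.norm_smoothT_sub_le hδ0 s
      rw [h, zero_sub, norm_neg, A.norm_T] at this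
      linarith
    obtain ⟨e₁, e₁', e₂, e₂', F⟩ := exists_normalFrame (A.isC1Loop_steklov δ)
      (A.contDiff_smoothT δ) hne
    have hnear : ∀ s n x, ‖n‖ ≤ r → ‖x - (steklov δ A.J s + n)‖ < δ →
        Metric.infDist x (range A.J) < 1 := by
      intro s n x hn hx
      refine (Metric.infDist_le_dist_of_mem (mem_range_self s)).trans_lt ?_
      rw [dist_eq_norm]
      have e : x - A.J s = (x - (steklov δ A.J s + n)) + (steklov δ A.J s - A.J s) + n := by abel
      have h1 := norm_add₃_le (a := x - (steklov δ A.J s + n)) (b := steklov δ A.J s - A.J s)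
        (c := n)
      rw [e]
      linarith [A.norm_steklov_J_sub_le hδ0 s, hr.2]
    have h1 := F.abs_gaussPairing_le A.pos.le hr.1.le (hinj δ hδ0 hδ1) hδ0 B.pos.le B.isC1Loop
      (fun s n τ hn => by
        have := hdist (steklov δ A.J s + n) τ (hnear s n _ hn (by simpa using hδ0))
        linarith)
      (S := {y | Metric.infDist y (range A.J) < 1})
      (measurableSet_lt (Metric.continuous_infDist_pt _).measurable measurable_const) hnear p
    rw [gaussPairing_eq_of_close hδ0 A.isC1Loop (A.isC1Loop_steklov δ) B.isC1Loop (C := A.J)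
      (fun σ => by simpa using hδ0.le) (A.norm_steklov_J_sub_le hδ0)
      (fun σ τ => by linarith [hAJ σ τ])] at h1
    rw [A.linkingNumber_eq B hδ0 (fun x y => by linarith [hAJ x y]), abs_mul,
      abs_of_nonneg (by positivity)]
    refine le_trans (le_of_eq ?_) h1
    field_simp
  have lim : Tendsto (fun r : ℝ => r ^ 2 * (Real.pi * |linkingNumber γ γ'|)) (𝓝[<] 1)
      (𝓝 ((1 : ℝ) ^ 2 * (Real.pi * |linkingNumber γ γ'|))) :=
    (Continuous.tendsto (by fun_prop) 1).mono_left nhdsWithin_le_nhds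
  rw [one_pow, one_mul] at lim
  exact le_of_tendsto lim (by
    filter_upwards [Ioo_mem_nhdsLT (show (0 : ℝ) < 1 by norm_num)] with r hr using step r hr)

end UnitSpeedLoop

/-! ### Spherical length and the curvature bound. -/

/-- The chord of an arc of angle $2x$ on the unit sphere is $2\sin x$; the cubic error disappears in
the derivative comparison of `angle_le_integral`. -/
theorem angle_le_norm_sub_add {u v : Space3} (hu : ‖u‖ = 1) (hv : ‖v‖ = 1) :
    InnerProductGeometry.angle u v ≤ ‖u - v‖ + ‖u - v‖ ^ 3 := by
  set x := InnerProductGeometry.angle u v / 2 with hx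
  have hx0 : 0 ≤ x := by have := InnerProductGeometry.angle_nonneg u v; linarith
  have hxπ : x ≤ Real.pi / 2 := by have := InnerProductGeometry.angle_le_pi u v; linarith
  have hsin : 0 ≤ Real.sin x := Real.sin_nonneg_of_nonneg_of_le_pi hx0 (by linarith [Real.pi_pos])
  have hd : ‖u - v‖ = 2 * Real.sin x := by
    have h1 : ‖u - v‖ ^ 2 = (2 * Real.sin x) ^ 2 := by
      have h2 : ⟪u, v⟫ = Real.cos (2 * x) := by
        rw [hx, mul_div_cancel₀ _ two_ne_zero, InnerProductGeometry.cos_angle, hu, hv]; simp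
      rw [norm_sub_sq_real, hu, hv, h2, Real.cos_two_mul]
      nlinarith [Real.sin_sq_add_cos_sq x]
    exact (pow_left_inj₀ (norm_nonneg _) (by positivity) two_ne_zero).1 h1
  have h3 := Real.mul_le_sin hx0 hxπ
  have h4 : x ≤ ‖u - v‖ := by
    have hπ := Real.pi_lt_four
    have : x / 2 ≤ 2 / Real.pi * x := by
      rw [div_mul_eq_mul_div, div_le_div_iff₀ two_pos Real.pi_pos]; nlinarith
    linarith
  have h5 := Real.sin_ge_sub_cube hx0
  have h6 : x ^ 3 ≤ ‖u - v‖ ^ 3 := pow_le_pow_left₀ hx0 h4 3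
  have h7 : 0 ≤ x ^ 3 := by positivity
  have h8 : InnerProductGeometry.angle u v = 2 * x := by rw [hx]; ring
  linarith

/-- The angle between two points of a curve on the unit sphere is at most the length of the arc
between them. -/
theorem angle_le_integral {u : ℝ → Space3} {φ : ℝ → ℝ} (hφ : Continuous φ) (hu : ∀ t, ‖u t‖ = 1)
    (hc : Continuous u) (h : ∀ t, ∀ r > φ t, ∀ᶠ z in 𝓝[>] t, ‖u z - u t‖ ≤ r * (z - t)) {s t : ℝ}
    (hst : s ≤ t) : InnerProductGeometry.angle (u s) (u t) ≤ ∫ x in s..t, φ x := by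
  have hne : ∀ t, u t ≠ 0 := fun t e => by simpa [e] using hu t
  have hd : ∀ x, HasDerivAt (fun z => ∫ x in s..z, φ x) (φ x) x := fun x =>
    intervalIntegral.integral_hasDerivAt_right (hφ.intervalIntegrable _ _)
      (hφ.stronglyMeasurableAtFilter _ _) hφ.continuousAt
  have hcont : Continuous fun z => InnerProductGeometry.angle (u s) (u z) := by
    unfold InnerProductGeometry.angle
    simp only [hu]
    fun_prop
  have := image_le_of_liminf_slope_right_le_deriv_boundary (a := s) (b := t)
    (f := fun z => InnerProductGeometry.angle (u s) (u z)) (B := fun z => ∫ x in s..z, φ x)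
    (B' := φ) hcont.continuousOn (by simp [InnerProductGeometry.angle_self (hne s)])
    (continuous_iff_continuousAt.2 fun x => (hd x).continuousAt).continuousOn
    (fun x _ => (hd x).hasDerivWithinAt) (fun x _ r hr => ?_)
  · exact this ⟨hst, le_rfl⟩
  refine Eventually.frequently ?_
  obtain ⟨r', hr', hrr⟩ := exists_between hr
  have l1 : Tendsto (fun z => r' * (1 + ‖u z - u x‖ ^ 2)) (𝓝[>] x) (𝓝 (r' * (1 + ‖u x - u x‖ ^ 2))) :=
    (Continuous.tendsto (by fun_prop) x).mono_left nhdsWithin_le_nhds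
  rw [sub_self, norm_zero, zero_pow two_ne_zero, add_zero, mul_one] at l1
  filter_upwards [h x r' hr', self_mem_nhdsWithin, l1.eventually_lt_const hrr] with z hz hxz h1
  have hxz' : 0 < z - x := sub_pos.2 hxz
  rw [slope_def_field, div_lt_iff₀ hxz']
  have a1 := InnerProductGeometry.angle_le_angle_add_angle (u s) (u x) (u z)
  have a2 := angle_le_norm_sub_add (hu x) (hu z)
  rw [norm_sub_rev] at a2
  calc _ ≤ ‖u z - u x‖ * (1 + ‖u z - u x‖ ^ 2) := by linarith
    _ ≤ r' * (z - x) * (1 + ‖u z - u x‖ ^ 2) := by gcongr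
    _ = r' * (1 + ‖u z - u x‖ ^ 2) * (z - x) := by ring
    _ < r * (z - x) := by gcongr

theorem angle_add_angle_eq_pi {u v w : Space3} (hu : ‖u‖ = 1) (hv : ‖v‖ = 1) (hw : ‖w‖ = 1)
    (h : ⟪w, u⟫ + ⟪w, v⟫ = 0) :
    InnerProductGeometry.angle w u + InnerProductGeometry.angle w v = Real.pi := by
  unfold InnerProductGeometry.angle
  rw [hu, hv, hw, eq_neg_of_add_eq_zero_right h]
  simp [Real.arccos_neg]

/-- A closed curve with curvature at most one has length at least `2π`. -/
theorem UnitSpeedLoop.two_pi_le {L : Set Space3} {γ : ClosedCurve} (A : UnitSpeedLoop L γ) :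
    2 * Real.pi ≤ A.ℓ := by
  have hang : ∀ {s t : ℝ}, s ≤ t → InnerProductGeometry.angle (A.T s) (A.T t) ≤ t - s := by
    intro s t hst
    have := angle_le_integral (φ := fun _ => 1) continuous_const A.norm_T A.continuous_T
      (fun t r hr => by
        filter_upwards [self_mem_nhdsWithin] with z hz
        have h1 := A.lipschitz_T z t
        have h2 : 0 < z - t := sub_pos.2 hz
        rw [abs_of_pos h2] at h1
        nlinarith) hst
    simpa using this
  have hper := A.isC1Loop.periodic_deriv
  -- By Rolle's theorem for $\langle J,v\rangle$ some tangent is orthogonal to the sum of the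
  -- tangents at two opposite parameters, so its angles with these two add up to $\pi$. Its
  -- parameter lies in one of the two halves of the loop, along which the tangent turns by at most
  -- $\ell/2$.
  set v := A.T 0 + A.T (A.ℓ / 2) with hv
  obtain ⟨s, hs, hs0⟩ := exists_hasDerivAt_eq_zero (f := fun t => ⟪A.J t, v⟫)
    (f' := fun t => ⟪A.T t, v⟫) A.pos (Continuous.continuousOn
      (by have := A.continuous_J; fun_prop))
    (by have := A.periodic 0; rw [zero_add] at this; simp only [this])
    (fun t _ => by simpa using (A.hasDerivAt t).inner ℝ (hasDerivAt_const t v))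
  rw [hv, inner_add_right] at hs0
  have hπ := angle_add_angle_eq_pi (A.norm_T _) (A.norm_T _) (A.norm_T s) hs0
  rcases le_total s (A.ℓ / 2) with h | h
  · have h1 := hang hs.1.le
    have h2 := hang h
    rw [InnerProductGeometry.angle_comm] at h1
    linarith
  · have h1 := hang hs.2.le
    have h2 := hang h
    have := hper 0
    rw [zero_add] at this
    rw [this] at h1
    rw [InnerProductGeometry.angle_comm] at h2
    linarith

/-! ### Wirtinger's inequality and the isoperimetric inequality. -/

/-- Wirtinger's inequality. -/
theorem integral_norm_sq_le_of_integral_eq_zero {ℓ : ℝ} (hℓ : 0 < ℓ) {w w' : ℝ → ℂ}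
    (hw : ∀ t, HasDerivAt w (w' t) t) (hw' : Continuous w') (h0 : w ℓ = w 0)
    (hmean : ∫ t in (0 : ℝ)..ℓ, w t = 0) :
    ∫ t in (0 : ℝ)..ℓ, ‖w t‖ ^ 2 ≤ (ℓ / (2 * Real.pi)) ^ 2 * ∫ t in (0 : ℝ)..ℓ, ‖w' t‖ ^ 2 := by
  have cw : Continuous w := continuous_iff_continuousAt.2 fun x => (hw x).continuousAt
  have mem : ∀ {f : ℝ → ℂ}, Continuous f → MemLp f 2 (volume.restrict (Ioc 0 ℓ)) := fun hf =>
    (memLp_two_iff_integrable_sq_norm hf.aestronglyMeasurable).2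
      ((Continuous.integrableOn_Icc (by fun_prop)).mono_set Ioc_subset_Icc_self)
  have s1 := hasSum_sq_fourierCoeffOn hℓ (mem cw)
  have s2 := (hasSum_sq_fourierCoeffOn hℓ (mem hw')).mul_left ((ℓ / (2 * Real.pi)) ^ 2)
  have := hasSum_le (fun n => ?_) s1 s2
  · rw [sub_zero, smul_eq_mul, smul_eq_mul, mul_left_comm] at this
    exact le_of_mul_le_mul_left this (inv_pos.2 hℓ)
  -- Parseval reduces the claim to single Fourier coefficients: the zeroth one of `w` vanishes by
  -- `hmean`, and the others are those of `w'` times a factor of modulus $\ell/(2\pi|n|)$.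
  · rcases eq_or_ne n 0 with rfl | hn
    · have : fourierCoeffOn hℓ w 0 = 0 := by
        rw [fourierCoeffOn_eq_integral]; simp [hmean]
      rw [this]; simp; positivity
    · rw [fourierCoeffOn_of_hasDerivAt hℓ hn (fun t _ => hw t) (hw'.intervalIntegrable _ _), h0,
        sub_self, mul_zero, zero_sub, norm_mul, norm_neg, norm_mul, mul_pow, mul_pow]
      have hn1 : (1 : ℝ) ≤ |(n : ℝ)| := by exact_mod_cast Int.one_le_abs hn
      have e : ‖(1 : ℂ) / (-2 * Real.pi * Complex.I * n)‖ = 1 / (2 * Real.pi * |(n : ℝ)|) := by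
        simp [abs_of_pos Real.pi_pos]
      have e2 : ‖((ℓ : ℝ) : ℂ) - ((0 : ℝ) : ℂ)‖ = ℓ := by simp [abs_of_pos hℓ]
      rw [e, e2, ← mul_assoc]
      refine mul_le_mul_of_nonneg_right ?_ (sq_nonneg _)
      rw [← mul_pow]
      refine pow_le_pow_left₀ (by positivity) ?_ 2
      rw [one_div_mul_eq_div]
      have hπ := Real.pi_pos
      refine div_le_div_of_nonneg_left hℓ.le (by positivity) ?_
      nlinarith

/-- The isoperimetric inequality for closed plane curves parametrized by arc length. -/
theorem integral_cross_le {ℓ : ℝ} (hℓ : 0 < ℓ) {x y x' y' : ℝ → ℝ} (hx : ∀ t, HasDerivAt x (x' t) t)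
    (hy : ∀ t, HasDerivAt y (y' t) t) (cx' : Continuous x') (cy' : Continuous y') (hx0 : x ℓ = x 0)
    (hy0 : y ℓ = y 0) (hunit : ∀ t, x' t ^ 2 + y' t ^ 2 = 1) :
    ∫ t in (0 : ℝ)..ℓ, (x t * y' t - y t * x' t) ≤ ℓ ^ 2 / (2 * Real.pi) := by
  have cx : Continuous x := continuous_iff_continuousAt.2 fun t => (hx t).continuousAt
  have cy : Continuous y := continuous_iff_continuousAt.2 fun t => (hy t).continuousAt
  -- Moving the centre of mass to the origin makes the mean zero and does not change the enclosed
  -- area.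
  set a := (∫ t in (0 : ℝ)..ℓ, x t) / ℓ with ha
  set b := (∫ t in (0 : ℝ)..ℓ, y t) / ℓ with hb
  have hπ := Real.pi_pos
  have nsq : ∀ p q : ℝ, ‖(p : ℂ) + q * Complex.I‖ ^ 2 = p ^ 2 + q ^ 2 := fun p q => by
    rw [← Complex.normSq_eq_norm_sq, Complex.normSq_add_mul_I]
  have W := integral_norm_sq_le_of_integral_eq_zero hℓ
    (w := fun t => ((x t - a : ℝ) : ℂ) + ((y t - b : ℝ) : ℂ) * Complex.I)
    (w' := fun t => ((x' t : ℝ) : ℂ) + ((y' t : ℝ) : ℂ) * Complex.I)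
    (fun t => (((hx t).sub_const a).ofReal_comp).add
      ((((hy t).sub_const b).ofReal_comp).mul_const _)) (by fun_prop) (by simp only [hx0, hy0]) (by
      rw [intervalIntegral.integral_add (Continuous.intervalIntegrable (by fun_prop) _ _)
        (Continuous.intervalIntegrable (by fun_prop) _ _), intervalIntegral.integral_mul_const,
        intervalIntegral.integral_ofReal, intervalIntegral.integral_ofReal,
        intervalIntegral.integral_sub (cx.intervalIntegrable _ _) (by simp),
        intervalIntegral.integral_sub (cy.intervalIntegrable _ _) (by simp),
        intervalIntegral.integral_const, intervalIntegral.integral_const, sub_zero, smul_eq_mul,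
        smul_eq_mul, ha, hb, mul_div_cancel₀ _ hℓ.ne', mul_div_cancel₀ _ hℓ.ne', sub_self, sub_self]
      simp)
  simp only [nsq, hunit] at W
  rw [intervalIntegral.integral_const, sub_zero, smul_eq_mul, mul_one] at W
  have fx : ∫ t in (0 : ℝ)..ℓ, x' t = 0 := by
    rw [intervalIntegral.integral_eq_sub_of_hasDerivAt (fun t _ => hx t)
      (cx'.intervalIntegrable _ _), hx0, sub_self]
  have fy : ∫ t in (0 : ℝ)..ℓ, y' t = 0 := by
    rw [intervalIntegral.integral_eq_sub_of_hasDerivAt (fun t _ => hy t)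
      (cy'.intervalIntegrable _ _), hy0, sub_self]
  have e : ∫ t in (0 : ℝ)..ℓ, (x t * y' t - y t * x' t) =
      ∫ t in (0 : ℝ)..ℓ, ((x t - a) * y' t - (y t - b) * x' t) := by
    have : ∀ t, (x t - a) * y' t - (y t - b) * x' t =
        (x t * y' t - y t * x' t) - (a * y' t - b * x' t) := fun t => by ring
    simp only [this]
    rw [intervalIntegral.integral_sub (f := fun t => x t * y' t - y t * x' t)
      (g := fun t => a * y' t - b * x' t) (Continuous.intervalIntegrable (by fun_prop) _ _)
      (Continuous.intervalIntegrable (by fun_prop) _ _),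
      intervalIntegral.integral_sub (f := fun t => a * y' t)
      (Continuous.intervalIntegrable (by fun_prop) _ _)
      (Continuous.intervalIntegrable (by fun_prop) _ _), intervalIntegral.integral_const_mul,
      intervalIntegral.integral_const_mul, fx, fy]
    ring
  -- The quadratic estimate is balanced for equality at radius $\ell/2\pi$: after Wirtinger both
  -- terms on the right contribute $\ell^2/4\pi$.
  have pt : ∀ t, (x t - a) * y' t - (y t - b) * x' t ≤
      Real.pi / ℓ * ((x t - a) ^ 2 + (y t - b) ^ 2) + ℓ / (4 * Real.pi) := by
    intro t
    set u := x t - a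
    set v := y t - b
    have h1 : (u * y' t - v * x' t) ^ 2 ≤ u ^ 2 + v ^ 2 := by
      have : (u * y' t - v * x' t) ^ 2 + (u * x' t + v * y' t) ^ 2 =
        (u ^ 2 + v ^ 2) * (x' t ^ 2 + y' t ^ 2) := by ring
      rw [hunit] at this
      nlinarith [sq_nonneg (u * x' t + v * y' t)]
    set c := u * y' t - v * x' t
    have h2 : Real.pi / ℓ * c ^ 2 + ℓ / (4 * Real.pi) - c =
        Real.pi / ℓ * (c - ℓ / (2 * Real.pi)) ^ 2 := by field_simp; ring
    have h3 : 0 ≤ Real.pi / ℓ * (c - ℓ / (2 * Real.pi)) ^ 2 := by positivity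
    have h4 : Real.pi / ℓ * c ^ 2 ≤ Real.pi / ℓ * (u ^ 2 + v ^ 2) := by gcongr
    linarith
  rw [e]
  refine (intervalIntegral.integral_mono hℓ.le (Continuous.intervalIntegrable (by fun_prop) _ _)
    (Continuous.intervalIntegrable (by fun_prop) _ _) pt).trans ?_
  rw [intervalIntegral.integral_add (Continuous.intervalIntegrable (by fun_prop) _ _) (by simp),
    intervalIntegral.integral_const_mul, intervalIntegral.integral_const, sub_zero, smul_eq_mul]
  have h5 := mul_le_mul_of_nonneg_left W (by positivity : 0 ≤ Real.pi / ℓ)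
  have h6 : Real.pi / ℓ * ((ℓ / (2 * Real.pi)) ^ 2 * ℓ) + ℓ * (ℓ / (4 * Real.pi)) =
      ℓ ^ 2 / (2 * Real.pi) := by field_simp; ring
  linarith

/-! ### Brunn–Minkowski inequalities. -/

/-- The one-dimensional Brunn–Minkowski inequality for a set and an interval. -/
theorem volume_add_le_of_interval {X Y : Set ℝ} (hX : MeasurableSet X) (hne : X.Nonempty) {h : ℝ}
    (h0 : 0 ≤ h) (hY : ∀ x ∈ X, ∀ u ∈ Icc (-h) h, x + u ∈ Y) :
    volume X + ENNReal.ofReal (2 * h) ≤ volume Y := by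
  obtain ⟨x₀, hx₀⟩ := hne
  -- The part of `X` to the left of `x₀` is shifted left by `h`, the rest right by `h`, and the gap
  -- `Ico (x₀ - h) (x₀ + h)` is filled from `x₀` itself; the three pieces are disjoint subsets of
  -- `Y`.
  set S₁ := (fun x => x + h) ⁻¹' (X ∩ Iio x₀) with hS₁
  set S₃ := (fun x => x + -h) ⁻¹' (X ∩ Ici x₀) with hS₃
  have m₁ : MeasurableSet S₁ := (measurable_add_const h) (hX.inter measurableSet_Iio)
  have m₃ : MeasurableSet S₃ := (measurable_add_const (-h)) (hX.inter measurableSet_Ici)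
  have v₁ : volume S₁ = volume (X ∩ Iio x₀) := measure_preimage_add_right _ _ _
  have v₃ : volume S₃ = volume (X ∩ Ici x₀) := measure_preimage_add_right _ _ _
  have vX : volume X = volume S₁ + volume S₃ := by
    rw [v₁, v₃, ← measure_inter_add_sdiff X measurableSet_Iio, ← compl_Iio]; rfl
  have v₂ : volume (Ico (x₀ - h) (x₀ + h)) = ENNReal.ofReal (2 * h) := by
    rw [Real.volume_Ico]; congr 1; ring
  have d₁ : Disjoint S₁ (Ico (x₀ - h) (x₀ + h)) := disjoint_left.2 fun x hx hx' => by
    have : x + h < x₀ := hx.2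
    linarith [hx'.1]
  have d₂ : Disjoint (S₁ ∪ Ico (x₀ - h) (x₀ + h)) S₃ := disjoint_left.2 fun x hx hx' => by
    have h3 : x₀ ≤ x + -h := hx'.2
    rcases hx with hx | hx
    · have : x + h < x₀ := hx.2
      linarith
    · linarith [hx.2]
  have sub : (S₁ ∪ Ico (x₀ - h) (x₀ + h)) ∪ S₃ ⊆ Y := by
    rintro x ((hx | hx) | hx)
    · have := hY _ hx.1 (-h) ⟨le_rfl, by linarith⟩
      simpa using this
    · have := hY _ hx₀ (x - x₀) ⟨by linarith [hx.1], by linarith [hx.2]⟩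
      simpa using this
    · have := hY _ hx.1 h ⟨by linarith, le_rfl⟩
      simpa using this
  calc volume X + ENNReal.ofReal (2 * h)
      = volume ((S₁ ∪ Ico (x₀ - h) (x₀ + h)) ∪ S₃) := by
        rw [measure_union d₂ m₃, measure_union d₁ measurableSet_Ico, v₂, vX]; ring
    _ ≤ volume Y := measure_mono sub

theorem integral_zero_one_sqrt : ∫ x in (0 : ℝ)..1, √(1 - x ^ 2) = Real.pi / 4 := by
  have hc : Continuous fun x : ℝ => √(1 - x ^ 2) := by fun_prop
  have h := integral_sqrt_one_sub_sq
  rw [← intervalIntegral.integral_add_adjacent_intervals (b := 0) (hc.intervalIntegrable _ _)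
    (hc.intervalIntegrable _ _)] at h
  have h2 := intervalIntegral.integral_comp_neg (a := 0) (b := 1) (fun x : ℝ => √(1 - x ^ 2))
  simp only [neg_zero, neg_sq] at h2
  linarith

/-- The Brunn–Minkowski inequality for a plane set and the unit disc. -/
theorem sq_sqrt_add_sqrt_pi_le {A Ω : Set (ℝ × ℝ)} (hA : MeasurableSet A) (hΩ : IsCompact Ω)
    (hA0 : volume A ≠ 0)
    (h : ∀ a ∈ A, ∀ u v : ℝ, u ^ 2 + v ^ 2 ≤ 1 → (a.1 + u, a.2 + v) ∈ Ω) :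
    (√(volume A).toReal + √Real.pi) ^ 2 ≤ (volume Ω).toReal := by
  have hAΩ : A ⊆ Ω := fun a ha => by simpa using h a ha 0 0 (by norm_num)
  obtain ⟨C, hC⟩ := hΩ.isBounded.subset_closedBall (0 : ℝ × ℝ)
  have slice_sub : ∀ x, Prod.mk x ⁻¹' Ω ⊆ Icc (-C) C := fun x y hy => by
    have := hC hy
    rw [mem_closedBall_zero_iff, Prod.norm_def, max_le_iff, Real.norm_eq_abs, Real.norm_eq_abs,
      abs_le, abs_le] at this
    exact this.2
  have fin : ∀ {B : Set (ℝ × ℝ)}, B ⊆ Ω → ∀ x, volume (Prod.mk x ⁻¹' B) ≤ ENNReal.ofReal (C - -C) :=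
    fun hB x => by
      rw [← Real.volume_Icc]; exact measure_mono ((preimage_mono hB).trans (slice_sub x))
  have fin' : ∀ {B : Set (ℝ × ℝ)}, B ⊆ Ω → ∀ x, volume (Prod.mk x ⁻¹' B) ≠ ∞ := fun hB x =>
    ((fin hB x).trans_lt ENNReal.ofReal_lt_top).ne
  -- The length of the vertical slice over `x`.
  let f : Set (ℝ × ℝ) → ℝ → ℝ := fun B x => (volume (Prod.mk x ⁻¹' B)).toReal
  have hf : ∀ {B}, MeasurableSet B → Measurable (f B) := fun hB =>
    (measurable_measure_prodMk_left hB).ennreal_toReal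
  have cake : ∀ {B}, MeasurableSet B → B ⊆ Ω →
      volume B = ∫⁻ t in Ioi 0, volume {x | t < f B x} := fun {B} hB hBΩ => by
    rw [← lintegral_eq_lintegral_meas_lt volume (Eventually.of_forall fun x => ENNReal.toReal_nonneg)
      (hf hB).aemeasurable, Measure.volume_eq_prod, Measure.prod_apply hB]
    congr 1; ext x
    rw [ENNReal.ofReal_toReal (fin' hBΩ x)]
  have scale : ∀ {N : ℝ}, 0 < N → ∀ g : ℝ → ℝ≥0∞,
      ∫⁻ t in Ioo 0 N, g t = ENNReal.ofReal N * ∫⁻ t in Ioo 0 1, g (N * t) := fun {N} hN g => by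
    have e : (fun t => N * t) '' Ioo 0 1 = Ioo 0 N := by
      rw [image_mul_left_Ioo hN, mul_zero, mul_one]
    rw [← e, lintegral_image_eq_lintegral_abs_deriv_mul (f := fun t => N * t)
      (f' := fun _ => N * 1) measurableSet_Ioo
      (fun x _ => ((hasDerivAt_id x).const_mul N).hasDerivWithinAt)
      (mul_right_injective₀ hN.ne').injOn]
    simp only [mul_one, abs_of_pos hN]
    rw [lintegral_const_mul']
    exact ENNReal.ofReal_ne_top
  have bdd : BddAbove (range (f A)) := ⟨(ENNReal.ofReal (C - -C)).toReal, by
    rintro _ ⟨x, rfl⟩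
    exact ENNReal.toReal_mono ENNReal.ofReal_ne_top (fin hAΩ x)⟩
  set M := sSup (range (f A)) with hM
  have hle : ∀ x, f A x ≤ M := fun x => le_csSup bdd (mem_range_self x)
  have hMpos : 0 < M := by
    by_contra! hM0
    apply hA0
    rw [cake hA hAΩ]
    refine (setLIntegral_congr_fun (g := fun _ => 0) measurableSet_Ioi fun t ht => ?_).trans (by simp)
    have : {x | t < f A x} = ∅ := eq_empty_of_forall_notMem fun x hx => by
      have h1 : t < f A x := hx
      have h2 : (0 : ℝ) < t := ht
      linarith [hle x]
    simp [this]
  have cakeA : volume A = ENNReal.ofReal M * ∫⁻ t in Ioo 0 1, volume {x | M * t < f A x} := by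
    rw [← scale hMpos (fun t => volume {x | t < f A x}), cake hA hAΩ,
      ← Ioo_union_Ici_eq_Ioi hMpos]
    refine le_antisymm ((lintegral_union_le _ _ _).trans ?_) (lintegral_mono_set subset_union_left)
    rw [setLIntegral_congr_fun (g := fun _ => 0) (s := Ici M) measurableSet_Ici fun t ht => ?_]
    · simp
    have : {x | t < f A x} = ∅ := eq_empty_of_forall_notMem fun x hx => by
      have h1 : t < f A x := hx
      have h2 : M ≤ t := ht
      linarith [hle x]
    simp [this]
  -- Superlevel sets of the slice lengths are compared at proportional heights, the maxima being `M`
  -- for `A` and 2 for the disc. Over $|u|\le\sqrt{1-t^2}$ the slice of the disc has length at least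
  -- $2t$, so the one-dimensional inequality in the fibre raises the level from $Mt$ to $(M+2)t$;
  -- the same inequality in the base adds $2\sqrt{1-t^2}$.
  have key : ∀ t ∈ Ioo (0 : ℝ) 1, volume {x | M * t < f A x} + ENNReal.ofReal (2 * √(1 - t ^ 2)) ≤
      volume {x | (M + 2) * t < f Ω x} := by
    intro t ht
    refine volume_add_le_of_interval (measurableSet_lt measurable_const (hf hA)) ?_
      (Real.sqrt_nonneg _) ?_
    · obtain ⟨_, ⟨x, rfl⟩, hx⟩ := exists_lt_of_lt_csSup (range_nonempty (f A))
        (show M * t < M by nlinarith [ht.2])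
      exact ⟨x, hx⟩
    · intro x hx u hu
      have hx' : M * t < f A x := hx
      have hu2 : u ^ 2 ≤ 1 - t ^ 2 := by
        rw [← Real.sq_sqrt (by nlinarith [ht.1, ht.2] : 0 ≤ 1 - t ^ 2)]
        exact sq_le_sq' hu.1 hu.2
      have ht2 : t ≤ √(1 - u ^ 2) := Real.le_sqrt_of_sq_le (by linarith)
      have hpos : 0 < f A x := lt_of_le_of_lt (mul_nonneg hMpos.le ht.1.le) hx'
      have hne : (Prod.mk x ⁻¹' A).Nonempty := by
        by_contra hemp
        rw [not_nonempty_iff_eq_empty] at hemp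
        simp only [f, hemp, measure_empty, ENNReal.toReal_zero, lt_irrefl] at hpos
      have h1 := volume_add_le_of_interval (X := Prod.mk x ⁻¹' A) (Y := Prod.mk (x + u) ⁻¹' Ω)
        (measurable_prodMk_left hA) hne (h := √(1 - u ^ 2))
        (Real.sqrt_nonneg _) (fun y hy v hv =>
          h (x, y) hy u v (by
            have : v ^ 2 ≤ 1 - u ^ 2 := by
              rw [← Real.sq_sqrt (by nlinarith [ht.1, ht.2] : 0 ≤ 1 - u ^ 2)]
              exact sq_le_sq' hv.1 hv.2
            linarith))
      have h2 := ENNReal.toReal_mono (fin' Subset.rfl (x + u)) h1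
      rw [ENNReal.toReal_add (fin' hAΩ x) ENNReal.ofReal_ne_top,
        ENNReal.toReal_ofReal (by positivity)] at h2
      change (M + 2) * t < f Ω (x + u)
      have h3 : f A x + 2 * √(1 - u ^ 2) ≤ f Ω (x + u) := h2
      linarith
  set I := ∫⁻ t in Ioo 0 1, volume {x | M * t < f A x} with hI
  have hdisc : ∫⁻ t in Ioo (0 : ℝ) 1, ENNReal.ofReal (2 * √(1 - t ^ 2)) =
      ENNReal.ofReal (Real.pi / 2) := by
    rw [← ofReal_integral_eq_lintegral_ofReal]
    · rw [← integral_Ioc_eq_integral_Ioo, ← intervalIntegral.integral_of_le zero_le_one,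
        intervalIntegral.integral_const_mul, integral_zero_one_sqrt]
      congr 1; ring
    · exact (Continuous.integrableOn_Icc (by fun_prop)).mono_set Ioo_subset_Icc_self
    · exact Eventually.of_forall fun t => by positivity
  have main : ENNReal.ofReal (M + 2) * (I + ENNReal.ofReal (Real.pi / 2)) ≤ volume Ω := by
    calc _ = ENNReal.ofReal (M + 2) * ∫⁻ t in Ioo (0 : ℝ) 1, (volume {x | M * t < f A x} +
          ENNReal.ofReal (2 * √(1 - t ^ 2))) := by
          rw [lintegral_add_right _ (by fun_prop), hdisc]
      _ ≤ ENNReal.ofReal (M + 2) * ∫⁻ t in Ioo (0 : ℝ) 1, volume {x | (M + 2) * t < f Ω x} := by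
          gcongr 1
          exact setLIntegral_mono' measurableSet_Ioo key
      _ = ∫⁻ t in Ioo 0 (M + 2), volume {x | t < f Ω x} :=
          (scale (by linarith) (fun t => volume {x | t < f Ω x})).symm
      _ ≤ ∫⁻ t in Ioi 0, volume {x | t < f Ω x} := lintegral_mono_set Ioo_subset_Ioi_self
      _ = volume Ω := (cake hΩ.measurableSet Subset.rfl).symm
  have hI1 : I ≠ ∞ := fun hI1 => by
    rw [hI1, ENNReal.mul_top (by simpa using hMpos)] at cakeA
    exact ((measure_mono hAΩ).trans_lt hΩ.measure_lt_top).ne cakeA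
  have m2 := ENNReal.toReal_mono hΩ.measure_lt_top.ne main
  rw [ENNReal.toReal_mul, ENNReal.toReal_add hI1 ENNReal.ofReal_ne_top,
    ENNReal.toReal_ofReal (by linarith), ENNReal.toReal_ofReal (by positivity)] at m2
  have m1 : (volume A).toReal = M * I.toReal := by
    rw [cakeA, ENNReal.toReal_mul, ENNReal.toReal_ofReal hMpos.le]
  refine le_trans ?_ m2
  have hi : 0 ≤ I.toReal := ENNReal.toReal_nonneg
  rw [m1]
  have hπ := Real.pi_pos
  rw [add_sq, Real.sq_sqrt (by positivity), Real.sq_sqrt hπ.le]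
  -- With area $MI$ for `A` and $2\cdot\pi/2$ for the disc, expanding $(M+2)(I+\pi/2)$ leaves the
  -- cross terms, to which the inequality of the means applies.
  have amgm : 2 * (√(M * I.toReal) * √Real.pi) ≤ 2 * I.toReal + M * (Real.pi / 2) := by
    rw [← Real.sqrt_mul (by positivity)]
    have : √(M * I.toReal * Real.pi) ≤ (2 * I.toReal + M * (Real.pi / 2)) / 2 := by
      apply Real.sqrt_le_iff.2 ⟨by positivity, ?_⟩
      nlinarith [sq_nonneg (2 * I.toReal - M * (Real.pi / 2))]
    linarith
  nlinarith

/-! ### Cone angle and the choice of the apex. -/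

theorem parallelogramArea_nonneg (u v : Space3) : 0 ≤ parallelogramArea u v := Real.sqrt_nonneg _

theorem parallelogramArea_sq (u v : Space3) :
    parallelogramArea u v ^ 2 = ‖u‖ ^ 2 * ‖v‖ ^ 2 - ⟪u, v⟫ ^ 2 :=
  Real.sq_sqrt (by rw [← norm_cross_sq]; positivity)

theorem parallelogramArea_le (u v : Space3) : parallelogramArea u v ≤ ‖u‖ * ‖v‖ := by
  refine le_of_sq_le_sq ?_ (by positivity)
  rw [parallelogramArea_sq, mul_pow]
  linarith [sq_nonneg ⟪u, v⟫]

namespace UnitSpeedLoop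

variable {L : Set Space3} {γ : ClosedCurve}

/-- The speed of the central projection of a curve to the unit sphere around a point. -/
def coneSpeed (B : UnitSpeedLoop L γ) (p : Space3) (t : ℝ) : ℝ :=
  parallelogramArea (B.J t - p) (B.T t) / ‖B.J t - p‖ ^ 2

theorem coneSpeed_nonneg (B : UnitSpeedLoop L γ) (p : Space3) (t : ℝ) : 0 ≤ B.coneSpeed p t :=
  div_nonneg (parallelogramArea_nonneg _ _) (sq_nonneg _)

theorem coneSpeed_periodic (B : UnitSpeedLoop L γ) (p : Space3) :
    Function.Periodic (B.coneSpeed p) B.ℓ := fun t => by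
  rw [coneSpeed, coneSpeed, B.periodic, B.isC1Loop.periodic_deriv]

theorem norm_J_sub_pos (B : UnitSpeedLoop L γ) {p : Space3} (hp : p ∉ range B.J) (t : ℝ) :
    0 < ‖B.J t - p‖ := norm_pos_iff.2 (sub_ne_zero.2 fun h => hp ⟨t, h⟩)

theorem continuous_coneSpeed (B : UnitSpeedLoop L γ) {p : Space3} (hp : p ∉ range B.J) :
    Continuous (B.coneSpeed p) := by
  have := B.continuous_J
  have := B.continuous_T
  exact (continuous_parallelogramArea (by fun_prop) (by fun_prop)).div (by fun_prop)
    fun t => (pow_pos (B.norm_J_sub_pos hp t) 2).ne'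

theorem hasDerivAt_norm_J_sub (B : UnitSpeedLoop L γ) {p : Space3} (hp : p ∉ range B.J) (t : ℝ) :
    HasDerivAt (fun t => ‖B.J t - p‖) (⟪B.J t - p, B.T t⟫ / ‖B.J t - p‖) t := by
  have h0 := B.norm_J_sub_pos hp t
  have h := (((B.hasDerivAt t).sub_const p).norm_sq).sqrt (pow_pos h0 2).ne'
  simp only [Real.sqrt_sq (norm_nonneg _)] at h
  convert h using 1
  field_simp

theorem sq_add_sq_coneSpeed (B : UnitSpeedLoop L γ) {p : Space3} (hp : p ∉ range B.J) (t : ℝ) :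
    (⟪B.J t - p, B.T t⟫ / ‖B.J t - p‖) ^ 2 + (‖B.J t - p‖ * B.coneSpeed p t) ^ 2 = 1 := by
  have h0 := B.norm_J_sub_pos hp t
  have h1 := parallelogramArea_sq (B.J t - p) (B.T t)
  rw [B.norm_T, one_pow, mul_one] at h1
  rw [coneSpeed, div_pow, mul_pow, div_pow, h1]
  field_simp
  ring

/-- `coneSpeed` is the norm of the derivative of the unit vector pointing from `p` to the curve. -/
theorem angle_le_integral_coneSpeed (B : UnitSpeedLoop L γ) {p : Space3} (hp : p ∉ range B.J)
    {s t : ℝ} (hst : s ≤ t) :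
    InnerProductGeometry.angle (B.J s - p) (B.J t - p) ≤ ∫ x in s..t, B.coneSpeed p x := by
  have hpos := B.norm_J_sub_pos hp
  have cJ := B.continuous_J
  have h := angle_le_integral (u := fun t => ‖B.J t - p‖⁻¹ • (B.J t - p)) (B.continuous_coneSpeed hp)
    (fun t => by rw [norm_smul, norm_inv, norm_norm, inv_mul_cancel₀ (hpos t).ne'])
    (((by fun_prop : Continuous fun t => ‖B.J t - p‖).inv₀ fun t => (hpos t).ne').smul
      (by fun_prop)) (fun t r hr => ?_) hst
  · simpa only [InnerProductGeometry.angle_smul_left_of_pos _ _ (inv_pos.2 (hpos s)),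
      InnerProductGeometry.angle_smul_right_of_pos _ _ (inv_pos.2 (hpos t))] using h
  have hd := ((B.hasDerivAt_norm_J_sub hp t).inv (hpos t).ne').smul ((B.hasDerivAt t).sub_const p)
  set R := ‖B.J t - p‖ with hR
  set c := ⟪B.J t - p, B.T t⟫ with hc
  have hn : ‖R⁻¹ • B.T t + (-(c / R) / R ^ 2) • (B.J t - p)‖ = B.coneSpeed p t := by
    have h0 : 0 < R := hpos t
    refine (pow_left_inj₀ (norm_nonneg _) (B.coneSpeed_nonneg p t) two_ne_zero).1 ?_
    rw [norm_add_sq_real, norm_smul, norm_smul, real_inner_smul_left, real_inner_smul_right,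
      real_inner_comm, ← hc, B.norm_T, mul_pow, mul_pow, Real.norm_eq_abs, Real.norm_eq_abs, sq_abs,
      sq_abs, ← hR, coneSpeed, div_pow (parallelogramArea _ _), parallelogramArea_sq, B.norm_T, ← hR,
      ← hc]
    field_simp
    ring
  have h2 := hd.hasDerivWithinAt.limsup_norm_slope_le (s := Ioi t) (r := r) (by
    refine lt_of_eq_of_lt ?_ hr
    exact hn)
  filter_upwards [h2, self_mem_nhdsWithin] with z hz hzt
  have hzt' : 0 < z - t := sub_pos.2 hzt
  rw [Real.norm_of_nonneg hzt'.le, inv_mul_lt_iff₀ hzt'] at hz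
  rw [mul_comm]
  exact hz.le

/-- A curve of unit thickness does not contain all its chords. -/
theorem exists_chord_notMem (B : UnitSpeedLoop L γ) (hB : range γ ⊆ L) :
    ∃ a b r : ℝ, r ∈ Icc 0 1 ∧ B.J a + r • (B.J b - B.J a) ∉ range B.J := by
  by_contra! hall
  -- Applied to the points of a chord close to `B.J 0`, the tangency inequality makes the chord
  -- parallel to `B.T 0`. The curve would then lie on a line, with zero velocity where the height
  -- along that line has a critical point.
  have hline : ∀ b, B.J b = B.J 0 + ⟪B.T 0, B.J b - B.J 0⟫ • B.T 0 := by
    intro b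
    set w := B.J b - B.J 0 with hw
    have hr : ∀ r ∈ Ioo (0 : ℝ) 1, 4 * (‖w‖ ^ 2 - ⟪B.T 0, w⟫ ^ 2) ≤ r ^ 2 * ‖w‖ ^ 4 := by
      intro r hr
      have h1 := B.tangent 0 (B.J 0 + r • w) (hB (B.range_J ▸ hall 0 b r ⟨hr.1.le, hr.2.le⟩))
      rw [add_sub_cancel_left, norm_smul, real_inner_smul_right, Real.norm_of_nonneg hr.1.le] at h1
      have h2 : 0 < r ^ 2 := pow_pos hr.1 2
      refine le_of_mul_le_mul_left ?_ h2
      linarith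
    have lim : Tendsto (fun r : ℝ => r ^ 2 * ‖w‖ ^ 4) (𝓝[>] 0) (𝓝 ((0 : ℝ) ^ 2 * ‖w‖ ^ 4)) :=
      (Continuous.tendsto (by fun_prop) 0).mono_left nhdsWithin_le_nhds
    have h3 := ge_of_tendsto lim (by
      filter_upwards [Ioo_mem_nhdsGT (show (0 : ℝ) < 1 by norm_num)] with r h using hr r h)
    have h4 : ‖w - ⟪B.T 0, w⟫ • B.T 0‖ ^ 2 = 0 := by
      refine le_antisymm ?_ (sq_nonneg _)
      rw [norm_sub_inner_smul_sq (B.norm_T 0)]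
      linarith
    rw [sq_eq_zero_iff, norm_eq_zero, sub_eq_zero] at h4
    rw [← h4, hw]; abel
  obtain ⟨s, -, hs0⟩ := exists_hasDerivAt_eq_zero (f := fun t => ⟪B.T 0, B.J t - B.J 0⟫)
    (f' := fun t => ⟪B.T 0, B.T t⟫) B.pos (Continuous.continuousOn
      (by have := B.continuous_J; fun_prop))
    (by have := B.periodic 0; rw [zero_add] at this; simp only [this])
    (fun t _ => by simpa using (hasDerivAt_const t (B.T 0)).inner ℝ ((B.hasDerivAt t).sub_const _))
  have h1 : HasDerivAt B.J (⟪B.T 0, B.T s⟫ • B.T 0) s := by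
    have h2 : HasDerivAt (fun t => ⟪B.T 0, B.J t - B.J 0⟫) ⟪B.T 0, B.T s⟫ s := by
      simpa using (hasDerivAt_const s (B.T 0)).inner ℝ ((B.hasDerivAt s).sub_const (B.J 0))
    have h3 := (h2.smul_const (B.T 0)).const_add (B.J 0)
    rwa [← funext hline] at h3
  have h4 := (B.hasDerivAt s).unique h1
  rw [hs0, zero_smul] at h4
  have := B.norm_T s
  rw [h4, norm_zero] at this
  exact zero_ne_one this

/-- Seen from an interior point of a chord, its two ends are in opposite directions, so each of the
two arcs between them has visual length at least $\pi$. -/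
theorem two_pi_le_coneAngle (B : UnitSpeedLoop L γ) {a b r : ℝ} (hr : r ∈ Icc (0 : ℝ) 1)
    (hp : B.J a + r • (B.J b - B.J a) ∉ range B.J) :
    2 * Real.pi ≤ ∫ t in (0 : ℝ)..B.ℓ, B.coneSpeed (B.J a + r • (B.J b - B.J a)) t := by
  obtain ⟨c, hc, hbc⟩ := B.periodic.exists_mem_Ico B.pos b a
  rw [hbc] at hp ⊢
  set p := B.J a + r • (B.J c - B.J a) with hpd
  set w := B.J c - B.J a with hw
  have hr0 : 0 < r := lt_of_le_of_ne hr.1 fun h => hp ⟨a, by rw [hpd, ← h]; simp⟩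
  have hr1 : r < 1 := lt_of_le_of_ne hr.2 fun h => hp ⟨c, by rw [hpd, h, hw]; simp⟩
  have ea : B.J a - p = (-r) • w := by rw [hpd]; module
  have ec : B.J c - p = (1 - r) • w := by
    rw [hpd, sub_smul, one_smul, hw]; abel
  have hw0 : w ≠ 0 := fun h => hp ⟨a, by rw [hpd, h]; simp⟩
  have hang : InnerProductGeometry.angle (B.J a - p) (B.J c - p) = Real.pi := by
    rw [ea, ec, InnerProductGeometry.angle_smul_left_of_neg _ _ (by linarith),
      InnerProductGeometry.angle_smul_right_of_pos _ _ (by linarith),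
      InnerProductGeometry.angle_neg_self_of_nonzero hw0]
  have h1 := B.angle_le_integral_coneSpeed hp hc.1
  have h2 := B.angle_le_integral_coneSpeed hp hc.2.le
  rw [B.periodic, InnerProductGeometry.angle_comm, hang] at h2
  rw [hang] at h1
  have cc := B.continuous_coneSpeed hp
  have h3 := intervalIntegral.integral_add_adjacent_intervals (μ := volume)
    (cc.intervalIntegrable a c) (cc.intervalIntegrable c (a + B.ℓ))
  have h4 := (B.coneSpeed_periodic p).intervalIntegral_add_eq a 0
  rw [zero_add] at h4
  linarith

/-- There is a point from which a curve of unit thickness is seen as a curve of length `2π`. -/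
theorem exists_coneAngle_eq (B : UnitSpeedLoop L γ) (hB : range γ ⊆ L) :
    ∃ p, p ∉ range B.J ∧ ∫ t in (0 : ℝ)..B.ℓ, B.coneSpeed p t = 2 * Real.pi := by
  obtain ⟨a, b, r, hr, hp⟩ := B.exists_chord_notMem hB
  have h1 := B.two_pi_le_coneAngle hr hp
  set p := B.J a + r • (B.J b - B.J a)
  have cJ := B.continuous_J
  have cT := B.continuous_T
  have hJ : ContDiff ℝ 1 B.J := by
    rw [contDiff_one_iff_deriv]
    refine ⟨fun x => (B.hasDerivAt x).differentiableAt, ?_⟩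
    rw [funext fun x => (B.hasDerivAt x).deriv]
    exact B.continuous_T
  -- The lines joining `p` to the curve form the `C¹` image of a plane; a direction off this set
  -- gives a ray from `p` that avoids the curve, along which the cone angle is continuous.
  have hd : Dense (range fun z : ℝ × ℝ => z.2 • (B.J z.1 - p))ᶜ :=
    ContDiff.dense_compl_range_of_finrank_lt_finrank
      (contDiff_snd.smul ((hJ.comp contDiff_fst).sub contDiff_const)) (by simp)
  obtain ⟨v, hv⟩ := hd.nonempty
  have hv0 : v ≠ 0 := fun h => hv ⟨(0, 0), by simp [h]⟩
  have hray : ∀ s : ℝ, p + s ^ 2 • v ∉ range B.J := by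
    rintro s ⟨t, ht⟩
    rcases eq_or_ne s 0 with rfl | hs
    · exact hp ⟨t, by simpa using ht⟩
    · refine hv ⟨(t, (s ^ 2)⁻¹), ?_⟩
      simp only
      rw [ht, add_sub_cancel_left, smul_smul, inv_mul_cancel₀ (pow_ne_zero 2 hs), one_smul]
  have hcont : Continuous fun s : ℝ => ∫ t in (0 : ℝ)..B.ℓ, B.coneSpeed (p + s ^ 2 • v) t := by
    refine intervalIntegral.continuous_parametric_intervalIntegral_of_continuous'
      (f := fun (s : ℝ) t => B.coneSpeed (p + s ^ 2 • v) t) ?_ _ _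
    exact (continuous_parallelogramArea (by fun_prop) (by fun_prop)).div (by fun_prop)
      fun z => (pow_pos (B.norm_J_sub_pos (hray z.1) z.2) 2).ne'
  obtain ⟨C, hC⟩ := B.isCompact_range.isBounded.subset_closedBall p
  have hC' : ∀ t, ‖B.J t - p‖ ≤ C := fun t => by
    rw [← dist_eq_norm]; exact hC (mem_range_self t)
  have hC0 : 0 ≤ C := (norm_nonneg _).trans (hC' 0)
  have hvn : 0 < ‖v‖ := norm_pos_iff.2 hv0
  -- At this point of the ray the curve is at distance at least `B.ℓ`, so the angular speed is at
  -- most $1/\ell$ and the cone angle at most one. The intermediate value theorem then supplies the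
  -- angle $2\pi$ in between.
  set s := √((B.ℓ + C) / ‖v‖) with hs
  have hfar : ∫ t in (0 : ℝ)..B.ℓ, B.coneSpeed (p + s ^ 2 • v) t ≤ 2 * Real.pi := by
    have hle : ∀ t, B.coneSpeed (p + s ^ 2 • v) t ≤ 1 / B.ℓ := by
      intro t
      have hpos := B.norm_J_sub_pos (hray s) t
      have h2 : B.ℓ ≤ ‖B.J t - (p + s ^ 2 • v)‖ := by
        have e : B.J t - (p + s ^ 2 • v) = (B.J t - p) - s ^ 2 • v := by abel
        have h3 := norm_sub_norm_le (s ^ 2 • v) (B.J t - p)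
        have h4 : ‖s ^ 2 • v‖ = B.ℓ + C := by
          rw [norm_smul, Real.norm_of_nonneg (sq_nonneg s), hs,
            Real.sq_sqrt (div_nonneg (by linarith [B.pos]) hvn.le), div_mul_cancel₀ _ hvn.ne']
        rw [e, norm_sub_rev]
        linarith [hC' t]
      have h5 := parallelogramArea_le (B.J t - (p + s ^ 2 • v)) (B.T t)
      rw [B.norm_T, mul_one] at h5
      rw [coneSpeed, div_le_div_iff₀ (pow_pos hpos 2) B.pos]
      nlinarith [parallelogramArea_nonneg (B.J t - (p + s ^ 2 • v)) (B.T t), B.pos]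
    have h6 := intervalIntegral.integral_mono B.pos.le (μ := volume)
      ((B.continuous_coneSpeed (hray s)).intervalIntegrable 0 B.ℓ) (by simp) hle
    rw [intervalIntegral.integral_const, sub_zero, smul_eq_mul, mul_one_div_cancel B.pos.ne'] at h6
    linarith [Real.pi_gt_three]
  obtain ⟨s', hs'⟩ := mem_range_of_exists_le_of_exists_ge hcont ⟨s, hfar⟩
    ⟨0, by simpa using h1⟩
  exact ⟨_, hray s', hs'⟩

end UnitSpeedLoop

/-! ### Development of the cone to the plane. -/

theorem exists_int_of_polar_eq {r r' a b : ℝ} (hr : 0 < r) (hr' : 0 < r')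
    (h1 : r * Real.cos a = r' * Real.cos b) (h2 : r * Real.sin a = r' * Real.sin b) :
    r = r' ∧ ∃ k : ℤ, a = b + k * (2 * Real.pi) := by
  have e : r = r' := by
    have h3 : r ^ 2 = r' ^ 2 := by
      have ha : r ^ 2 = (r * Real.cos a) ^ 2 + (r * Real.sin a) ^ 2 := by
        rw [mul_pow, mul_pow, ← mul_add, Real.cos_sq_add_sin_sq, mul_one]
      rw [ha, h1, h2, mul_pow, mul_pow, ← mul_add, Real.cos_sq_add_sin_sq, mul_one]
    exact (pow_left_inj₀ hr.le hr'.le two_ne_zero).1 h3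
  subst e
  obtain ⟨k, hk⟩ := Real.Angle.angle_eq_iff_two_pi_dvd_sub.1
    (Real.Angle.cos_sin_inj (mul_left_cancel₀ hr.ne' h1) (mul_left_cancel₀ hr.ne' h2))
  exact ⟨rfl, k, by linarith⟩

namespace UnitSpeedLoop

variable {L : Set Space3} {γ : ClosedCurve}

/-- The angle swept out by the central projection of a curve to the unit sphere around a point. -/
def coneAngle (B : UnitSpeedLoop L γ) (p : Space3) (t : ℝ) : ℝ := ∫ x in (0 : ℝ)..t, B.coneSpeed p x

/-- The first coordinate of the development of the cone over a curve to the plane. -/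
def devX (B : UnitSpeedLoop L γ) (p : Space3) (t : ℝ) : ℝ :=
  ‖B.J t - p‖ * Real.cos (B.coneAngle p t)

/-- The second coordinate of the development of the cone over a curve to the plane. -/
def devY (B : UnitSpeedLoop L γ) (p : Space3) (t : ℝ) : ℝ :=
  ‖B.J t - p‖ * Real.sin (B.coneAngle p t)

/-- The derivative of `devX`. -/
def devX' (B : UnitSpeedLoop L γ) (p : Space3) (t : ℝ) : ℝ :=
  ⟪B.J t - p, B.T t⟫ / ‖B.J t - p‖ * Real.cos (B.coneAngle p t) -
    ‖B.J t - p‖ * B.coneSpeed p t * Real.sin (B.coneAngle p t)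

/-- The derivative of `devY`. -/
def devY' (B : UnitSpeedLoop L γ) (p : Space3) (t : ℝ) : ℝ :=
  ⟪B.J t - p, B.T t⟫ / ‖B.J t - p‖ * Real.sin (B.coneAngle p t) +
    ‖B.J t - p‖ * B.coneSpeed p t * Real.cos (B.coneAngle p t)

/-- The development of the cone over a curve to the plane. -/
def devCone (B : UnitSpeedLoop L γ) (p : Space3) (z : ℝ × ℝ) : ℝ × ℝ :=
  (z.1 * B.devX p z.2, z.1 * B.devY p z.2)

theorem hasDerivAt_coneAngle (B : UnitSpeedLoop L γ) {p : Space3} (hp : p ∉ range B.J) (t : ℝ) :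
    HasDerivAt (B.coneAngle p) (B.coneSpeed p t) t :=
  intervalIntegral.integral_hasDerivAt_right ((B.continuous_coneSpeed hp).intervalIntegrable _ _)
    ((B.continuous_coneSpeed hp).stronglyMeasurableAtFilter _ _)
    (B.continuous_coneSpeed hp).continuousAt

theorem continuous_coneAngle (B : UnitSpeedLoop L γ) {p : Space3} (hp : p ∉ range B.J) :
    Continuous (B.coneAngle p) :=
  continuous_iff_continuousAt.2 fun t => (B.hasDerivAt_coneAngle hp t).continuousAt

theorem coneAngle_zero (B : UnitSpeedLoop L γ) (p : Space3) : B.coneAngle p 0 = 0 :=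
  intervalIntegral.integral_same

theorem coneAngle_sub (B : UnitSpeedLoop L γ) {p : Space3} (hp : p ∉ range B.J) (s t : ℝ) :
    B.coneAngle p t - B.coneAngle p s = ∫ x in s..t, B.coneSpeed p x :=
  intervalIntegral.integral_interval_sub_left ((B.continuous_coneSpeed hp).intervalIntegrable _ _)
    ((B.continuous_coneSpeed hp).intervalIntegrable _ _)

theorem coneAngle_mono (B : UnitSpeedLoop L γ) {p : Space3} (hp : p ∉ range B.J) :
    Monotone (B.coneAngle p) := fun s t hst => by
  rw [← sub_nonneg, B.coneAngle_sub hp]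
  exact intervalIntegral.integral_nonneg hst fun x _ => B.coneSpeed_nonneg p x

theorem coneAngle_lt (B : UnitSpeedLoop L γ) {p : Space3} (hp : p ∉ range B.J) {s t c : ℝ}
    (hst : s < t) (hc : c ∈ Icc s t) (h : 0 < B.coneSpeed p c) :
    B.coneAngle p s < B.coneAngle p t := by
  rw [← sub_pos, B.coneAngle_sub hp]
  exact intervalIntegral.integral_pos hst (B.continuous_coneSpeed hp).continuousOn
    (fun x _ => B.coneSpeed_nonneg p x) ⟨c, hc, h⟩

theorem coneAngle_add (B : UnitSpeedLoop L γ) {p : Space3} (hp : p ∉ range B.J)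
    (hΘ : B.coneAngle p B.ℓ = 2 * Real.pi) (t : ℝ) :
    B.coneAngle p (t + B.ℓ) = B.coneAngle p t + 2 * Real.pi := by
  have h1 := B.coneAngle_sub hp t (t + B.ℓ)
  rw [(B.coneSpeed_periodic p).intervalIntegral_add_eq t 0, zero_add] at h1
  rw [← hΘ, coneAngle, coneAngle, coneAngle]
  rw [coneAngle, coneAngle] at h1
  linarith

theorem coneAngle_sub_int_mul (B : UnitSpeedLoop L γ) {p : Space3} (hp : p ∉ range B.J)
    (hΘ : B.coneAngle p B.ℓ = 2 * Real.pi) (t : ℝ) (k : ℤ) :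
    B.coneAngle p (t - k * B.ℓ) = B.coneAngle p t - k * (2 * Real.pi) := by
  have h : Function.Periodic (fun t => B.coneAngle p t - 2 * Real.pi / B.ℓ * t) B.ℓ := fun t => by
    have := B.pos.ne'
    simp only [B.coneAngle_add hp hΘ]
    field_simp
    ring
  have h2 := h.sub_int_mul_eq k (x := t)
  have h3 : 2 * Real.pi / B.ℓ * (k * B.ℓ) = k * (2 * Real.pi) := by
    have := B.pos.ne'
    field_simp
  linarith

theorem hasDerivAt_devX (B : UnitSpeedLoop L γ) {p : Space3} (hp : p ∉ range B.J) (t : ℝ) :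
    HasDerivAt (B.devX p) (B.devX' p t) t := by
  have h := (B.hasDerivAt_norm_J_sub hp t).mul (B.hasDerivAt_coneAngle hp t).cos
  refine h.congr_deriv ?_
  rw [devX']; ring

theorem hasDerivAt_devY (B : UnitSpeedLoop L γ) {p : Space3} (hp : p ∉ range B.J) (t : ℝ) :
    HasDerivAt (B.devY p) (B.devY' p t) t := by
  have h := (B.hasDerivAt_norm_J_sub hp t).mul (B.hasDerivAt_coneAngle hp t).sin
  refine h.congr_deriv ?_
  rw [devY']; ring

theorem continuous_devX (B : UnitSpeedLoop L γ) {p : Space3} (hp : p ∉ range B.J) :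
    Continuous (B.devX p) :=
  continuous_iff_continuousAt.2 fun t => (B.hasDerivAt_devX hp t).continuousAt

theorem continuous_devY (B : UnitSpeedLoop L γ) {p : Space3} (hp : p ∉ range B.J) :
    Continuous (B.devY p) :=
  continuous_iff_continuousAt.2 fun t => (B.hasDerivAt_devY hp t).continuousAt

theorem continuous_devX' (B : UnitSpeedLoop L γ) {p : Space3} (hp : p ∉ range B.J) :
    Continuous (B.devX' p) := by
  have c1 := B.continuous_coneSpeed hp
  have c2 := B.continuous_coneAngle hp
  have c3 := B.continuous_J
  have c4 := B.continuous_T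
  have c5 : Continuous fun t => ⟪B.J t - p, B.T t⟫ / ‖B.J t - p‖ :=
    Continuous.div (by fun_prop) (by fun_prop) fun t => (B.norm_J_sub_pos hp t).ne'
  unfold devX'; fun_prop

theorem continuous_devY' (B : UnitSpeedLoop L γ) {p : Space3} (hp : p ∉ range B.J) :
    Continuous (B.devY' p) := by
  have c1 := B.continuous_coneSpeed hp
  have c2 := B.continuous_coneAngle hp
  have c3 := B.continuous_J
  have c4 := B.continuous_T
  have c5 : Continuous fun t => ⟪B.J t - p, B.T t⟫ / ‖B.J t - p‖ :=
    Continuous.div (by fun_prop) (by fun_prop) fun t => (B.norm_J_sub_pos hp t).ne'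
  unfold devY'; fun_prop

theorem continuous_devCone (B : UnitSpeedLoop L γ) {p : Space3} (hp : p ∉ range B.J) :
    Continuous (B.devCone p) := by
  have := B.continuous_devX hp
  have := B.continuous_devY hp
  unfold devCone; fun_prop

theorem dev_add (B : UnitSpeedLoop L γ) {p : Space3} (hp : p ∉ range B.J)
    (hΘ : B.coneAngle p B.ℓ = 2 * Real.pi) :
    Function.Periodic (fun t => (B.devX p t, B.devY p t)) B.ℓ := fun t => by
  simp only [devX, devY, B.coneAngle_add hp hΘ, B.periodic t, Real.cos_add_two_pi,
    Real.sin_add_two_pi]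

/-- The development preserves the radial and the angular component of the velocity, so it has unit
speed as well. -/
theorem devX'_sq_add (B : UnitSpeedLoop L γ) {p : Space3} (hp : p ∉ range B.J) (t : ℝ) :
    B.devX' p t ^ 2 + B.devY' p t ^ 2 = 1 := by
  rw [← B.sq_add_sq_coneSpeed hp t, devX', devY']
  set a := ⟪B.J t - p, B.T t⟫ / ‖B.J t - p‖
  set b := ‖B.J t - p‖ * B.coneSpeed p t
  linear_combination (a ^ 2 + b ^ 2) * Real.cos_sq_add_sin_sq (B.coneAngle p t)

theorem devX_mul_devY' (B : UnitSpeedLoop L γ) {p : Space3} (hp : p ∉ range B.J) (t : ℝ) :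
    B.devX p t * B.devY' p t - B.devY p t * B.devX' p t =
      parallelogramArea (B.J t - p) (B.T t) := by
  have h : parallelogramArea (B.J t - p) (B.T t) = ‖B.J t - p‖ ^ 2 * B.coneSpeed p t := by
    rw [coneSpeed, mul_div_cancel₀ _ (pow_pos (B.norm_J_sub_pos hp t) 2).ne']
  rw [h, devX, devY, devX', devY']
  linear_combination (‖B.J t - p‖ ^ 2 * B.coneSpeed p t) *
    Real.cos_sq_add_sin_sq (B.coneAngle p t)

/-- The derivative of the development of the cone. -/
def devCone' (B : UnitSpeedLoop L γ) (p : Space3) (z : ℝ × ℝ) : ℝ × ℝ →L[ℝ] ℝ × ℝ :=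
  (B.devX p z.2 • ContinuousLinearMap.fst ℝ ℝ ℝ +
    (z.1 * B.devX' p z.2) • ContinuousLinearMap.snd ℝ ℝ ℝ).prod
  (B.devY p z.2 • ContinuousLinearMap.fst ℝ ℝ ℝ +
    (z.1 * B.devY' p z.2) • ContinuousLinearMap.snd ℝ ℝ ℝ)

theorem hasFDerivAt_devCone (B : UnitSpeedLoop L γ) {p : Space3} (hp : p ∉ range B.J) (z : ℝ × ℝ) :
    HasFDerivAt (B.devCone p) (B.devCone' p z) z := by
  have h1 : HasFDerivAt (fun z : ℝ × ℝ => z.1) (ContinuousLinearMap.fst ℝ ℝ ℝ) z := hasFDerivAt_fst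
  have h2 : HasFDerivAt (fun z : ℝ × ℝ => z.2) (ContinuousLinearMap.snd ℝ ℝ ℝ) z := hasFDerivAt_snd
  have hx := h1.mul ((B.hasDerivAt_devX hp z.2).comp_hasFDerivAt z h2)
  have hy := h1.mul ((B.hasDerivAt_devY hp z.2).comp_hasFDerivAt z h2)
  refine (hx.prodMk hy).congr_fderiv ?_
  ext <;> simp [devCone']

theorem det_devCone' (B : UnitSpeedLoop L γ) {p : Space3} (hp : p ∉ range B.J) (z : ℝ × ℝ) :
    (B.devCone' p z).det = z.1 * parallelogramArea (B.J z.2 - p) (B.T z.2) := by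
  rw [← B.devX_mul_devY' hp, ContinuousLinearMap.det,
    ← LinearMap.det_toMatrix (Module.Basis.finTwoProd ℝ), Matrix.det_fin_two]
  simp [LinearMap.toMatrix_apply, devCone']
  ring

/-- The developed cone over a curve of length `ℓ` has area at most `ℓ ^ 2 / 4π`. -/
theorem volume_devCone_le (B : UnitSpeedLoop L γ) {p : Space3} (hp : p ∉ range B.J)
    (hΘ : B.coneAngle p B.ℓ = 2 * Real.pi) :
    (volume (B.devCone p '' (Icc 0 1 ×ˢ Icc 0 B.ℓ))).toReal ≤ B.ℓ ^ 2 / (4 * Real.pi) := by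
  have cJ := B.continuous_J
  have cT := B.continuous_T
  have cpA : Continuous fun z : ℝ × ℝ => z.1 * parallelogramArea (B.J z.2 - p) (B.T z.2) :=
    continuous_fst.mul (continuous_parallelogramArea (by fun_prop) (by fun_prop))
  -- Only an upper bound for the image is needed, so injectivity plays no role here.
  have h1 := addHaar_image_le_lintegral_abs_det_fderiv (volume : Measure (ℝ × ℝ))
    (measurableSet_Icc.prod measurableSet_Icc : MeasurableSet (Icc (0 : ℝ) 1 ×ˢ Icc 0 B.ℓ))
    (fun z _ => (B.hasFDerivAt_devCone hp z).hasFDerivWithinAt)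
  have h2 : ∫⁻ z in Icc (0 : ℝ) 1 ×ˢ Icc 0 B.ℓ, ENNReal.ofReal |(B.devCone' p z).det| =
      ENNReal.ofReal (∫ z in Icc (0 : ℝ) 1 ×ˢ Icc 0 B.ℓ,
        z.1 * parallelogramArea (B.J z.2 - p) (B.T z.2)) := by
    rw [ofReal_integral_eq_lintegral_ofReal]
    · refine setLIntegral_congr_fun (measurableSet_Icc.prod measurableSet_Icc) fun z hz => ?_
      rw [B.det_devCone' hp, abs_of_nonneg (mul_nonneg hz.1.1 (parallelogramArea_nonneg _ _))]
    · exact cpA.continuousOn.integrableOn_compact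
        (isCompact_Icc.prod isCompact_Icc)
    · exact (ae_restrict_iff' (measurableSet_Icc.prod measurableSet_Icc)).2
        (Eventually.of_forall fun z hz => mul_nonneg hz.1.1 (parallelogramArea_nonneg _ _))
  rw [h2] at h1
  have hper := B.dev_add hp hΘ 0
  simp only [zero_add, Prod.mk.injEq] at hper
  have h3 := integral_cross_le B.pos (B.hasDerivAt_devX hp) (B.hasDerivAt_devY hp)
    (B.continuous_devX' hp) (B.continuous_devY' hp) hper.1 hper.2 (B.devX'_sq_add hp)
  simp only [B.devX_mul_devY' hp] at h3
  have h4 : ∫ z in Icc (0 : ℝ) 1 ×ˢ Icc 0 B.ℓ, z.1 * parallelogramArea (B.J z.2 - p) (B.T z.2) =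
      1 / 2 * ∫ t in (0 : ℝ)..B.ℓ, parallelogramArea (B.J t - p) (B.T t) := by
    rw [Measure.volume_eq_prod, setIntegral_prod_mul (fun x : ℝ => x)
      (fun t => parallelogramArea (B.J t - p) (B.T t)), integral_Icc_eq_integral_Ioc,
      integral_Icc_eq_integral_Ioc, ← intervalIntegral.integral_of_le zero_le_one,
      ← intervalIntegral.integral_of_le B.pos.le, integral_id]
    norm_num
  have h5 := ENNReal.toReal_mono ENNReal.ofReal_ne_top h1
  rw [ENNReal.toReal_ofReal (setIntegral_nonneg (measurableSet_Icc.prod measurableSet_Icc)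
    fun z hz => mul_nonneg hz.1.1 (parallelogramArea_nonneg _ _)), h4] at h5
  refine h5.trans ?_
  have : B.ℓ ^ 2 / (4 * Real.pi) = 1 / 2 * (B.ℓ ^ 2 / (2 * Real.pi)) := by
    field_simp; ring
  rw [this]
  gcongr

/-- The total angle is $2\pi$, so at positive angular speed the polar angle determines the
parameter. Parameters of zero angular speed are left out: they contribute no area to the cone. -/
theorem injOn_devCone (B : UnitSpeedLoop L γ) {p : Space3} (hp : p ∉ range B.J)
    (hΘ : B.coneAngle p B.ℓ = 2 * Real.pi) :
    InjOn (B.devCone p) {z | z.1 ∈ Ioc (0 : ℝ) 1 ∧ z.2 ∈ Ioc 0 B.ℓ ∧ 0 < B.coneSpeed p z.2} := by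
  rintro ⟨r, t⟩ ⟨hr, ht, hφ⟩ ⟨r', t'⟩ ⟨hr', ht', hφ'⟩ h
  simp only at hr ht hφ hr' ht' hφ'
  simp only [devCone, devX, devY, Prod.mk.injEq, ← mul_assoc] at h
  obtain ⟨h1, k, hk⟩ := exists_int_of_polar_eq (mul_pos hr.1 (B.norm_J_sub_pos hp t))
    (mul_pos hr'.1 (B.norm_J_sub_pos hp t')) h.1 h.2
  have bd : ∀ s ∈ Ioc 0 B.ℓ, 0 < B.coneSpeed p s →
      0 < B.coneAngle p s ∧ B.coneAngle p s ≤ 2 * Real.pi := fun s hs hφs => by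
    constructor
    · rw [← B.coneAngle_zero p]
      exact B.coneAngle_lt hp hs.1 ⟨hs.1.le, le_rfl⟩ hφs
    · rw [← hΘ]; exact B.coneAngle_mono hp hs.2
  obtain ⟨b1, b2⟩ := bd t ht hφ
  obtain ⟨b3, b4⟩ := bd t' ht' hφ'
  have hπ := Real.pi_pos
  have hk0 : k = 0 := by
    have k1 : (-1 : ℝ) < k := by by_contra! hh; nlinarith
    have k2 : (k : ℝ) < 1 := by by_contra! hh; nlinarith
    have k3 : -1 < k := by exact_mod_cast k1
    have k4 : k < 1 := by exact_mod_cast k2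
    omega
  rw [hk0, Int.cast_zero, zero_mul, add_zero] at hk
  have htt : t = t' := by
    rcases lt_trichotomy t t' with hlt | heq | hlt
    · exact absurd hk (B.coneAngle_lt hp hlt ⟨le_rfl, hlt.le⟩ hφ).ne
    · exact heq
    · exact absurd hk (B.coneAngle_lt hp hlt ⟨le_rfl, hlt.le⟩ hφ').ne'
  subst htt
  rw [mul_left_inj' (B.norm_J_sub_pos hp t).ne'] at h1
  rw [h1]

/-- The developing map does not decrease distances to the curve. -/
theorem norm_cone_sub_sq_le (B : UnitSpeedLoop L γ) {p : Space3} (hp : p ∉ range B.J)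
    (hΘ : B.coneAngle p B.ℓ = 2 * Real.pi) {r t t' : ℝ} (hr : 0 ≤ r) (ht : t ∈ Icc 0 B.ℓ)
    (ht' : t' ∈ Icc 0 B.ℓ) : ‖p + r • (B.J t - p) - B.J t'‖ ^ 2 ≤
      (r * B.devX p t - B.devX p t') ^ 2 + (r * B.devY p t - B.devY p t') ^ 2 := by
  -- The angle in space is at most the developed angle along either of the two arcs, hence at most
  -- the smaller of the two, which is at most $\pi$. Its cosine is therefore at least that of the
  -- developed angle, and the law of cosines concludes.
  have key : ∀ {t t' : ℝ}, t ∈ Icc 0 B.ℓ → t' ∈ Icc 0 B.ℓ → t ≤ t' →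
      Real.cos (B.coneAngle p t' - B.coneAngle p t) ≤
        Real.cos (InnerProductGeometry.angle (B.J t - p) (B.J t' - p)) := by
    intro t t' ht ht' htt
    have h1 := B.angle_le_integral_coneSpeed hp htt
    have h2 := B.angle_le_integral_coneSpeed hp (show t' ≤ t + B.ℓ by linarith [ht.1, ht'.2])
    rw [← B.coneAngle_sub hp] at h1 h2
    rw [B.coneAngle_add hp hΘ, B.periodic, InnerProductGeometry.angle_comm] at h2
    have h0 := InnerProductGeometry.angle_nonneg (B.J t - p) (B.J t' - p)
    rcases le_total (B.coneAngle p t' - B.coneAngle p t) Real.pi with h | h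
    · exact Real.cos_le_cos_of_nonneg_of_le_pi h0 h h1
    · rw [← Real.cos_two_pi_sub (B.coneAngle p t' - B.coneAngle p t)]
      exact Real.cos_le_cos_of_nonneg_of_le_pi h0 (by linarith) (by linarith)
  have hcos : Real.cos (B.coneAngle p t' - B.coneAngle p t) ≤
      Real.cos (InnerProductGeometry.angle (B.J t - p) (B.J t' - p)) := by
    rcases le_total t t' with h | h
    · exact key ht ht' h
    · rw [InnerProductGeometry.angle_comm, ← Real.cos_neg, neg_sub]
      exact key ht' ht h
  have e1 : p + r • (B.J t - p) - B.J t' = r • (B.J t - p) - (B.J t' - p) := by abel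
  have e2 := InnerProductGeometry.cos_angle_mul_norm_mul_norm (B.J t - p) (B.J t' - p)
  rw [e1, norm_sub_sq_real, norm_smul, real_inner_smul_left, mul_pow, Real.norm_eq_abs, sq_abs,
    ← e2, devX, devX, devY, devY]
  set R := ‖B.J t - p‖
  set R' := ‖B.J t' - p‖
  rw [Real.cos_sub] at hcos
  have hRR : 0 ≤ r * (R * R') := by positivity
  have h3 := mul_le_mul_of_nonneg_left hcos hRR
  have h4 := Real.cos_sq_add_sin_sq (B.coneAngle p t)
  have h5 := Real.cos_sq_add_sin_sq (B.coneAngle p t')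
  have e3 : (r * (R * Real.cos (B.coneAngle p t)) - R' * Real.cos (B.coneAngle p t')) ^ 2 +
      (r * (R * Real.sin (B.coneAngle p t)) - R' * Real.sin (B.coneAngle p t')) ^ 2 =
      r ^ 2 * R ^ 2 + R' ^ 2 - 2 * (r * (R * R') * (Real.cos (B.coneAngle p t') *
        Real.cos (B.coneAngle p t) + Real.sin (B.coneAngle p t') * Real.sin (B.coneAngle p t))) := by
    linear_combination (r ^ 2 * R ^ 2) * h4 + R' ^ 2 * h5
  rw [e3]
  linarith

/-- Every point of the plane is on a ray through a point of the developed curve. -/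
theorem exists_dev_eq_smul (B : UnitSpeedLoop L γ) {p : Space3} (hp : p ∉ range B.J)
    (hΘ : B.coneAngle p B.ℓ = 2 * Real.pi) (y : ℝ × ℝ) :
    y ∈ B.devCone p '' (Icc 0 1 ×ˢ Icc 0 B.ℓ) ∨
      ∃ m ∈ Icc (0 : ℝ) 1, ∃ t ∈ Icc 0 B.ℓ, (m * y.1, m * y.2) = (B.devX p t, B.devY p t) := by
  set z : ℂ := ⟨y.1, y.2⟩ with hz
  have hy1 : y.1 = ‖z‖ * Real.cos z.arg := (Complex.norm_mul_cos_arg z).symm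
  have hy2 : y.2 = ‖z‖ * Real.sin z.arg := (Complex.norm_mul_sin_arg z).symm
  have hπ := Real.pi_pos
  have hneg : B.coneAngle p (-B.ℓ) = -(2 * Real.pi) := by
    have := B.coneAngle_add hp hΘ (-B.ℓ)
    rw [neg_add_cancel, B.coneAngle_zero] at this
    linarith
  -- The developed angle attains every value in $[-2\pi,2\pi]$, so the ray through `y` meets the
  -- developed curve; comparing distances to the origin decides between the two cases.
  obtain ⟨s, -, hs⟩ := intermediate_value_Icc (a := -B.ℓ) (b := B.ℓ) (by linarith [B.pos])
    (B.continuous_coneAngle hp).continuousOn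
    (show z.arg ∈ Icc (B.coneAngle p (-B.ℓ)) (B.coneAngle p B.ℓ) by
      rw [hneg, hΘ]
      exact ⟨by linarith [Complex.neg_pi_lt_arg z], by linarith [Complex.arg_le_pi z]⟩)
  obtain ⟨t, ht, hst⟩ := (B.dev_add hp hΘ).exists_mem_Ico B.pos s 0
  rw [zero_add] at ht
  have hR := B.norm_J_sub_pos hp s
  have hX : B.devX p t = ‖B.J s - p‖ * Real.cos z.arg := by
    rw [← hs]; exact (congrArg Prod.fst hst).symm
  have hY : B.devY p t = ‖B.J s - p‖ * Real.sin z.arg := by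
    rw [← hs]; exact (congrArg Prod.snd hst).symm
  have ht' : t ∈ Icc 0 B.ℓ := ⟨ht.1, ht.2.le⟩
  rcases le_total ‖z‖ ‖B.J s - p‖ with h | h
  · refine Or.inl ⟨(‖z‖ / ‖B.J s - p‖, t), ⟨⟨by positivity, (div_le_one hR).2 h⟩, ht'⟩, ?_⟩
    refine Prod.ext ?_ ?_
    · simp only [devCone]; rw [hX, hy1]; field_simp
    · simp only [devCone]; rw [hY, hy2]; field_simp
  · have hz0 : 0 < ‖z‖ := hR.trans_le h
    refine Or.inr ⟨‖B.J s - p‖ / ‖z‖, ⟨by positivity, (div_le_one hz0).2 h⟩, t, ht', ?_⟩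
    refine Prod.ext ?_ ?_
    · simp only; rw [hX, hy1]; field_simp
    · simp only; rw [hY, hy2]; field_simp

/-- A point which is both in the developed cone and beyond the developed curve is on the
developed curve. -/
theorem exists_dev_eq (B : UnitSpeedLoop L γ) {p : Space3} (hp : p ∉ range B.J)
    (hΘ : B.coneAngle p B.ℓ = 2 * Real.pi) {l t m t' : ℝ} (hl : l ∈ Icc (0 : ℝ) 1)
    (hm : m ∈ Icc (0 : ℝ) 1) (h1 : m * (l * B.devX p t) = B.devX p t')
    (h2 : m * (l * B.devY p t) = B.devY p t') :
    ∃ s, l * B.devX p t = B.devX p s ∧ l * B.devY p t = B.devY p s := by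
  have hR := B.norm_J_sub_pos hp t
  have hR' := B.norm_J_sub_pos hp t'
  have hml : 0 < m * l := by
    refine lt_of_le_of_ne (mul_nonneg hm.1 hl.1) fun h0 => ?_
    rw [← mul_assoc, ← h0, zero_mul, devX] at h1
    rw [← mul_assoc, ← h0, zero_mul, devY] at h2
    have h3 := (mul_eq_zero.1 h1.symm).resolve_left hR'.ne'
    have h4 := (mul_eq_zero.1 h2.symm).resolve_left hR'.ne'
    have h5 := Real.cos_sq_add_sin_sq (B.coneAngle p t')
    rw [h3, h4] at h5
    norm_num at h5
  simp only [devX, devY, ← mul_assoc] at h1 h2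
  obtain ⟨h3, k, hk⟩ := exists_int_of_polar_eq (mul_pos hml hR) hR' h1 h2
  have ha : B.coneAngle p (t' - -k * B.ℓ) = B.coneAngle p t := by
    have := B.coneAngle_sub_int_mul hp hΘ t' (-k)
    push_cast at this
    rw [this, hk]; ring
  have hJ : B.J (t' - -k * B.ℓ) = B.J t' := by
    have := B.periodic.sub_int_mul_eq (-k) (x := t')
    push_cast at this
    exact this
  -- `u` has the same developed angle as `t`, so by monotonicity this angle is constant between
  -- them. The radius takes the values `m * l` and `1` times $|J(t)-p|$ at the ends, hence the value
  -- `l` times it in between.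
  set u := t' - -k * B.ℓ
  have cJ := B.continuous_J
  have hmem : l * ‖B.J t - p‖ ∈ uIcc ‖B.J u - p‖ ‖B.J t - p‖ := by
    rw [hJ, ← h3]
    refine mem_uIcc.2 (Or.inl ⟨?_, ?_⟩)
    · rw [mul_assoc]
      exact mul_le_of_le_one_left (mul_nonneg hl.1 hR.le) hm.2
    · exact mul_le_of_le_one_left hR.le hl.2
  obtain ⟨s, hs, hs'⟩ := intermediate_value_uIcc (f := fun s => ‖B.J s - p‖)
    (Continuous.continuousOn (by fun_prop)) hmem
  have hθ : B.coneAngle p s = B.coneAngle p t := by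
    rcases mem_uIcc.1 hs with ⟨g1, g2⟩ | ⟨g1, g2⟩
    · exact le_antisymm (B.coneAngle_mono hp g2) (ha ▸ B.coneAngle_mono hp g1)
    · exact le_antisymm (ha ▸ B.coneAngle_mono hp g2) (B.coneAngle_mono hp g1)
  simp only at hs'
  exact ⟨s, by rw [devX, devX, hθ, hs', mul_assoc], by rw [devY, devY, hθ, hs', mul_assoc]⟩

/-- The unit disc around a point of the developed cone at distance at least one from the developed
curve is contained in the developed cone. -/
theorem disc_subset_devCone (B : UnitSpeedLoop L γ) {p : Space3} (hp : p ∉ range B.J)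
    (hΘ : B.coneAngle p B.ℓ = 2 * Real.pi) {a : ℝ × ℝ}
    (ha : a ∈ B.devCone p '' (Icc 0 1 ×ˢ Icc 0 B.ℓ))
    (hd : ∀ t ∈ Icc 0 B.ℓ, 1 ≤ (a.1 - B.devX p t) ^ 2 + (a.2 - B.devY p t) ^ 2) {u v : ℝ}
    (huv : u ^ 2 + v ^ 2 ≤ 1) :
    (a.1 + u, a.2 + v) ∈ B.devCone p '' (Icc 0 1 ×ˢ Icc 0 B.ℓ) := by
  by_contra hb
  have cX := B.continuous_devX hp
  have cY := B.continuous_devY hp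
  have hΩ : IsClosed (B.devCone p '' (Icc 0 1 ×ˢ Icc 0 B.ℓ)) :=
    ((isCompact_Icc.prod isCompact_Icc).image (B.continuous_devCone hp)).isClosed
  have cf : Continuous fun s : ℝ => (a.1 + s * u, a.2 + s * v) := by fun_prop
  -- `T` is the set of times at which the segment from `a` is on or beyond the developed curve. It
  -- is closed by compactness and covers the unit interval together with the times spent in the
  -- developed cone; by connectedness they share a time, at which the segment is on the developed
  -- curve.
  obtain ⟨T, hT⟩ : ∃ T : Set ℝ, T = Prod.fst '' ((Icc 0 1 ×ˢ (Icc 0 1 ×ˢ Icc 0 B.ℓ)) ∩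
    {x : ℝ × ℝ × ℝ | (x.2.1 * (a.1 + x.1 * u), x.2.1 * (a.2 + x.1 * v)) =
      (B.devX p x.2.2, B.devY p x.2.2)}) := ⟨_, rfl⟩
  have hTc : IsClosed T := by
    rw [hT]
    refine (IsCompact.image ?_ continuous_fst).isClosed
    exact (isCompact_Icc.prod (isCompact_Icc.prod isCompact_Icc)).inter_right
      (isClosed_eq (by fun_prop) (by fun_prop))
  have hTm : ∀ {s m t : ℝ}, s ∈ Icc (0 : ℝ) 1 → m ∈ Icc (0 : ℝ) 1 → t ∈ Icc 0 B.ℓ →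
      (m * (a.1 + s * u), m * (a.2 + s * v)) = (B.devX p t, B.devY p t) → s ∈ T := by
    intro s m t hs hm ht h
    rw [hT]
    exact ⟨(s, m, t), ⟨⟨hs, hm, ht⟩, h⟩, rfl⟩
  obtain ⟨s, hs, ⟨⟨l, t⟩, ⟨hl, ht⟩, hlt⟩, hsT⟩ := isPreconnected_closed_iff.1
    (isPreconnected_Icc (a := (0 : ℝ)) (b := 1)) _ T (hΩ.preimage cf) hTc
    (fun s hs => by
      rcases B.exists_dev_eq_smul hp hΘ (a.1 + s * u, a.2 + s * v) with h | ⟨m, hm, t, ht, h⟩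
      · exact Or.inl h
      · exact Or.inr (hTm hs hm ht h))
    ⟨0, by simp, by simpa using ha⟩
    (by
      rcases B.exists_dev_eq_smul hp hΘ (a.1 + u, a.2 + v) with h | ⟨m, hm, t, ht, h⟩
      · exact absurd h hb
      · exact ⟨1, by simp, hTm (by simp) hm ht (by simpa using h)⟩)
  rw [hT] at hsT
  obtain ⟨⟨s', m, t'⟩, ⟨⟨-, hm, -⟩, hmt⟩, hss⟩ := hsT
  simp only at hss hm
  subst hss
  simp only [devCone, Prod.mk.injEq] at hlt
  have hmt' := Prod.mk.inj hmt
  simp only at hmt'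
  rw [← hlt.1, ← hlt.2] at hmt'
  obtain ⟨q, hq1, hq2⟩ := B.exists_dev_eq hp hΘ hl hm hmt'.1 hmt'.2
  rw [hlt.1] at hq1
  rw [hlt.2] at hq2
  obtain ⟨q', hq', hqq⟩ := (B.dev_add hp hΘ).exists_mem_Ico B.pos q 0
  rw [zero_add] at hq'
  have hqq' := Prod.mk.inj hqq
  rw [hqq'.1] at hq1
  rw [hqq'.2] at hq2
  have h1 := hd q' ⟨hq'.1, hq'.2.le⟩
  rw [← hq1, ← hq2] at h1
  have h2 : 1 ≤ s' ^ 2 * (u ^ 2 + v ^ 2) := by linarith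
  -- A point of the curve is at distance at least one from `a`, so the crossing can only be the end
  -- of the segment; but then the end is on the curve, hence in the developed cone.
  have h3 : s' = 1 := by
    refine le_antisymm hs.2 ?_
    by_contra! hlt1
    have : s' ^ 2 < 1 := by nlinarith [hs.1]
    nlinarith [sq_nonneg u, sq_nonneg v]
  apply hb
  rw [h3, one_mul] at hq1 hq2
  exact ⟨(1, q'), ⟨by simp, hq'.1, hq'.2.le⟩, by
    rw [devCone]; simp only [one_mul]; rw [← hq1, ← hq2]⟩

/-- A curve is long if a set at distance at least one meets every cone over the curve in a large
area. -/
theorem sq_sqrt_add_sqrt_pi_le_length (B : UnitSpeedLoop L γ) (hB : range γ ⊆ L) {S : Set Space3}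
    (hSm : MeasurableSet S) (hS : ∀ y ∈ S, ∀ t, 1 ≤ ‖y - B.J t‖) {F : ℝ} (hF0 : 0 < F)
    (hF : ∀ p, F ≤ ∫ z in (Ioc 0 1 ×ˢ Ioc 0 B.ℓ) ∩
      (fun z : ℝ × ℝ => p + z.1 • (B.J z.2 - p)) ⁻¹' S,
        z.1 * parallelogramArea (B.J z.2 - p) (B.T z.2)) :
    (√F + √Real.pi) ^ 2 ≤ B.ℓ ^ 2 / (4 * Real.pi) := by
  obtain ⟨p, hp, hΘ⟩ := B.exists_coneAngle_eq hB
  replace hΘ : B.coneAngle p B.ℓ = 2 * Real.pi := hΘ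
  have cJ := B.continuous_J
  have cT := B.continuous_T
  have cpA : Continuous fun z : ℝ × ℝ => z.1 * parallelogramArea (B.J z.2 - p) (B.T z.2) :=
    continuous_fst.mul (continuous_parallelogramArea (by fun_prop) (by fun_prop))
  have cM : Continuous fun z : ℝ × ℝ => p + z.1 • (B.J z.2 - p) := by fun_prop
  obtain ⟨E₀, hE₀⟩ : ∃ E₀ : Set (ℝ × ℝ), E₀ = (Ioc 0 1 ×ˢ Ioc 0 B.ℓ) ∩
      (fun z : ℝ × ℝ => p + z.1 • (B.J z.2 - p)) ⁻¹' S := ⟨_, rfl⟩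
  -- Dropping the parameters of zero angular speed does not change the area and makes the
  -- development injective.
  obtain ⟨E, hE⟩ : ∃ E : Set (ℝ × ℝ), E = E₀ ∩ {z | 0 < B.coneSpeed p z.2} := ⟨_, rfl⟩
  have mE₀ : MeasurableSet E₀ := by
    rw [hE₀]; exact (measurableSet_Ioc.prod measurableSet_Ioc).inter (cM.measurable hSm)
  have mE : MeasurableSet E := by
    rw [hE]
    exact mE₀.inter (measurableSet_lt measurable_const
      ((B.continuous_coneSpeed hp).measurable.comp measurable_snd))
  have hEsub : E ⊆ E₀ := by rw [hE]; exact inter_subset_left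
  have hE₀m : ∀ z ∈ E₀, z.1 ∈ Ioc (0 : ℝ) 1 ∧ z.2 ∈ Ioc 0 B.ℓ ∧
      p + z.1 • (B.J z.2 - p) ∈ S := fun z hz => by
    rw [hE₀] at hz; exact ⟨hz.1.1, hz.1.2, hz.2⟩
  have hφ : ∀ z ∈ E, 0 < B.coneSpeed p z.2 := fun z hz => by
    rw [hE] at hz; exact hz.2
  have hF1 : F ≤ ∫ z in E, z.1 * parallelogramArea (B.J z.2 - p) (B.T z.2) := by
    have h := hF p
    rw [← hE₀] at h
    rwa [setIntegral_eq_of_subset_of_forall_sdiff_eq_zero mE₀ hEsub (fun z hz => ?_)] at h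
    have h0 : ¬ 0 < B.coneSpeed p z.2 := fun h0 => hz.2 (by rw [hE]; exact ⟨hz.1, h0⟩)
    have h1 : parallelogramArea (B.J z.2 - p) (B.T z.2) = 0 := by
      refine le_antisymm ?_ (parallelogramArea_nonneg _ _)
      by_contra! h2
      exact h0 (div_pos h2 (pow_pos (B.norm_J_sub_pos hp z.2) 2))
    rw [h1, mul_zero]
  have hE' : E ⊆ {z | z.1 ∈ Ioc (0 : ℝ) 1 ∧ z.2 ∈ Ioc 0 B.ℓ ∧ 0 < B.coneSpeed p z.2} :=
    fun z hz => ⟨(hE₀m z (hEsub hz)).1, (hE₀m z (hEsub hz)).2.1, hφ z hz⟩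
  have hinj : InjOn (B.devCone p) E := (B.injOn_devCone hp hΘ).mono hE'
  have hvol := lintegral_abs_det_fderiv_eq_addHaar_image (volume : Measure (ℝ × ℝ)) mE
    (fun z _ => (B.hasFDerivAt_devCone hp z).hasFDerivWithinAt) hinj
  have hint : IntegrableOn (fun z : ℝ × ℝ => z.1 * parallelogramArea (B.J z.2 - p) (B.T z.2)) E := by
    refine (cpA.continuousOn.integrableOn_compact
      ((isCompact_Icc (a := (0 : ℝ)) (b := 1)).prod (isCompact_Icc (a := 0) (b := B.ℓ)))).mono_set
      fun z hz => ?_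
    obtain ⟨h1, h2, -⟩ := hE₀m z (hEsub hz)
    exact mk_mem_prod (Ioc_subset_Icc_self h1) (Ioc_subset_Icc_self h2)
  have hvol2 : volume (B.devCone p '' E) = ENNReal.ofReal
      (∫ z in E, z.1 * parallelogramArea (B.J z.2 - p) (B.T z.2)) := by
    rw [← hvol, ofReal_integral_eq_lintegral_ofReal hint]
    · refine setLIntegral_congr_fun mE fun z hz => ?_
      rw [B.det_devCone' hp, abs_of_nonneg (mul_nonneg (hE₀m z (hEsub hz)).1.1.le
        (parallelogramArea_nonneg _ _))]
    · exact (ae_restrict_iff' mE).2 (Eventually.of_forall fun z hz =>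
        mul_nonneg (hE₀m z (hEsub hz)).1.1.le (parallelogramArea_nonneg _ _))
  -- The disc condition holds because points of `S` are at distance at least one from the curve in
  -- space, and their developments are at least as far from the developed curve.
  have hBM := sq_sqrt_add_sqrt_pi_le (A := B.devCone p '' E)
    (Ω := B.devCone p '' (Icc 0 1 ×ˢ Icc 0 B.ℓ))
    (mE.image_of_continuousOn_injOn (B.continuous_devCone hp).continuousOn hinj)
    ((isCompact_Icc.prod isCompact_Icc).image (B.continuous_devCone hp))
    (by rw [hvol2]; simpa using hF0.trans_le hF1) (by
      rintro _ ⟨z, hz, rfl⟩ u v huv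
      obtain ⟨h1, h2, h3⟩ := hE₀m z (hEsub hz)
      refine B.disc_subset_devCone hp hΘ
        (mem_image_of_mem _ ⟨Ioc_subset_Icc_self h1, Ioc_subset_Icc_self h2⟩) (fun t ht => ?_) huv
      refine le_trans ?_ (B.norm_cone_sub_sq_le hp hΘ h1.1.le (Ioc_subset_Icc_self h2) ht)
      exact one_le_pow₀ (hS _ h3 t))
  refine le_trans ?_ (hBM.trans (B.volume_devCone_le hp hΘ))
  rw [hvol2, ENNReal.toReal_ofReal (hF0.le.trans hF1)]
  gcongr

end UnitSpeedLoop

/-! ### Assembly: disjoint tubes around the components of `J`. -/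

/-- The unit neighbourhoods of the components in `J` are disjoint from each other and at distance at
least one from component `k`, so every cone over that component meets their union in area at least
$\pi\Lambda$. The resulting inequality $(\sqrt{\pi\Lambda}+\sqrt\pi)^2\le\ell^2/4\pi$ is the claim
squared. -/
theorem OrientedLink.two_pi_add_le_length {ι : Type*} (L : OrientedLink ι)
    (hL : 1 ≤ thickness L.carrier) (k : ι) (J : Finset ι) (hk : k ∉ J) :
    ENNReal.ofReal (2 * Real.pi + 2 * Real.pi * √|L.totalLinkingNumber J k|) ≤
      (L.component k).length := by
  have hU := unitThick_of_one_le_thickness hL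
  have hsub : ∀ i, range (L.component i) ⊆ L.carrier := fun i =>
    subset_iUnion (fun i => range (L.component i)) i
  have loop : ∀ i, Nonempty (UnitSpeedLoop L.carrier (L.component i)) := fun i =>
    hU.nonempty_unitSpeedLoop (L.injective i) (hsub i)
  have A := fun i => (loop i).some
  have hdisj : ∀ {i j}, i ≠ j → Disjoint (range (L.component i)) (range (L.component j)) :=
    fun hij => L.disjoint hij
  rw [(A k).length_eq]
  refine ENNReal.ofReal_le_ofReal ?_
  have hπ := Real.pi_pos
  -- The areas bound the sum of the absolute values of the linking numbers, which is at least the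
  -- absolute value of their sum for any orientations.
  set Λ := ∑ j ∈ J, |linkingNumber (L.component j) (L.component k)| with hΛ
  have hΛ0 : 0 ≤ Λ := Finset.sum_nonneg fun j _ => abs_nonneg _
  have htot : |L.totalLinkingNumber J k| ≤ Λ := Finset.abs_sum_le_sum_abs _ _
  refine le_trans (b := 2 * Real.pi + 2 * Real.pi * √Λ) (by gcongr) ?_
  -- The Brunn–Minkowski argument needs a set of positive area, so the unlinked case is treated by
  -- curvature.
  rcases hΛ0.eq_or_lt with h0 | hpos
  · rw [← h0, Real.sqrt_zero, mul_zero, add_zero]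
    exact (A k).two_pi_le
  have hne : ∀ j ∈ J, j ≠ k := fun j hj h => hk (h ▸ hj)
  let S : ι → Set Space3 := fun j => {y | Metric.infDist y (range (A j).J) < 1}
  have mS : ∀ j, MeasurableSet (S j) := fun j =>
    measurableSet_lt (Metric.continuous_infDist_pt _).measurable measurable_const
  have cJ := (A k).continuous_J
  have cT := (A k).continuous_T
  have main := (A k).sq_sqrt_add_sqrt_pi_le_length (hsub k) (S := ⋃ j ∈ J, S j)
    (F := Real.pi * Λ) (Finset.measurableSet_biUnion J fun j _ => mS j)
    (fun y hy t => by
      obtain ⟨j, hj, hyj⟩ := mem_iUnion₂.1 hy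
      rw [← dist_eq_norm]
      exact ((A j).one_le_infDist (A k) (hsub k) (hsub j) (hdisj (hne j hj)) hyj).trans
        (Metric.infDist_le_dist_of_mem (mem_range_self t)))
    (mul_pos hπ hpos)
    (fun p => by
      have cM : Continuous fun z : ℝ × ℝ => p + z.1 • ((A k).J z.2 - p) := by fun_prop
      have cpA : Continuous fun z : ℝ × ℝ =>
          z.1 * parallelogramArea ((A k).J z.2 - p) ((A k).T z.2) :=
        continuous_fst.mul (continuous_parallelogramArea (by fun_prop) (by fun_prop))
      rw [preimage_iUnion₂, inter_iUnion₂, integral_biUnion_finset J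
        (fun j _ => (measurableSet_Ioc.prod measurableSet_Ioc).inter (cM.measurable (mS j)))
        (fun i _ j _ hij => ?_) (fun j _ => ?_), hΛ, Finset.mul_sum]
      · exact Finset.sum_le_sum fun j hj =>
          (A j).abs_linkingNumber_le (A k) (hsub j) (hsub k) (hdisj (hne j hj)) p
      · refine disjoint_left.2 fun z hzi hzj => ?_
        have h1 := (A i).one_le_infDist (A j) (hsub j) (hsub i) (hdisj hij) hzi.2
        exact absurd hzj.2 (not_lt.2 h1)
      · exact (cpA.continuousOn.integrableOn_compact ((isCompact_Icc (a := (0 : ℝ)) (b := 1)).prod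
          (isCompact_Icc (a := 0) (b := (A k).ℓ)))).mono_set fun z hz =>
            mk_mem_prod (Ioc_subset_Icc_self hz.1.1) (Ioc_subset_Icc_self hz.1.2))
  rw [Real.sqrt_mul hπ.le, le_div_iff₀ (by positivity)] at main
  have hsq : (2 * Real.pi + 2 * Real.pi * √Λ) ^ 2 ≤ (A k).ℓ ^ 2 := by
    refine le_trans (le_of_eq ?_) main
    linear_combination (-4 * Real.pi * (√Λ + 1) ^ 2) * Real.sq_sqrt hπ.le
  exact le_of_sq_le_sq hsq (A k).pos.le

end

theorem mainTheorem4 {ι : Type*} [Finite ι] (L : OrientedLink ι)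
    (hL : 1 ≤ thickness L.carrier) (k : ι) (J : Finset ι) (hk : k ∉ J) :
    ENNReal.ofReal
        (2 * Real.pi + 2 * Real.pi * Real.sqrt |L.totalLinkingNumber J k|)
      ≤ (L.component k).length :=
  L.two_pi_add_le_length hL k J hk
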